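/- Let $d>1$. Let $T^+(d)$ be the set of real upper triangular $d\times d$ matrices with positive diagonal entries, and let $G_{\mathcal N}=T^+(d)\times\mathbb R^d$ be the topological group (with the topology of a subset of a Euclidean space) whose product is $(V_2,m_2)\cdot(V_1,m_1)=(V_2V_1,\;V_2m_1+m_2)$. Let $\mathcal Y=\mathbb R^d$ and let $\Theta$ be the set of pairs $\theta=(U,\mu)$ with $U\in T^+(d)$ and $\mu\in\mathbb R^d$, both with their Borel $\sigma$-algebras, and let $p(\cdot\mid\theta)=\mathcal N(\mu,UU^{T})$ be the multivariate normal likelihood (so that $U$ is the upper triangular Cholesky factor of the covariance matrix). Let $G$ be a $\sigma$-compact locally compact topological group with its Borel $\sigma$-algebra, acting on $\mathcal Y$ and on $\Theta$, such that 1. the action $\alpha_{\mathcal Y}:G\times\mathcal Y\to\mathcal Y$ is measurable; 2. the action $\alpha_\Theta:G\times\Theta\to\Theta$ is measurable and simply transitive (for all $\theta_1,\theta_2\in\Theta$ there is exactly one $g\in G$ with $g\theta_1=\theta_2$); 3. $p(A\mid\theta)=p(gA\mid g\theta)$ for all $g\in G$, $\theta\in\Theta$ and all Borel sets $A\subseteq\mathcal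 Y$. Then: * $G$ is isomorphic to $G_{\mathcal N}$ as a topological group; * $\alpha_{\mathcal Y}$ acts affinely on $\mathbb R^d$, up to null sets: there is a homomorphism $\rho$ from $G$ to the group of invertible affine maps of $\mathbb R^d$ such that, for every $g\in G$, $gy=\rho(g)(y)$ for Lebesgue-almost every $y\in\mathbb R^d$; and, for every $g\in G$ for which $y\mapsto gy$ is continuous, $gy=\rho(g)(y)$ for every $y\in\mathbb R^d$; * $\alpha_{\mathcal Y}$ is not free: there are $g\in G$ different from the identity and $y\in\mathcal Y$ with $gy=y$. -/

import Mathlib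

open MeasureTheory ProbabilityTheory Matrix

noncomputable section

/-- Real upper triangular `d × d` matrices with positive diagonal entries. -/
structure PosUpper (d : ℕ) : Type where
  toMatrix : Matrix (Fin d) (Fin d) ℝ
  upper : ∀ i j, j < i → toMatrix i j = 0
  pos : ∀ i, 0 < toMatrix i i

namespace PosUpper

variable {d : ℕ}

/-- The topology of entrywise convergence. -/
instance : TopologicalSpace (PosUpper d) :=
  TopologicalSpace.induced PosUpper.toMatrix inferInstance

@[ext]
theorem ext {V W : PosUpper d} (h : V.toMatrix = W.toMatrix) : V = W := by
  cases V; cases W; cases h; rfl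

theorem blockTriangular (V : PosUpper d) : V.toMatrix.BlockTriangular id := fun i j h => V.upper i j h

theorem isUnit_det (V : PosUpper d) : IsUnit V.toMatrix.det := by
  rw [Matrix.det_of_isUpperTriangular (V.blockTriangular)]
  exact (Finset.prod_pos fun i _ => V.pos i).ne'.isUnit

theorem inv_blockTriangular (V : PosUpper d) : (V.toMatrix⁻¹).BlockTriangular id := by
  have := V.toMatrix.invertibleOfIsUnitDet V.isUnit_det
  exact Matrix.blockTriangular_inv_of_blockTriangular V.blockTriangular

theorem mul_diag {A B : Matrix (Fin d) (Fin d) ℝ} (hA : A.BlockTriangular id)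
    (hB : B.BlockTriangular id) (i : Fin d) : (A * B) i i = A i i * B i i := by
  rw [Matrix.mul_apply]
  refine Finset.sum_eq_single i (fun j _ hj => ?_) (by simp)
  rcases lt_or_gt_of_ne hj with h | h
  · rw [hA h, zero_mul]
  · rw [hB h, mul_zero]

theorem inv_diag_pos (V : PosUpper d) (i : Fin d) : 0 < V.toMatrix⁻¹ i i := by
  have h := mul_diag V.blockTriangular V.inv_blockTriangular i
  rw [Matrix.mul_nonsing_inv _ V.isUnit_det, Matrix.one_apply_eq] at h
  exact (pos_iff_pos_of_mul_pos (by rw [← h]; exact one_pos)).1 (V.pos i)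

instance : Mul (PosUpper d) :=
  ⟨fun V W => ⟨V.toMatrix * W.toMatrix, fun _ _ h => (V.blockTriangular.mul W.blockTriangular) h, fun i => by
    rw [mul_diag V.blockTriangular W.blockTriangular]; exact mul_pos (V.pos i) (W.pos i)⟩⟩

instance : One (PosUpper d) :=
  ⟨⟨1, fun _ _ h => Matrix.one_apply_ne h.ne', fun i => by simp⟩⟩

instance : Inv (PosUpper d) :=
  ⟨fun V => ⟨V.toMatrix⁻¹, fun _ _ h => V.inv_blockTriangular h, V.inv_diag_pos⟩⟩

@[simp] theorem coe_mul (V W : PosUpper d) : (V * W).toMatrix = V.toMatrix * W.toMatrix := rfl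

@[simp] theorem coe_one : (1 : PosUpper d).toMatrix = 1 := rfl

@[simp] theorem coe_inv (V : PosUpper d) : (V⁻¹).toMatrix = V.toMatrix⁻¹ := rfl

instance : Group (PosUpper d) :=
  Group.ofLeftAxioms (fun _ _ _ => ext (mul_assoc _ _ _)) (fun _ => ext (one_mul _))
    (fun V => ext (Matrix.nonsing_inv_mul _ V.isUnit_det))

end PosUpper

/-- The group `G_𝒩`: pairs `(V, m)` of an upper triangular matrix `V` with positive diagonal and a
vector `m`, with `(V₂, m₂) * (V₁, m₁) = (V₂ V₁, V₂ m₁ + m₂)`. -/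
@[ext]
structure GaussianGroup (d : ℕ) : Type where
  linear : PosUpper d
  shift : EuclideanSpace ℝ (Fin d)

namespace GaussianGroup

variable {d : ℕ}

/-- The topology of `G_𝒩` as a subset of a finite-dimensional real vector space. -/
instance : TopologicalSpace (GaussianGroup d) :=
  TopologicalSpace.induced (fun g => (g.linear, g.shift)) inferInstance

instance : Mul (GaussianGroup d) :=
  ⟨fun g h => ⟨g.linear * h.linear, toEuclideanCLM (𝕜 := ℝ) g.linear.toMatrix h.shift + g.shift⟩⟩

instance : One (GaussianGroup d) := ⟨⟨1, 0⟩⟩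

instance : Inv (GaussianGroup d) :=
  ⟨fun g => ⟨g.linear⁻¹, -toEuclideanCLM (𝕜 := ℝ) (g.linear⁻¹).toMatrix g.shift⟩⟩

instance : Group (GaussianGroup d) :=
  Group.ofLeftAxioms
    (fun a b c => by
      refine GaussianGroup.ext (mul_assoc _ _ _) ?_
      change toEuclideanCLM (𝕜 := ℝ) (a.linear * b.linear).toMatrix c.shift
          + (toEuclideanCLM (𝕜 := ℝ) a.linear.toMatrix b.shift + a.shift)
        = toEuclideanCLM (𝕜 := ℝ) a.linear.toMatrix
            (toEuclideanCLM (𝕜 := ℝ) b.linear.toMatrix c.shift + b.shift) + a.shift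
      simp [add_assoc])
    (fun a => by
      refine GaussianGroup.ext (one_mul _) ?_
      change toEuclideanCLM (𝕜 := ℝ) (1 : PosUpper d).toMatrix a.shift + 0 = a.shift
      simp)
    (fun a => by
      refine GaussianGroup.ext (inv_mul_cancel _) ?_
      change toEuclideanCLM (𝕜 := ℝ) (a.linear⁻¹).toMatrix a.shift
        + -toEuclideanCLM (𝕜 := ℝ) (a.linear⁻¹).toMatrix a.shift = 0
      simp)

end GaussianGroup

/-- The parameter space `Θ` of the (nondegenerate) `d`-dimensional normal distributions: the mean
`μ` and the upper triangular Cholesky factor `U` (with positive diagonal) of the covariance matrix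
`U Uᵀ`. -/
@[ext]
structure NormalParam (d : ℕ) : Type where
  chol : PosUpper d
  mean : EuclideanSpace ℝ (Fin d)

namespace NormalParam

variable {d : ℕ}

instance : TopologicalSpace (NormalParam d) :=
  TopologicalSpace.induced (fun θ => (θ.chol, θ.mean)) inferInstance

instance : MeasurableSpace (NormalParam d) := borel _

instance : BorelSpace (NormalParam d) := ⟨rfl⟩

/-- The multivariate normal likelihood `p(· ∣ θ) = N(μ, U Uᵀ)`. -/
def likelihood (θ : NormalParam d) : Measure (EuclideanSpace ℝ (Fin d)) :=
  multivariateGaussian θ.mean (θ.chol.toMatrix * θ.chol.toMatrixᵀ)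

end NormalParam

/-- For any two points there is exactly one group element taking the first to the second. -/
def IsSimplyTransitive (G X : Type*) [Group G] [MulAction G X] : Prop :=
  ∀ x y : X, ∃! g : G, g • x = y

/-- Only the identity element has a fixed point. -/
def IsFreeAction (G X : Type*) [Group G] [MulAction G X] : Prop :=
  ∀ (g : G) (x : X), g • x = x → g = 1

end

/-! The log-ratio of two normal densities is a quadratic polynomial, and equivariance carries the
log-ratio of one pair of parameters to that of another pair. Both `y i` and `y i ^ 2` are such
log-ratios up to affine rescaling, so each coordinate of `g • y` and its square agree almost
everywhere with quadratics, which forces the coordinate to be affine (`exists_ae_smul_eq_affine`).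
An affine map is determined off a null set, so these maps form a homomorphism `φ` from `G` to block
matrices of size `d + 1`; it is measurable, hence continuous by a Steinhaus argument.

If `T` is the block matrix of `(U, μ)`, then `T * Tᵀ` encodes mean and covariance, and `g` acts on
it through `φ g`. Simple transitivity says that the image `H` of `φ` is closed, meets the orthogonal
group trivially, and attains every `T * Tᵀ` as `h * hᵀ`. The core,
`exists_conj_triangularAffine_subset`, is that such an `H` contains an orthogonal conjugate of the
triangular group. Its Lie algebra is a complement of the skew matrices. Push it along a diagonal
one-parameter group whose weights have distinct differences: by compactness of the orthogonal group,
all leading terms of the Lie algebra lie in one orthogonal conjugate of it. A dimension count then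
puts into that conjugate every diagonal matrix with last entry zero and at least one of `E_ij`,
`E_ji` for each pair; both cannot occur, as their difference is skew. The choice is a total order on
the coordinates, a permutation makes it the usual one, and exponentiation gives the triangular
group. Cholesky factorisation gives equality, and the open mapping theorem gives the isomorphism of
topological groups.

The affine action has nontrivial stabilisers, since the covariance can change while the mean stays.
By Fubini, some `y` has true and affine action agreeing for almost every `g`; comparing `g` with `g
* s` transfers a stabiliser element `s` of `y` to the true action. -/

noncomputable section

open Filter Topology

/-! ### One-parameter subgroups and Lie algebras of closed matrix groups. -/

section MatrixLie

open scoped Matrix.Norms.Operator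
open NormedSpace (exp)

variable {n : Type*} [Fintype n] [DecidableEq n]

/-- Telescoping. It bounds the error accumulated when a factor is replaced by a nearby one in a long
power. -/
theorem norm_pow_sub_pow_le_of_norm_le {𝔸 : Type*} [NormedRing 𝔸] [NormOneClass 𝔸] {A B : 𝔸}
    {M : ℝ} (hM : 1 ≤ M) (hA : ‖A‖ ≤ M) (hB : ‖B‖ ≤ M) (m : ℕ) :
    ‖A ^ m - B ^ m‖ ≤ m * M ^ m * ‖A - B‖ := by
  induction m with
  | zero => simp
  | succ m ih =>
    have h1 : A ^ (m + 1) - B ^ (m + 1) = A ^ m * (A - B) + (A ^ m - B ^ m) * B := by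
      rw [pow_succ, pow_succ]; noncomm_ring
    have h2 : ‖A ^ m‖ ≤ M ^ m := (norm_pow_le _ _).trans (pow_le_pow_left₀ (norm_nonneg _) hA _)
    have h0 : (0 : ℝ) ≤ ‖A - B‖ := norm_nonneg _
    have hMm : (0 : ℝ) ≤ M ^ m := by positivity
    rw [h1]
    calc ‖A ^ m * (A - B) + (A ^ m - B ^ m) * B‖
        ≤ ‖A ^ m * (A - B)‖ + ‖(A ^ m - B ^ m) * B‖ := norm_add_le _ _
      _ ≤ ‖A ^ m‖ * ‖A - B‖ + ‖A ^ m - B ^ m‖ * ‖B‖ := add_le_add (norm_mul_le _ _)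
          (norm_mul_le _ _)
      _ ≤ M ^ m * ‖A - B‖ + (m * M ^ m * ‖A - B‖) * M := by gcongr
      _ ≤ M ^ m * M * ‖A - B‖ + (m * M ^ m * ‖A - B‖) * M := by
          gcongr; exact le_mul_of_one_le_right hMm hM
      _ = _ := by push_cast; ring

theorem tendsto_slope_exp {t : ℕ → ℝ} (ht0 : ∀ k, t k ≠ 0) (ht : Tendsto t atTop (𝓝 0))
    (X : Matrix n n ℝ) : Tendsto (fun k => (t k)⁻¹ • (exp (t k • X) - 1)) atTop (𝓝 X) := by
  have h := (hasDerivAt_exp_smul_const (𝕂 := ℝ) X (0 : ℝ)).tendsto_slope_zero.comp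
    (tendsto_nhdsWithin_iff.2 ⟨ht, Eventually.of_forall ht0⟩)
  simp only [Function.comp_def, zero_add, zero_smul, NormedSpace.exp_zero, one_mul] at h
  exact h

/-- If `A k = 1 + t k • X + o(t k)` then suitable powers of `A k` converge to `exp (s • X)`. -/
theorem tendsto_pow_floor_exp [Nonempty n] {A : ℕ → Matrix n n ℝ} {t : ℕ → ℝ} {X : Matrix n n ℝ}
    (ht0 : ∀ k, 0 < t k) (ht : Tendsto t atTop (𝓝 0))
    (hA : Tendsto (fun k => (t k)⁻¹ • (A k - 1)) atTop (𝓝 X)) {s : ℝ} (hs : 0 ≤ s) :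
    Tendsto (fun k => A k ^ ⌊s / t k⌋₊) atTop (𝓝 (exp (s • X))) := by
  -- The exponential has the same first-order expansion as `A k`, so the two differ by `o(t k)`;
  -- over about `s / t k` factors the total error still vanishes.
  have hB := tendsto_slope_exp (fun k => (ht0 k).ne') ht X
  have hAB : Tendsto (fun k => (t k)⁻¹ * ‖A k - exp (t k • X)‖) atTop (𝓝 0) := by
    have h := (hA.sub hB).norm
    simp only [sub_self, norm_zero] at h
    refine h.congr fun k => ?_
    rw [← smul_sub, norm_smul, Real.norm_of_nonneg (inv_nonneg.2 (ht0 k).le),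
        sub_sub_sub_cancel_right]
  have bound : ∀ {C : ℕ → Matrix n n ℝ},
      Tendsto (fun k => (t k)⁻¹ • (C k - 1)) atTop (𝓝 X) →
      ∀ᶠ k in atTop, ‖C k‖ ≤ 1 + t k * (‖X‖ + 1) := by
    intro C hC
    filter_upwards [hC.norm.eventually (gt_mem_nhds (lt_add_one ‖X‖))] with k hk
    rw [norm_smul, Real.norm_of_nonneg (inv_nonneg.2 (ht0 k).le), inv_mul_lt_iff₀ (ht0 k)] at hk
    calc ‖C k‖ = ‖1 + (C k - 1)‖ := by congr 1; abel
      _ ≤ ‖(1 : Matrix n n ℝ)‖ + ‖C k - 1‖ := norm_add_le _ _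
      _ ≤ _ := by rw [norm_one]; gcongr
  set c := ‖X‖ + 1 with hc
  have hc0 : 0 ≤ c := by positivity
  have hfl : Tendsto (fun k => (⌊s / t k⌋₊ : ℝ) * t k) atTop (𝓝 s) := by
    refine tendsto_of_tendsto_of_tendsto_of_le_of_le (g := fun k => s - t k) (h := fun _ => s)
      (by simpa using (tendsto_const_nhds (x := s)).sub ht) tendsto_const_nhds
      (fun k => ?_) fun k => ?_
    · have := Nat.lt_floor_add_one (s / t k)
      rw [div_lt_iff₀ (ht0 k)] at this
      change s - t k ≤ _
      nlinarith
    · have := Nat.floor_le (div_nonneg hs (ht0 k).le)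
      rwa [le_div_iff₀ (ht0 k)] at this
  have hmain : Tendsto (fun k => exp (t k • X) ^ ⌊s / t k⌋₊) atTop (𝓝 (exp (s • X))) := by
    have hcont : Continuous fun u : ℝ => exp (u • X) :=
      (NormedSpace.exp_continuous).comp (continuous_id.smul continuous_const)
    refine (hcont.continuousAt.tendsto.comp hfl).congr fun k => ?_
    simp only [Function.comp]
    rw [← Matrix.exp_nsmul, ← Nat.cast_smul_eq_nsmul ℝ, smul_smul]
  have hdiff : Tendsto (fun k => A k ^ ⌊s / t k⌋₊ - exp (t k • X) ^ ⌊s / t k⌋₊) atTop (𝓝 0) := by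
    have hz : Tendsto (fun k => s * Real.exp (s * c) * ((t k)⁻¹ * ‖A k - exp (t k • X)‖)) atTop
        (𝓝 0) := by
      simpa using hAB.const_mul (s * Real.exp (s * c))
    refine squeeze_zero_norm' ?_ hz
    filter_upwards [bound hA, bound hB] with k h1 h2
    have hM : 1 ≤ 1 + t k * c := by have := mul_nonneg (ht0 k).le hc0; linarith
    have hfk := Nat.floor_le (div_nonneg hs (ht0 k).le)
    refine (norm_pow_sub_pow_le_of_norm_le hM h1 h2 _).trans ?_
    have h3 : (1 + t k * c) ^ ⌊s / t k⌋₊ ≤ Real.exp (s * c) := by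
      calc (1 + t k * c) ^ ⌊s / t k⌋₊ ≤ (Real.exp (t k * c)) ^ ⌊s / t k⌋₊ := by
            refine pow_le_pow_left₀ (by linarith) ?_ _
            rw [add_comm]; exact Real.add_one_le_exp _
        _ = Real.exp (⌊s / t k⌋₊ * (t k * c)) := by rw [← Real.exp_nat_mul]
        _ ≤ _ := by
            rw [← mul_assoc]
            gcongr
            rwa [le_div_iff₀ (ht0 k)] at hfk
    calc (⌊s / t k⌋₊ : ℝ) * (1 + t k * c) ^ ⌊s / t k⌋₊ * ‖A k - exp (t k • X)‖
        ≤ (s / t k) * Real.exp (s * c) * ‖A k - exp (t k • X)‖ := by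
          have := div_nonneg hs (ht0 k).le
          gcongr
      _ = _ := by ring
  simpa using hdiff.add hmain

end MatrixLie

/-- A set of invertible matrices is closed in the general linear group, sequentially. -/
def ClosedInGL {n : Type*} [Fintype n] [DecidableEq n] (H : Submonoid (Matrix n n ℝ)) : Prop :=
  ∀ (u : ℕ → Matrix n n ℝ) (B : Matrix n n ℝ), (∀ k, u k ∈ H) → Tendsto u atTop (𝓝 B) →
    IsUnit B → B ∈ H

/-- Every element of a submonoid of matrices has an inverse in the submonoid. -/
def HasInverses {n : Type*} [Fintype n] [DecidableEq n] (H : Submonoid (Matrix n n ℝ)) : Prop :=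
  ∀ A ∈ H, IsUnit A ∧ A⁻¹ ∈ H

section LieAlgebra

open NormedSpace (exp)

variable {n : Type*} [Fintype n] [DecidableEq n]

theorem tendsto_inv_nat_succ : Tendsto (fun k : ℕ => ((k : ℝ) + 1)⁻¹) atTop (𝓝 0) := by
  simpa using tendsto_one_div_add_atTop_nhds_zero_nat (𝕜 := ℝ)

theorem tendsto_succ_smul_exp_sub_one (X : Matrix n n ℝ) :
    Tendsto (fun k : ℕ => (((k : ℝ) + 1)⁻¹)⁻¹ • (exp (((k : ℝ) + 1)⁻¹ • X) - 1)) atTop (𝓝 X) :=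
  tendsto_slope_exp (fun k => by positivity) tendsto_inv_nat_succ X

/-- The powers of `A k` stay in `H`, and their limit is an exponential, hence invertible, so
closedness inside the general linear group suffices. Inverses give negative `s`. -/
theorem exp_smul_mem_of_tendsto {H : Submonoid (Matrix n n ℝ)} (hcl : ClosedInGL H)
    (hinv : HasInverses H) {A : ℕ → Matrix n n ℝ} (hAH : ∀ k, A k ∈ H) {t : ℕ → ℝ}
    {X : Matrix n n ℝ} (ht0 : ∀ k, 0 < t k) (ht : Tendsto t atTop (𝓝 0))
    (hA : Tendsto (fun k => (t k)⁻¹ • (A k - 1)) atTop (𝓝 X)) (s : ℝ) : exp (s • X) ∈ H := by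
  rcases isEmpty_or_nonempty n with hn | hn
  · rw [Subsingleton.elim (exp (s • X)) 1]; exact H.one_mem
  have hpos : ∀ s : ℝ, 0 ≤ s → exp (s • X) ∈ H := fun s hs =>
    hcl _ _ (fun k => H.pow_mem (hAH k) _) (tendsto_pow_floor_exp ht0 ht hA hs)
        (Matrix.isUnit_exp _)
  rcases le_total 0 s with hs | hs
  · exact hpos s hs
  · have h := (hinv _ (hpos (-s) (by linarith))).2
    rwa [← Matrix.exp_neg, neg_smul, neg_neg] at h

/-- The Lie algebra of a group of matrices that is closed in the general linear group. -/
def lieSubspace (H : Submonoid (Matrix n n ℝ)) (hcl : ClosedInGL H) (hinv : HasInverses H) :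
    Submodule ℝ (Matrix n n ℝ) where
  carrier := {X | ∀ t : ℝ, exp (t • X) ∈ H}
  zero_mem' := fun t => by simp [H.one_mem]
  smul_mem' := fun c X hX t => by rw [smul_smul]; exact hX _
  add_mem' := by
    intro X Y hX hY t
    -- The curve `exp (uX) * exp (uY)` in `H` has tangent `X + Y`: in `PQ - 1 = (P - 1) + (Q - 1) +
    -- (P - 1)(Q - 1)` the last term is of second order.
    refine exp_smul_mem_of_tendsto hcl hinv
      (A := fun k : ℕ => exp (((k : ℝ) + 1)⁻¹ • X) * exp (((k : ℝ) + 1)⁻¹ • Y))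
      (t := fun k : ℕ => ((k : ℝ) + 1)⁻¹) (fun k => H.mul_mem (hX _) (hY _))
      (fun k => by positivity) tendsto_inv_nat_succ ?_ t
    have h1 := tendsto_succ_smul_exp_sub_one X
    have h2 := tendsto_succ_smul_exp_sub_one Y
    have h3 := (h1.add h2).add (tendsto_inv_nat_succ.smul (h1.mul h2))
    rw [zero_smul, add_zero] at h3
    refine h3.congr fun k => ?_
    have hk : ((k : ℝ) + 1)⁻¹ ≠ 0 := by positivity
    generalize exp (((k : ℝ) + 1)⁻¹ • X) = P
    generalize exp (((k : ℝ) + 1)⁻¹ • Y) = Q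
    generalize ((k : ℝ) + 1)⁻¹ = u at hk
    rw [smul_mul_smul_comm, smul_smul, ← mul_assoc, mul_inv_cancel₀ hk, one_mul, ← smul_add,
      ← smul_add]
    congr 1
    noncomm_ring

theorem eq_of_forall_exp_smul_eq_one {X : Matrix n n ℝ} (h : ∀ t : ℝ, exp (t • X) = 1) : X = 0 := by
  refine tendsto_nhds_unique (tendsto_succ_smul_exp_sub_one X) ?_
  simp [h]

end LieAlgebra

end

/-! ### Tangent directions modulo skew matrices, and degeneration of the Lie algebra. -/

noncomputable section

open Filter Topology

/-- Rescaling two null sequences and a positive null sequence to a nonzero limit. -/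
theorem exists_subseq_rescaled_limit {E : Type*} [NormedAddCommGroup E] [NormedSpace ℝ E]
    [FiniteDimensional ℝ E] {t : ℕ → ℝ} {a b : ℕ → E} (ht0 : ∀ k, 0 < t k)
    (ht : Tendsto t atTop (𝓝 0)) (ha : Tendsto a atTop (𝓝 0)) (hb : Tendsto b atTop (𝓝 0)) :
    ∃ (u : ℕ → ℝ) (φ : ℕ → ℕ) (c : ℝ) (x y : E), (∀ k, 0 < u k) ∧ Tendsto u atTop (𝓝 0) ∧
      StrictMono φ ∧ Tendsto (fun k => (u k)⁻¹ * t (φ k)) atTop (𝓝 c) ∧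
      Tendsto (fun k => (u k)⁻¹ • a (φ k)) atTop (𝓝 x) ∧
      Tendsto (fun k => (u k)⁻¹ • b (φ k)) atTop (𝓝 y) ∧ ¬ (c = 0 ∧ x = 0 ∧ y = 0) := by
  -- Dividing by the sum of the three sizes makes the rescaled norms add up to 1, which gives both
  -- compactness and a nonzero limit.
  set v : ℕ → ℝ := fun k => t k + ‖a k‖ + ‖b k‖ with hv
  have hv0 : ∀ k, 0 < v k := fun k => by have := ht0 k; positivity
  have hvt : Tendsto v atTop (𝓝 0) := by simpa using (ht.add ha.norm).add hb.norm
  have hsum : ∀ k, ‖(v k)⁻¹ * t k‖ + ‖(v k)⁻¹ • a k‖ + ‖(v k)⁻¹ • b k‖ = 1 := fun k => by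
    rw [norm_mul, norm_smul, norm_smul, Real.norm_of_nonneg (inv_nonneg.2 (hv0 k).le),
      Real.norm_of_nonneg (ht0 k).le, ← mul_add, ← mul_add]
    exact inv_mul_cancel₀ (hv0 k).ne'
  obtain ⟨⟨c, x, y⟩, -, φ, hφ, hlim⟩ := tendsto_subseq_of_bounded
    (x := fun k => (((v k)⁻¹ * t k, (v k)⁻¹ • a k, (v k)⁻¹ • b k) : ℝ × E × E))
    (Metric.isBounded_closedBall (x := 0) (r := 1)) fun k => by
      rw [mem_closedBall_zero_iff]
      have h := hsum k
      have h1 := norm_nonneg ((v k)⁻¹ * t k)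
      have h2 := norm_nonneg ((v k)⁻¹ • a k)
      have h3 := norm_nonneg ((v k)⁻¹ • b k)
      simp only [Prod.norm_def, sup_le_iff]
      refine ⟨?_, ?_, ?_⟩ <;> linarith
  have l1 := (continuous_fst.tendsto _).comp hlim
  have l2 := ((continuous_fst.comp continuous_snd).tendsto _).comp hlim
  have l3 := ((continuous_snd.comp continuous_snd).tendsto _).comp hlim
  refine ⟨v ∘ φ, φ, c, x, y, fun k => hv0 _, hvt.comp hφ.tendsto_atTop, hφ, l1, l2, l3, ?_⟩
  rintro ⟨rfl, rfl, rfl⟩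
  have h := (l1.norm.add l2.norm).add l3.norm
  have h' : Tendsto (fun _ : ℕ => (1 : ℝ)) atTop (𝓝 0) := by
    refine Tendsto.congr (fun k => hsum (φ k)) ?_
    simpa [Function.comp_def] using h
  exact one_ne_zero (tendsto_nhds_unique tendsto_const_nhds h')

section

open NormedSpace (exp)

variable {n : Type*} [Fintype n] [DecidableEq n]

theorem Filter.Tendsto.matrix_inv {ι : Type*} {l : Filter ι} {u : ι → Matrix n n ℝ}
    {B : Matrix n n ℝ} (hu : Tendsto u l (𝓝 B)) (hB : IsUnit B) :
    Tendsto (fun k => (u k)⁻¹) l (𝓝 B⁻¹) := by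
  have hdet : B.det ≠ 0 := ((Matrix.isUnit_iff_isUnit_det B).1 hB).ne_zero
  have h1 : Tendsto (fun k => (u k).det) l (𝓝 B.det) := (continuous_id.matrix_det.tendsto B).comp hu
  have h2 : Tendsto (fun k => (u k).adjugate) l (𝓝 B.adjugate) :=
    (continuous_id.matrix_adjugate.tendsto B).comp hu
  simp only [Matrix.inv_def, Ring.inverse_eq_inv']
  exact (h1.inv₀ hdet).smul h2

/-- First-order part of `q * qᵀ = 1`: after division by `u k` the quadratic term in `q k - 1`
disappears. -/
theorem add_transpose_eq_zero_of_tendsto {q : ℕ → Matrix n n ℝ} {u : ℕ → ℝ} {Y : Matrix n n ℝ}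
    (hq : ∀ k, q k * (q k)ᵀ = 1) (hu0 : ∀ k, 0 < u k) (hu : Tendsto u atTop (𝓝 0))
    (hY : Tendsto (fun k => (u k)⁻¹ • (q k - 1)) atTop (𝓝 Y)) : Y + Yᵀ = 0 := by
  have hT : Tendsto (fun k => ((u k)⁻¹ • (q k - 1))ᵀ) atTop (𝓝 Yᵀ) :=
    (continuous_id.matrix_transpose.tendsto Y).comp hY
  have h := (hY.add hT).add (hu.smul (hY.mul hT))
  rw [zero_smul, add_zero] at h
  refine tendsto_nhds_unique (h.congr fun k => ?_) tendsto_const_nhds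
  have hk := (hu0 k).ne'
  rw [transpose_smul, smul_mul_smul_comm, smul_smul, ← mul_assoc, mul_inv_cancel₀ hk, one_mul,
    ← smul_add, ← smul_add, transpose_sub, transpose_one]
  have : q k - 1 + ((q k)ᵀ - 1) + (q k - 1) * ((q k)ᵀ - 1) = q k * (q k)ᵀ - 1 := by noncomm_ring
  rw [this, hq, sub_self, smul_zero]

theorem exp_smul_orthogonal {X : Matrix n n ℝ} (hX : X + Xᵀ = 0) (t : ℝ) :
    exp (t • X) * (exp (t • X))ᵀ = 1 := by
  rw [← Matrix.exp_transpose, transpose_smul, eq_neg_of_add_eq_zero_right hX, smul_neg,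
    Matrix.exp_neg]
  exact Matrix.mul_nonsing_inv _ ((Matrix.isUnit_iff_isUnit_det _).1 (Matrix.isUnit_exp _))

variable {H : Submonoid (Matrix n n ℝ)}

/-- The one-parameter group of a skew matrix is orthogonal, hence trivial inside `H`. -/
theorem eq_zero_of_mem_lieSubspace_of_skew (hcl : ClosedInGL H) (hinv : HasInverses H)
    (horth : ∀ A ∈ H, A * Aᵀ = 1 → A = 1) {X : Matrix n n ℝ} (hX : X ∈ lieSubspace H hcl hinv)
    (hskew : X + Xᵀ = 0) : X = 0 :=
  eq_of_forall_exp_smul_eq_one fun t => horth _ (hX t) (exp_smul_orthogonal hskew t)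

theorem conj_mem_lieSubspace {hcl : ClosedInGL H} {hinv : HasInverses H} {A X : Matrix n n ℝ}
    (hA : A ∈ H) (hX : X ∈ lieSubspace H hcl hinv) : A⁻¹ * X * A ∈ lieSubspace H hcl hinv := by
  intro t
  have : t • (A⁻¹ * X * A) = A⁻¹ * (t • X) * A := by simp
  rw [this, Matrix.exp_conj' _ _ (hinv A hA).1]
  exact H.mul_mem (H.mul_mem (hinv A hA).2 (hX t)) hA

/-- Matrices with equal `h * hᵀ` differ by an orthogonal factor on the right. -/
theorem inv_mul_orthogonal {h T : Matrix n n ℝ} (hu : IsUnit h) (hT : h * hᵀ = T * Tᵀ) :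
    (h⁻¹ * T) * (h⁻¹ * T)ᵀ = 1 := by
  have hd := (Matrix.isUnit_iff_isUnit_det _).1 hu
  have hd' : IsUnit hᵀ.det := by rwa [det_transpose]
  rw [transpose_mul, Matrix.mul_assoc, ← Matrix.mul_assoc T, ← hT, Matrix.mul_assoc,
    transpose_nonsing_inv, Matrix.mul_nonsing_inv _ hd', mul_one, Matrix.nonsing_inv_mul _ hd]

/-- A tangent direction of a curve in `H · O(n)` is the sum of a tangent direction of `H` and a skew
symmetric matrix. -/
theorem exists_mem_lieSubspace_add_skew (hcl : ClosedInGL H) (hinv : HasInverses H)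
    (horth : ∀ A ∈ H, A * Aᵀ = 1 → A = 1) {Z : Matrix n n ℝ} {t : ℕ → ℝ} (ht0 : ∀ k, 0 < t k)
    (ht : Tendsto t atTop (𝓝 0)) {h : ℕ → Matrix n n ℝ} (hH : ∀ k, h k ∈ H)
    (hh : Tendsto h atTop (𝓝 1))
    (hT : ∀ k, h k * (h k)ᵀ = (1 + t k • Z) * (1 + t k • Z)ᵀ) :
    ∃ X ∈ lieSubspace H hcl hinv, (Z - X) + (Z - X)ᵀ = 0 := by
  set q : ℕ → Matrix n n ℝ := fun k => (h k)⁻¹ * (1 + t k • Z) with hq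
  have hqo : ∀ k, q k * (q k)ᵀ = 1 := fun k => inv_mul_orthogonal (hinv _ (hH k)).1 (hT k)
  have hhq : ∀ k, h k * q k = 1 + t k • Z := fun k =>
    Matrix.mul_nonsing_inv_cancel_left _ _ ((Matrix.isUnit_iff_isUnit_det _).1 (hinv _ (hH k)).1)
  have hTlim : Tendsto (fun k => 1 + t k • Z) atTop (𝓝 1) := by
    simpa using (ht.smul_const Z).const_add (1 : Matrix n n ℝ)
  have hqlim : Tendsto q atTop (𝓝 1) := by simpa using (hh.matrix_inv isUnit_one).mul hTlim
  -- How fast `h k` tends to 1 compared with `t k` is unknown, so `t k`, `h k - 1` and `q k - 1` are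
  -- rescaled jointly along a subsequence.
  have key : ∃ (u : ℕ → ℝ) (φ : ℕ → ℕ) (c : ℝ) (X Y : Matrix n n ℝ), (∀ k, 0 < u k) ∧
      Tendsto u atTop (𝓝 0) ∧
      StrictMono φ ∧ Tendsto (fun k => (u k)⁻¹ * t (φ k)) atTop (𝓝 c) ∧
      Tendsto (fun k => (u k)⁻¹ • (h (φ k) - 1)) atTop (𝓝 X) ∧
      Tendsto (fun k => (u k)⁻¹ • (q (φ k) - 1)) atTop (𝓝 Y) ∧ ¬ (c = 0 ∧ X = 0 ∧ Y = 0) := by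
    have h1 : Tendsto (fun k => h k - 1) atTop (𝓝 0) := by simpa using hh.sub_const 1
    have h2 : Tendsto (fun k => q k - 1) atTop (𝓝 0) := by simpa using hqlim.sub_const 1
    open scoped Matrix.Norms.Elementwise in
    exact exists_subseq_rescaled_limit ht0 ht h1 h2
  obtain ⟨u, φ, c, X, Y, hu0, hu, hφ, lc, lX, lY, hne⟩ := key
  have hX : X ∈ lieSubspace H hcl hinv := fun s =>
    exp_smul_mem_of_tendsto hcl hinv (fun k => hH (φ k)) hu0 hu lX s
  have hY : Y + Yᵀ = 0 := add_transpose_eq_zero_of_tendsto (fun k => hqo (φ k)) hu0 hu lY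
  have hsum : c • Z = X + Y := by
    have l := (lX.add lY).add (hu.smul (lX.mul lY))
    rw [zero_smul, add_zero] at l
    refine tendsto_nhds_unique (lc.smul_const Z) (l.congr fun k => ?_)
    have hk := (hu0 k).ne'
    rw [smul_mul_smul_comm, smul_smul, ← mul_assoc, mul_inv_cancel₀ hk, one_mul,
      ← smul_add, ← smul_add, mul_smul]
    congr 1
    have : h (φ k) - 1 + (q (φ k) - 1) + (h (φ k) - 1) * (q (φ k) - 1) = h (φ k) * q (φ k) - 1 := by
      noncomm_ring
    rw [this, hhq, add_sub_cancel_left]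
  -- If `t k` were negligible, `X = -Y` would be a skew element of the Lie algebra, hence zero, and
  -- the whole rescaled limit would vanish.
  have hc : c ≠ 0 := by
    rintro rfl
    rw [zero_smul] at hsum
    have hXY : X = -Y := eq_neg_of_add_eq_zero_left hsum.symm
    have hX0 : X = 0 := eq_zero_of_mem_lieSubspace_of_skew hcl hinv horth hX (by
      rw [hXY, transpose_neg, ← neg_add, hY, neg_zero])
    exact hne ⟨rfl, hX0, by rw [hX0] at hXY; exact neg_eq_zero.1 hXY.symm⟩
  refine ⟨c⁻¹ • X, (lieSubspace H hcl hinv).smul_mem _ hX, ?_⟩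
  have : Z - c⁻¹ • X = c⁻¹ • Y := by
    rw [← inv_smul_smul₀ hc Z, hsum, ← smul_sub, add_sub_cancel_left]
  rw [this, transpose_smul, ← smul_add, hY, smul_zero]

theorem isCompact_orthogonal : IsCompact {q : Matrix n n ℝ | q * qᵀ = 1} := by
  have hK : IsCompact (Set.univ.pi fun _ => Set.univ.pi fun _ => Set.Icc (-1) 1 :
      Set (n → n → ℝ)) := isCompact_univ_pi fun _ => isCompact_univ_pi fun _ => isCompact_Icc
  have hcl : IsClosed {q : Matrix n n ℝ | q * qᵀ = 1} :=
    isClosed_eq (continuous_id.matrix_mul continuous_id.matrix_transpose) continuous_const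
  refine hK.of_isClosed_subset hcl fun (q : Matrix n n ℝ) hq i _ j _ => ?_
  have h := congrFun (congrFun (show q * qᵀ = 1 from hq) i) i
  rw [Matrix.mul_apply, one_apply_eq] at h
  have h2 : q i j * q i j ≤ 1 := by
    rw [← h]
    exact Finset.single_le_sum (f := fun j => q i j * qᵀ j i) (fun j _ => mul_self_nonneg _)
      (Finset.mem_univ j)
  exact ⟨by nlinarith, by nlinarith⟩

/-- Degenerating the Lie algebra of `H` along a diagonal one-parameter group: after conjugation with
an orthogonal matrix, it contains all leading terms of its elements. -/
theorem exists_orthogonal_leading_terms (hcl : ClosedInGL H) (hinv : HasInverses H) (w : n → ℝ)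
    (hfac : ∀ m : ℕ, ∃ h ∈ H, h * hᵀ =
      diagonal (fun i => Real.exp (-m * w i)) * (diagonal (fun i => Real.exp (-m * w i)))ᵀ) :
    ∃ q : Matrix n n ℝ, q * qᵀ = 1 ∧
      (∃ u : ℕ → Matrix n n ℝ, (∀ k, ∃ h ∈ H, ∃ v, u k = h * diagonal v ∧
        ∀ i, w i = 0 → v i = 1) ∧ Tendsto u atTop (𝓝 q)) ∧
      ∀ X ∈ lieSubspace H hcl hinv, ∀ c : ℝ, (∀ i j, X i j ≠ 0 → w i - w j ≤ c) →
        q * (Matrix.of fun i j => if w i - w j = c then X i j else 0) * qᵀ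
          ∈ lieSubspace H hcl hinv := by
  choose h hH hh using hfac
  set a : ℕ → Matrix n n ℝ := fun m => diagonal (fun i => Real.exp (-m * w i)) with ha
  set b : ℕ → Matrix n n ℝ := fun m => diagonal (fun i => Real.exp (m * w i)) with hb
  have hab : ∀ m, a m * b m = 1 := fun m => by
    rw [ha, hb, diagonal_mul_diagonal, ← diagonal_one]
    congr 1
    ext i
    rw [← Real.exp_add, neg_mul, neg_add_cancel, Real.exp_zero]
  have hunit : ∀ m, IsUnit (h m).det := fun m =>
    (Matrix.isUnit_iff_isUnit_det _).1 (hinv _ (hH m)).1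
  have : FirstCountableTopology (Matrix n n ℝ) :=
    inferInstanceAs (FirstCountableTopology (n → n → ℝ))
  -- Writing `a m = h m * q m` with `q m` orthogonal, compactness yields a limit point `q` of the
  -- orthogonal factors.
  obtain ⟨q, hq, φ, hφ, hlim⟩ := isCompact_orthogonal.tendsto_subseq
    (x := fun m => (h m)⁻¹ * a m) fun m => inv_mul_orthogonal (hinv _ (hH m)).1 (hh m)
  refine ⟨q, hq, ⟨_, fun k => ⟨_, (hinv _ (hH (φ k))).2, _, rfl, fun i hi => by simp [hi]⟩, hlim⟩,
    fun X hX c hXc => ?_⟩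
  have hlimT : Tendsto (fun k => ((h (φ k))⁻¹ * a (φ k))ᵀ) atTop (𝓝 qᵀ) :=
    (continuous_id.matrix_transpose.tendsto q).comp hlim
  -- Conjugation multiplies entry `(i, j)` by `exp (m (w i - w j))`. After normalisation by `exp (-m
  -- c)` the entries of weight `c` survive and the lower ones die.
  have hmid : Tendsto (fun k => Real.exp (-(φ k : ℝ) * c) • (b (φ k) * X * a (φ k))) atTop
      (𝓝 (Matrix.of fun i j => if w i - w j = c then X i j else 0)) := by
    refine tendsto_pi_nhds.2 fun i => tendsto_pi_nhds.2 fun j => ?_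
    have he : ∀ k, (Real.exp (-(φ k : ℝ) * c) • (b (φ k) * X * a (φ k))) i j
        = X i j * Real.exp ((φ k : ℝ) * (w i - w j - c)) := fun k => by
      have : (φ k : ℝ) * (w i - w j - c)
          = -(φ k : ℝ) * c + ((φ k : ℝ) * w i + -(φ k : ℝ) * w j) := by ring
      rw [this, Real.exp_add, Real.exp_add]
      simp only [ha, hb, Matrix.smul_apply, mul_diagonal, diagonal_mul, smul_eq_mul]
      ring
    refine Tendsto.congr (fun k => (he k).symm) ?_
    simp only [of_apply]
    split_ifs with hc
    · simp [hc]
    · by_cases hx : X i j = 0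
      · simp [hx]
      · have hneg : w i - w j - c < 0 := by
          have := lt_of_le_of_ne (hXc i j hx) hc
          linarith
        have hφ' : Tendsto (fun k => (φ k : ℝ)) atTop atTop :=
          tendsto_natCast_atTop_atTop.comp hφ.tendsto_atTop
        simpa using
          (Real.tendsto_exp_atBot.comp (hφ'.atTop_mul_const_of_neg hneg)).const_mul (X i j)
  have hl := (hlim.mul hmid).mul hlimT
  refine (Submodule.closed_of_finiteDimensional (lieSubspace H hcl hinv)).mem_of_tendsto hl
    (Eventually.of_forall fun k => ?_)
  have hqT : ((h (φ k))⁻¹ * a (φ k))ᵀ = b (φ k) * h (φ k) := by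
    refine (left_inv_eq_right_inv (a := (h (φ k))⁻¹ * a (φ k)) ?_ ?_)
    · exact mul_eq_one_comm.1 (inv_mul_orthogonal (hinv _ (hH (φ k))).1 (hh (φ k)))
    · rw [Matrix.mul_assoc, ← Matrix.mul_assoc (a _), hab, one_mul,
        Matrix.nonsing_inv_mul _ (hunit _)]
  -- The factors `a` and `b` cancel, so conjugating the rescaled element by `q m` is conjugating `X`
  -- by `h m`, which preserves the Lie algebra; a finite-dimensional subspace is closed, so the
  -- limit stays in it.
  have heq : ((h (φ k))⁻¹ * a (φ k)) * (Real.exp (-(φ k : ℝ) * c) • (b (φ k) * X * a (φ k))) *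
      ((h (φ k))⁻¹ * a (φ k))ᵀ = Real.exp (-(φ k : ℝ) * c) • ((h (φ k))⁻¹ * X * h (φ k)) := by
    rw [hqT, Matrix.mul_smul, Matrix.smul_mul]
    congr 1
    calc _ = (h (φ k))⁻¹ * (a (φ k) * b (φ k)) * X * (a (φ k) * b (φ k)) * h (φ k) := by
          simp only [Matrix.mul_assoc]
      _ = _ := by rw [hab, mul_one, mul_one]
  change ((h (φ k))⁻¹ * a (φ k)) * _ * _ ∈ _
  rw [heq]
  exact Submodule.smul_mem _ _ (conj_mem_lieSubspace (hH _) hX)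

end

end

/-! ### Orthogonal conjugation and matrices with fixed last row. -/

noncomputable section

open Filter Topology

section Conj

open NormedSpace (exp)

variable {n : Type*} [Fintype n] [DecidableEq n]

theorem inv_eq_transpose_of_orthogonal {q : Matrix n n ℝ} (hq : q * qᵀ = 1) : q⁻¹ = qᵀ :=
  Matrix.inv_eq_right_inv hq

theorem isUnit_of_orthogonal {q : Matrix n n ℝ} (hq : q * qᵀ = 1) : IsUnit q :=
  IsUnit.of_mul_eq_one _ hq

theorem conj_mul_conj {q : Matrix n n ℝ} (hq : q * qᵀ = 1) (A B : Matrix n n ℝ) :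
    q * A * qᵀ * (q * B * qᵀ) = q * (A * B) * qᵀ := by
  have hq' : qᵀ * q = 1 := mul_eq_one_comm.1 hq
  calc q * A * qᵀ * (q * B * qᵀ) = q * A * (qᵀ * q) * B * qᵀ := by simp only [Matrix.mul_assoc]
    _ = _ := by rw [hq', mul_one, Matrix.mul_assoc q]

theorem orthogonal_conj_injective {q : Matrix n n ℝ} (hq : q * qᵀ = 1) {A B : Matrix n n ℝ}
    (h : q * A * qᵀ = q * B * qᵀ) : A = B := by
  have hq' : qᵀ * q = 1 := mul_eq_one_comm.1 hq
  have key : ∀ C : Matrix n n ℝ, qᵀ * (q * C * qᵀ) * q = C := fun C => by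
    calc qᵀ * (q * C * qᵀ) * q = (qᵀ * q) * C * (qᵀ * q) := by simp only [Matrix.mul_assoc]
      _ = C := by rw [hq', one_mul, mul_one]
  rw [← key A, h, key]

/-- The conjugate `qᵀ H q` of a group of matrices by an orthogonal matrix. -/
def conjSubmonoid (H : Submonoid (Matrix n n ℝ)) (q : Matrix n n ℝ) (hq : q * qᵀ = 1) :
    Submonoid (Matrix n n ℝ) where
  carrier := {A | q * A * qᵀ ∈ H}
  one_mem' := by change q * 1 * qᵀ ∈ H; rw [mul_one, hq]; exact H.one_mem
  mul_mem' {A B} hA hB := by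
    change q * (A * B) * qᵀ ∈ H
    rw [← conj_mul_conj hq]
    exact H.mul_mem hA hB

theorem isUnit_conj_iff {q : Matrix n n ℝ} (hq : q * qᵀ = 1) {A : Matrix n n ℝ} :
    IsUnit (q * A * qᵀ) ↔ IsUnit A := by
  have h1 := (Matrix.isUnit_iff_isUnit_det _).1 (isUnit_of_orthogonal hq)
  rw [Matrix.isUnit_iff_isUnit_det, Matrix.isUnit_iff_isUnit_det, det_mul, det_mul, det_transpose,
    IsUnit.mul_iff, IsUnit.mul_iff]
  tauto

variable {H : Submonoid (Matrix n n ℝ)} {q : Matrix n n ℝ} (hq : q * qᵀ = 1)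

theorem mem_conjSubmonoid {A : Matrix n n ℝ} : A ∈ conjSubmonoid H q hq ↔ q * A * qᵀ ∈ H := Iff.rfl

theorem ClosedInGL.conj (hcl : ClosedInGL H) : ClosedInGL (conjSubmonoid H q hq) :=
  fun _ _ hu hl hB => hcl _ _ hu ((hl.const_mul q).mul_const qᵀ) ((isUnit_conj_iff hq).2 hB)

theorem HasInverses.conj (hinv : HasInverses H) : HasInverses (conjSubmonoid H q hq) := by
  intro A hA
  obtain ⟨h1, h2⟩ := hinv _ hA
  have hAu := (isUnit_conj_iff hq).1 h1
  refine ⟨hAu, ?_⟩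
  have : (q * A * qᵀ)⁻¹ = q * A⁻¹ * qᵀ := Matrix.inv_eq_right_inv (by
    rw [conj_mul_conj hq, Matrix.mul_nonsing_inv _ ((Matrix.isUnit_iff_isUnit_det _).1 hAu),
        mul_one,
      hq])
  rw [this] at h2
  exact h2

theorem conjSubmonoid_orthogonal (horth : ∀ A ∈ H, A * Aᵀ = 1 → A = 1) :
    ∀ A ∈ conjSubmonoid H q hq, A * Aᵀ = 1 → A = 1 := by
  intro A hA h
  refine orthogonal_conj_injective hq ?_
  rw [mul_one, hq]
  refine horth _ hA ?_
  rw [transpose_mul, transpose_mul, transpose_transpose, ← Matrix.mul_assoc q Aᵀ, conj_mul_conj hq,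
      h,
    mul_one, hq]

theorem mem_lieSubspace_conj {hcl : ClosedInGL H} {hinv : HasInverses H} {X : Matrix n n ℝ} :
    X ∈ lieSubspace (conjSubmonoid H q hq) (hcl.conj hq) (hinv.conj hq) ↔
      q * X * qᵀ ∈ lieSubspace H hcl hinv := by
  refine forall_congr' fun t => ?_
  rw [mem_conjSubmonoid, ← inv_eq_transpose_of_orthogonal hq,
    ← Matrix.exp_conj _ _ (isUnit_of_orthogonal hq), Matrix.mul_smul, Matrix.smul_mul]

end Conj

section Affine

variable {n : Type*} [Fintype n] [DecidableEq n] {l : n}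

theorem mul_row_of_row_eq_one {A : Matrix n n ℝ} (hA : A l = (1 : Matrix n n ℝ) l)
    (B : Matrix n n ℝ) : (A * B) l = B l := by
  ext j
  conv_rhs => rw [← one_mul B]
  rw [Matrix.mul_apply, Matrix.mul_apply, hA]

theorem row_eq_one_of_conj_row_eq_one {q : Matrix n n ℝ} (hq : q * qᵀ = 1) (hl : q l = (1 : Matrix n n ℝ) l)
    {A : Matrix n n ℝ} (hA : (q * A * qᵀ) l = (1 : Matrix n n ℝ) l) :
    A l = (1 : Matrix n n ℝ) l := by
  have h : A * qᵀ * q = A := by rw [Matrix.mul_assoc, mul_eq_one_comm.1 hq, mul_one]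
  rw [Matrix.mul_assoc, mul_row_of_row_eq_one hl] at hA
  rw [← h, mul_row_of_row_eq_one hA, hl]

theorem row_eq_zero_of_mem_lieSubspace {H : Submonoid (Matrix n n ℝ)} {hcl : ClosedInGL H}
    {hinv : HasInverses H} (haff : ∀ A ∈ H, A l = (1 : Matrix n n ℝ) l) {X : Matrix n n ℝ}
    (hX : X ∈ lieSubspace H hcl hinv) : X l = 0 := by
  ext j
  have h := tendsto_pi_nhds.1 (tendsto_pi_nhds.1 (tendsto_succ_smul_exp_sub_one X) l) j
  refine tendsto_nhds_unique h (tendsto_const_nhds.congr fun k => ?_)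
  rw [Matrix.smul_apply, Matrix.sub_apply, haff _ (hX _), sub_self, smul_zero]
  rfl

end Affine

/-- Uniqueness of binary expansions, after moving the negative terms across: comparing the exact
power of 2 dividing both sides identifies the exponents. -/
theorem two_pow_sub_injective {i j k l : ℕ} (hij : i ≠ j)
    (h : (2 : ℝ) ^ i - 2 ^ j = 2 ^ k - 2 ^ l) : i = k ∧ j = l := by
  have key : ∀ {a b c e : ℕ}, a < b → (2 : ℕ) ^ b + 2 ^ c = 2 ^ e + 2 ^ a → b = e ∧ a = c := by
    intro a b c e hab h
    have hc : c = a := by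
      by_contra hne
      rcases lt_or_gt_of_ne hne with hca | hca
      · have hec : e = c := by
          by_contra hec
          rcases lt_or_gt_of_ne hec with h1 | h1
          · have hd : 2 ^ (e + 1) ∣ 2 ^ e := by
              have h2 : (2 : ℕ) ^ (e + 1) ∣ 2 ^ e + 2 ^ a := h ▸ (Dvd.dvd.add
                (pow_dvd_pow 2 (by omega)) (pow_dvd_pow 2 (by omega)))
              exact (Nat.dvd_add_left (pow_dvd_pow 2 (by omega))).1 h2
            exact absurd (Nat.pow_dvd_pow_iff_le_right'.1 hd) (by omega)
          · have hd : 2 ^ (c + 1) ∣ 2 ^ c := by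
              have h2 : (2 : ℕ) ^ (c + 1) ∣ 2 ^ b + 2 ^ c := h ▸ (Dvd.dvd.add
                (pow_dvd_pow 2 (by omega)) (pow_dvd_pow 2 (by omega)))
              exact (Nat.dvd_add_right (pow_dvd_pow 2 (by omega))).1 h2
            exact absurd (Nat.pow_dvd_pow_iff_le_right'.1 hd) (by omega)
        subst hec
        have : (2 : ℕ) ^ b = 2 ^ a := by omega
        exact absurd (Nat.pow_right_injective le_rfl this) (by omega)
      · have hle : 2 ^ e + 2 ^ a = 2 ^ b + 2 ^ c := h.symm
        have hae : e = a := by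
          by_contra hne'
          rcases lt_or_gt_of_ne hne' with h1 | h1
          · have hd : 2 ^ (e + 1) ∣ 2 ^ e := by
              have h2 : (2 : ℕ) ^ (e + 1) ∣ 2 ^ e + 2 ^ a := h ▸ (Dvd.dvd.add
                (pow_dvd_pow 2 (by omega)) (pow_dvd_pow 2 (by omega)))
              exact (Nat.dvd_add_left (pow_dvd_pow 2 (by omega))).1 h2
            exact absurd (Nat.pow_dvd_pow_iff_le_right'.1 hd) (by omega)
          · have hd : 2 ^ (a + 1) ∣ 2 ^ a := by
              have h2 : (2 : ℕ) ^ (a + 1) ∣ 2 ^ e + 2 ^ a := h ▸ (Dvd.dvd.add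
                (pow_dvd_pow 2 (by omega)) (pow_dvd_pow 2 (by omega)))
              exact (Nat.dvd_add_right (pow_dvd_pow 2 (by omega))).1 h2
            exact absurd (Nat.pow_dvd_pow_iff_le_right'.1 hd) (by omega)
        subst hae
        have h1 : (2 : ℕ) ^ (e + 1) ≤ 2 ^ b := Nat.pow_le_pow_right (by norm_num) (by omega)
        have h2 : 0 < (2 : ℕ) ^ c := by positivity
        rw [pow_succ] at h1
        omega
    subst hc
    exact ⟨Nat.pow_right_injective le_rfl (by simpa using h), rfl⟩
  have h' : (2 : ℕ) ^ i + 2 ^ l = 2 ^ k + 2 ^ j := by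
    have : (2 : ℝ) ^ i + 2 ^ l = 2 ^ k + 2 ^ j := by linarith
    exact_mod_cast this
  rcases lt_or_gt_of_ne hij with hlt | hlt
  · obtain ⟨h1, h2⟩ := key (a := i) (b := j) (c := k) (e := l) hlt (by omega)
    exact ⟨h2, h1⟩
  · obtain ⟨h1, h2⟩ := key (a := j) (b := i) (c := l) (e := k) hlt h'
    exact ⟨h1, h2⟩

/-! ### Leading terms and dimension counting. -/

section Count

variable {n : Type*}

/-- Elements with distinct weights: if one of their nontrivial combinations lies in `V`, and `V'`
contains the leading terms of `V`, then one of the elements lies in `V'`. -/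
theorem exists_mem_of_leading_terms {V V' : Submodule ℝ (Matrix n n ℝ)} {w : n → ℝ}
    (hlead : ∀ X ∈ V, ∀ c : ℝ, (∀ i j, X i j ≠ 0 → w i - w j ≤ c) →
      (Matrix.of fun i j => if w i - w j = c then X i j else 0) ∈ V')
    {O : Type*} [Fintype O] {B : O → Matrix n n ℝ} {ω : O → ℝ} (hω : Function.Injective ω)
    (hB : ∀ o i j, B o i j ≠ 0 → w i - w j = ω o) {f : O → ℝ} (hf : f ≠ 0)
    (hfV : ∑ o, f o • B o ∈ V) : ∃ o, B o ∈ V' := by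
  classical
  obtain ⟨o₁, ho₁⟩ := Function.ne_iff.1 hf
  -- Among the elements occurring in the combination, the one of largest weight is alone in its
  -- weight and therefore is the leading term up to a scalar.
  obtain ⟨o, ho, hmax⟩ := Finset.exists_max_image (Finset.univ.filter fun o => f o ≠ 0) ω
    ⟨o₁, by simpa using ho₁⟩
  have hfo : f o ≠ 0 := (Finset.mem_filter.1 ho).2
  have happ : ∀ i j, (∑ o, f o • B o) i j = ∑ o, f o * B o i j := fun i j => by
    rw [Matrix.sum_apply]; rfl
  have h1 := hlead _ hfV (ω o) fun i j hij => by
    rw [happ] at hij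
    obtain ⟨o', -, ho'⟩ := Finset.exists_ne_zero_of_sum_ne_zero hij
    rw [hB o' i j (right_ne_zero_of_mul ho')]
    exact hmax o' (Finset.mem_filter.2 ⟨Finset.mem_univ _, left_ne_zero_of_mul ho'⟩)
  have h2 : (Matrix.of fun i j => if w i - w j = ω o then (∑ o, f o • B o) i j else 0)
      = f o • B o := by
    ext i j
    rw [of_apply, happ, Matrix.smul_apply, smul_eq_mul]
    split_ifs with hc
    · refine Finset.sum_eq_single o (fun o' _ hne => ?_) (by simp)
      by_contra hcon
      exact hne (hω ((hB o' i j (right_ne_zero_of_mul hcon)).symm.trans hc))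
    · by_contra hcon
      exact hc (hB o i j (right_ne_zero_of_mul (Ne.symm hcon)))
  rw [h2] at h1
  refine ⟨o, ?_⟩
  simpa [smul_smul, inv_mul_cancel₀ hfo] using V'.smul_mem (f o)⁻¹ h1

/-- Otherwise the `B o` would span a space of dimension `card O` meeting `V` trivially inside `L`,
so `card O + dim V ≤ dim L ≤ dim V + dim K`. -/
theorem exists_combination_mem [Fintype n] {V L K : Submodule ℝ (Matrix n n ℝ)} (hVL : V ≤ L)
    (hsup : L ≤ V ⊔ K)
    {O : Type*} [Fintype O] {B : O → Matrix n n ℝ} (hBL : ∀ o, B o ∈ L)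
    (hcard : Module.finrank ℝ K < Fintype.card O) :
    ∃ f : O → ℝ, f ≠ 0 ∧ ∑ o, f o • B o ∈ V := by
  classical
  by_contra! hcon
  let Ψ : (O → ℝ) →ₗ[ℝ] Matrix n n ℝ := Fintype.linearCombination ℝ B
  have hΨ : ∀ f, Ψ f = ∑ o, f o • B o := fun f => Fintype.linearCombination_apply ℝ B f
  have hz : ∀ f, Ψ f ∈ V → f = 0 := fun f hf => by
    by_contra h
    exact hcon f h (hΨ f ▸ hf)
  have hinj : Function.Injective Ψ := by
    rw [← LinearMap.ker_eq_bot, LinearMap.ker_eq_bot']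
    exact fun f hf => hz f (hf ▸ V.zero_mem)
  have h1 : Module.finrank ℝ (LinearMap.range Ψ) = Fintype.card O := by
    rw [LinearMap.finrank_range_of_inj hinj, Module.finrank_fintype_fun_eq_card]
  have hinf : LinearMap.range Ψ ⊓ V = ⊥ := by
    rw [eq_bot_iff]
    rintro _ ⟨⟨f, rfl⟩, hfV⟩
    rw [hz f hfV, map_zero]
    exact Submodule.zero_mem _
  have h2 := Submodule.finrank_sup_add_finrank_inf_eq (LinearMap.range Ψ) V
  rw [hinf, finrank_bot, add_zero] at h2
  have h3 : LinearMap.range Ψ ⊔ V ≤ L := by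
    refine sup_le ?_ hVL
    rintro _ ⟨f, rfl⟩
    rw [hΨ]
    exact L.sum_mem fun o _ => L.smul_mem _ (hBL o)
  have h4 := Submodule.finrank_mono (h3.trans hsup)
  have h5 := Submodule.finrank_add_le_finrank_add_finrank V K
  omega

end Count

end

/-! ### The affine matrix algebra modulo skew matrices, and its weight vectors. -/

noncomputable section

open Filter Topology

open NormedSpace (exp)

theorem Matrix.exp_eq_one_add_of_mul_self_eq_zero {n : Type*} [Fintype n] [DecidableEq n]
    {N : Matrix n n ℝ} (hN : N * N = 0) : exp N = 1 + N := by
  rw [NormedSpace.exp_eq_tsum ℝ]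
  change (∑' k : ℕ, ((k.factorial : ℝ)⁻¹) • N ^ k) = _
  rw [tsum_eq_sum (s := Finset.range 2)]
  · simp [Finset.sum_range_succ]
  · intro k hk
    have hk2 : 2 ≤ k := not_lt.1 (Finset.mem_range.not.1 hk)
    obtain ⟨m, rfl⟩ := Nat.exists_eq_add_of_le hk2
    rw [pow_add, pow_two, hN, zero_mul, smul_zero]

/-- A finite strict total order on `Fin n` is isomorphic to the usual one. -/
theorem exists_perm_of_strictTotal {n : ℕ} (r : Fin n → Fin n → Prop) (hirr : ∀ i, ¬ r i i)
    (htot : ∀ i j, i ≠ j → r i j ∨ r j i) (htrans : ∀ i j k, r i j → r j k → r i k) :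
    ∃ σ : Equiv.Perm (Fin n), ∀ i j, i < j → r (σ i) (σ j) := by
  classical
  let rank : Fin n → Fin n := fun i => ⟨(Finset.univ.filter fun j => r j i).card, by
    calc (Finset.univ.filter fun j => r j i).card < (Finset.univ : Finset (Fin n)).card :=
          Finset.card_lt_card ⟨Finset.filter_subset _ _, fun h =>
            hirr i (Finset.mem_filter.1 (h (Finset.mem_univ i))).2⟩
      _ = n := by simp⟩
  have hmono : ∀ i j, r i j → rank i < rank j := fun i j hij => by
    change (Finset.univ.filter fun k => r k i).card < (Finset.univ.filter fun k => r k j).card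
    refine Finset.card_lt_card ⟨fun k hk => ?_, fun h => ?_⟩
    · exact Finset.mem_filter.2 ⟨Finset.mem_univ _, htrans _ _ _ (Finset.mem_filter.1 hk).2 hij⟩
    · exact hirr i (Finset.mem_filter.1 (h (Finset.mem_filter.2 ⟨Finset.mem_univ i, hij⟩))).2
  have hinj : Function.Injective rank := fun i j h => by
    by_contra hne
    rcases htot i j hne with h' | h'
    · exact (hmono _ _ h').ne h
    · exact (hmono _ _ h').ne h.symm
  let τ := Equiv.ofBijective rank (Finite.injective_iff_bijective.1 hinj)
  refine ⟨τ.symm, fun i j hij => ?_⟩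
  rcases htot (τ.symm i) (τ.symm j) (fun h => hij.ne (τ.symm.injective h)) with h | h
  · exact h
  · have h1 := hmono _ _ h
    have h2 : ∀ k, rank (τ.symm k) = k := fun k => τ.apply_symm_apply k
    rw [h2, h2] at h1
    exact absurd h1 hij.not_gt

/-- Upper triangular matrices with positive diagonal whose last diagonal entry is `1`. -/
def triangularAffine (d : ℕ) : Set (Matrix (Fin (d + 1)) (Fin (d + 1)) ℝ) :=
  {T | (∀ i j, j < i → T i j = 0) ∧ (∀ i, 0 < T i i) ∧ T (Fin.last d) (Fin.last d) = 1}

variable {d : ℕ}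

theorem exists_pos_one_add_smul_mem_triangularAffine {Z : Matrix (Fin (d + 1)) (Fin (d + 1)) ℝ}
    (hZ : ∀ i j, j < i → Z i j = 0) (hl : Z (Fin.last d) = 0) :
    ∃ t : ℕ → ℝ, (∀ k, 0 < t k) ∧ Tendsto t atTop (𝓝 0) ∧
      ∀ k, 1 + t k • Z ∈ triangularAffine d := by
  -- `C` dominates every `|Z i i|`, so with `t k = 1 / (k + 1 + C)` the diagonal of `1 + t k • Z` is
  -- positive from the first index on.
  set C : ℝ := ∑ i, |Z i i| with hC
  have hC0 : 0 ≤ C := Finset.sum_nonneg fun i _ => abs_nonneg _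
  refine ⟨fun k => ((k : ℝ) + (1 + C))⁻¹, fun k => by positivity, ?_, fun k => ⟨?_, ?_, ?_⟩⟩
  · exact (tendsto_natCast_atTop_atTop.atTop_add tendsto_const_nhds).inv_tendsto_atTop
  · intro i j hij
    simp [hZ i j hij, one_apply_ne hij.ne']
  · intro i
    have h1 : |Z i i| ≤ C := Finset.single_le_sum (f := fun i => |Z i i|)
      (fun i _ => abs_nonneg _) (Finset.mem_univ i)
    have h2 := neg_abs_le (Z i i)
    have hk : (0 : ℝ) ≤ k := Nat.cast_nonneg k
    have hpos : (0 : ℝ) < (k : ℝ) + (1 + C) := by positivity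
    rw [Matrix.add_apply, one_apply_eq, Matrix.smul_apply, smul_eq_mul]
    have h3 : 1 + ((k : ℝ) + (1 + C))⁻¹ * Z i i
        = ((k : ℝ) + (1 + C))⁻¹ * ((k : ℝ) + (1 + C) + Z i i) := by field_simp
    rw [h3]
    exact mul_pos (inv_pos.2 hpos) (by linarith)
  · rw [Matrix.add_apply, one_apply_eq, Matrix.smul_apply, congrFun hl]; simp

/-- Skew symmetric matrices with vanishing last row. -/
def skewAffine (d : ℕ) : Submodule ℝ (Matrix (Fin (d + 1)) (Fin (d + 1)) ℝ) where
  carrier := {Y | Y (Fin.last d) = 0 ∧ Y + Yᵀ = 0}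
  zero_mem' := ⟨rfl, by simp⟩
  add_mem' := by
    rintro X Y ⟨h1, h2⟩ ⟨h3, h4⟩
    refine ⟨?_, ?_⟩
    · change X (Fin.last d) + Y (Fin.last d) = 0
      rw [h1, h3, add_zero]
    · rw [transpose_add, add_add_add_comm, h2, h4, add_zero]
  smul_mem' := by
    rintro c X ⟨h1, h2⟩
    refine ⟨?_, ?_⟩
    · change c • X (Fin.last d) = 0
      rw [h1, smul_zero]
    · rw [transpose_smul, ← smul_add, h2, smul_zero]

/-- Matrices with vanishing last row. -/
def zeroLastRow (d : ℕ) : Submodule ℝ (Matrix (Fin (d + 1)) (Fin (d + 1)) ℝ) where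
  carrier := {Y | Y (Fin.last d) = 0}
  zero_mem' := rfl
  add_mem' {X Y} h1 h2 := by
    change X (Fin.last d) + Y (Fin.last d) = 0
    rw [h1, h2, add_zero]
  smul_mem' c X h := by
    change c • X (Fin.last d) = 0
    rw [h, smul_zero]

/-- Positions strictly above the diagonal and outside of the last column. -/
abbrev UpperPos (d : ℕ) : Type :=
  {p : Fin (d + 1) × Fin (d + 1) // p.1 < p.2 ∧ p.2 ≠ Fin.last d}

/-- By skewness the last column vanishes with the last row, and the entries above the diagonal
determine the rest. Only this upper bound enters the count. -/
theorem finrank_skewAffine_le : Module.finrank ℝ (skewAffine d) ≤ Fintype.card (UpperPos d) := by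
  let f : skewAffine d →ₗ[ℝ] (UpperPos d → ℝ) :=
    { toFun := fun Y p => Y.1 p.1.1 p.1.2
      map_add' := fun _ _ => rfl
      map_smul' := fun _ _ => rfl }
  have hf : Function.Injective f := by
    rw [← LinearMap.ker_eq_bot, LinearMap.ker_eq_bot']
    rintro ⟨Y, hl, hs⟩ h
    have hsk : ∀ i j, Y i j = -Y j i := fun i j => by
      have := congrFun (congrFun hs i) j
      rw [Matrix.add_apply, transpose_apply] at this
      exact eq_neg_of_add_eq_zero_left this
    have hup : ∀ i j, i < j → Y i j = 0 := fun i j hij => by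
      by_cases hj : j = Fin.last d
      · subst hj; rw [hsk, congrFun hl]; simp
      · exact congrFun h ⟨(i, j), hij, hj⟩
    ext i j
    change Y i j = 0
    rcases lt_trichotomy i j with hij | rfl | hij
    · exact hup i j hij
    · linarith [hsk i i]
    · rw [hsk, hup j i hij, neg_zero]
  have := LinearMap.finrank_le_finrank_of_injective hf
  rwa [Module.finrank_fintype_fun_eq_card] at this

/-- Folding the lower triangle onto the upper one changes a matrix by a skew one, so only upper
triangular matrices need to be reached. -/
theorem zeroLastRow_le_sup {V : Submodule ℝ (Matrix (Fin (d + 1)) (Fin (d + 1)) ℝ)}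
    (hV : V ≤ zeroLastRow d)
    (hup : ∀ Z : Matrix (Fin (d + 1)) (Fin (d + 1)) ℝ, (∀ i j, j < i → Z i j = 0) →
      Z (Fin.last d) = 0 → ∃ X ∈ V, (Z - X) + (Z - X)ᵀ = 0) :
    zeroLastRow d ≤ V ⊔ skewAffine d := by
  intro W hW
  have hWl : ∀ j, W (Fin.last d) j = 0 := fun j => congrFun hW j
  set U : Matrix (Fin (d + 1)) (Fin (d + 1)) ℝ :=
    Matrix.of fun i j => if i = j then W i i else if i < j then W i j + W j i else 0 with hU
  have hUl : U (Fin.last d) = 0 := by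
    ext j
    rw [hU, of_apply]
    split_ifs with h1 h2
    · exact hWl _
    · exact absurd h2 (Fin.le_last j).not_gt
    · rfl
  obtain ⟨X, hX, hXs⟩ := hup U (fun i j hij => by
    rw [hU, of_apply, if_neg hij.ne', if_neg hij.not_gt]) hUl
  have hWU : (W - U) + (W - U)ᵀ = 0 := by
    ext i j
    simp only [hU, Matrix.add_apply, Matrix.sub_apply, transpose_apply, of_apply, Matrix.zero_apply]
    rcases lt_trichotomy i j with hij | rfl | hij
    · simp [hij.ne, hij.ne', hij, hij.not_gt]
    · simp
    · simp [hij.ne, hij.ne', hij, hij.not_gt]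
  have h1 : W - X ∈ skewAffine d := by
    refine ⟨?_, ?_⟩
    · change W (Fin.last d) - X (Fin.last d) = 0
      rw [show W (Fin.last d) = 0 from hW, show X (Fin.last d) = 0 from hV hX, sub_zero]
    · have : W - X = (W - U) + (U - X) := by abel
      rw [this, transpose_add, add_add_add_comm, hWU, hXs, add_zero]
  have : W = X + (W - X) := by abel
  rw [this]
  exact Submodule.add_mem_sup hX h1

/-- Weights with pairwise distinct differences. -/
def sidonWeight (d : ℕ) (i : Fin (d + 1)) : ℝ := 2 ^ (i : ℕ) - 2 ^ d

theorem sidonWeight_sub_injective {i j k l : Fin (d + 1)} (hij : i ≠ j)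
    (h : sidonWeight d i - sidonWeight d j = sidonWeight d k - sidonWeight d l) :
    i = k ∧ j = l := by
  simp only [sidonWeight, sub_sub_sub_cancel_right] at h
  obtain ⟨h1, h2⟩ := two_pow_sub_injective (fun h => hij (Fin.ext h)) h
  exact ⟨Fin.ext h1, Fin.ext h2⟩

theorem single_weight {i j : Fin (d + 1)} (a b : Fin (d + 1))
    (h : (single i j (1 : ℝ)) a b ≠ 0) :
    sidonWeight d a - sidonWeight d b = sidonWeight d i - sidonWeight d j := by
  rw [single_apply] at h
  obtain ⟨⟨rfl, rfl⟩, -⟩ := ite_ne_right_iff.1 h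
  rfl

theorem single_mem_zeroLastRow {i : Fin (d + 1)} (j : Fin (d + 1)) (hi : i ≠ Fin.last d) :
    single i j (1 : ℝ) ∈ zeroLastRow d := by
  change (single i j (1 : ℝ)) (Fin.last d) = 0
  ext b
  exact single_apply_of_row_ne hi _ _ _

/-- The counting argument: a weight vector that is not on the chosen side of the root system lies in
the degenerated Lie algebra. -/
theorem weight_vector_mem {V V' : Submodule ℝ (Matrix (Fin (d + 1)) (Fin (d + 1)) ℝ)}
    (hV : V ≤ zeroLastRow d) (hsup : zeroLastRow d ≤ V ⊔ skewAffine d)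
    (hlead : ∀ X ∈ V, ∀ c : ℝ, (∀ i j, X i j ≠ 0 → sidonWeight d i - sidonWeight d j ≤ c) →
      (Matrix.of fun i j => if sidonWeight d i - sidonWeight d j = c then X i j else 0) ∈ V')
    {F : UpperPos d → Fin (d + 1) × Fin (d + 1)} (hF : ∀ p, F p = p.1 ∨ F p = p.1.swap)
    (hFV : ∀ p, single (F p).1 (F p).2 (1 : ℝ) ∉ V')
    {v : Matrix (Fin (d + 1)) (Fin (d + 1)) ℝ} {c : ℝ} (hvl : v ∈ zeroLastRow d)
    (hvc : ∀ i j, v i j ≠ 0 → sidonWeight d i - sidonWeight d j = c)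
    (hcF : ∀ p, sidonWeight d (F p).1 - sidonWeight d (F p).2 ≠ c) : v ∈ V' := by
  -- Adding `v` to one root vector per position gives one element more than the dimension of the
  -- skew matrices allows, so a nontrivial combination lies in `V`; its leading term cannot be any
  -- of the root vectors excluded by `hFV`.
  let B : Option (UpperPos d) → Matrix (Fin (d + 1)) (Fin (d + 1)) ℝ :=
    fun o => o.elim v fun p => single (F p).1 (F p).2 1
  let ω : Option (UpperPos d) → ℝ :=
    fun o => o.elim c fun p => sidonWeight d (F p).1 - sidonWeight d (F p).2
  have hFne : ∀ p, (F p).1 ≠ (F p).2 := fun p => by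
    rcases hF p with h | h <;> rw [h]
    · exact p.2.1.ne
    · exact p.2.1.ne'
  have hFl : ∀ p, (F p).1 ≠ Fin.last d := fun p => by
    rcases hF p with h | h <;> rw [h]
    · exact (p.2.1.trans_le (Fin.le_last _)).ne
    · exact p.2.2
  have hω : Function.Injective ω := by
    rintro (_ | p) (_ | p') h
    · rfl
    · exact absurd h.symm (hcF p')
    · exact absurd h (hcF p)
    · obtain ⟨h1, h2⟩ := sidonWeight_sub_injective (hFne p) h
      have h3 := p.2.1
      have h4 := p'.2.1
      congr 1
      refine Subtype.ext ?_
      rcases hF p with e | e <;> rcases hF p' with e' | e' <;> rw [e, e'] at h1 h2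
      · exact Prod.ext h1 h2
      · simp only [Prod.fst_swap, Prod.snd_swap] at h1 h2
        rw [h1, h2] at h3
        exact absurd h3 h4.not_gt
      · simp only [Prod.fst_swap, Prod.snd_swap] at h1 h2
        rw [h1, h2] at h3
        exact absurd h3 h4.not_gt
      · exact Prod.ext h2 h1
  obtain ⟨f, hf, hfV⟩ := exists_combination_mem (B := B) hV hsup
    (by rintro (_ | p); exacts [hvl, single_mem_zeroLastRow _ (hFl p)])
    (by rw [Fintype.card_option]; exact Nat.lt_succ_of_le finrank_skewAffine_le)
  obtain ⟨o, ho⟩ := exists_mem_of_leading_terms hlead (B := B) hω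
    (by rintro (_ | p) i j h; exacts [hvc i j h, single_weight i j h]) hf hfV
  rcases o with _ | p
  · exact ho
  · exact absurd ho (hFV p)

end

/-! ### Roots of the degenerated Lie algebra and recovery of the triangular group. -/

noncomputable section

open Filter Topology

open NormedSpace (exp)

variable {d : ℕ}

theorem single_mul_single_eq_zero {n : Type*} [Fintype n] [DecidableEq n] {i j k l : n}
    (h : j ≠ k) :
    single i j (1 : ℝ) * single k l (1 : ℝ) = 0 := by
  rw [single_mul_single_of_ne _ _ _ _ h]

/-- The bracket `[E_ij, E_jk] = E_ik` is read off from one group conjugation: as `E_ij` squares to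
zero, conjugating `E_jk` by `exp E_ij = 1 + E_ij` gives exactly `E_jk - E_ik`. -/
theorem single_trans_mem_lieSubspace {n : Type*} [Fintype n] [DecidableEq n]
    {H : Submonoid (Matrix n n ℝ)} {hcl : ClosedInGL H} {hinv : HasInverses H} {i j k : n}
    (hij : i ≠ j) (hik : i ≠ k) (h1 : single i j (1 : ℝ) ∈ lieSubspace H hcl hinv)
    (h2 : single j k (1 : ℝ) ∈ lieSubspace H hcl hinv) :
    single i k (1 : ℝ) ∈ lieSubspace H hcl hinv := by
  have hsq : single i j (1 : ℝ) * single i j (1 : ℝ) = 0 := single_mul_single_eq_zero hij.symm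
  have hA := h1 1
  rw [one_smul] at hA
  have h3 := conj_mem_lieSubspace hA h2
  rw [← Matrix.exp_neg, Matrix.exp_eq_one_add_of_mul_self_eq_zero hsq,
    Matrix.exp_eq_one_add_of_mul_self_eq_zero (by rw [neg_mul_neg, hsq])] at h3
  have h4 : (1 + -single i j (1 : ℝ)) * single j k 1 * (1 + single i j 1)
      = single j k 1 - single i k 1 := by
    have e1 : single j k (1 : ℝ) * single i j (1 : ℝ) = 0 := single_mul_single_eq_zero hik.symm
    have e2 : single i j (1 : ℝ) * single j k (1 : ℝ) = single i k 1 := by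
      rw [single_mul_single_same, one_mul]
    have e3 : single i k (1 : ℝ) * single i j (1 : ℝ) = 0 := single_mul_single_eq_zero hik.symm
    rw [add_mul, one_mul, neg_mul, e2, mul_add, mul_one, add_mul, neg_mul, e1, e3, neg_zero,
        add_zero,
      add_zero, sub_eq_add_neg]
  rw [h4] at h3
  have h5 := Submodule.sub_mem _ h2 h3
  rwa [sub_sub_cancel] at h5

/-- The degenerated Lie algebra contains all diagonal matrices and all translations, and decides
a total order on the coordinates. -/
theorem root_structure {V : Submodule ℝ (Matrix (Fin (d + 1)) (Fin (d + 1)) ℝ)}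
    {H' : Submonoid (Matrix (Fin (d + 1)) (Fin (d + 1)) ℝ)} {hcl : ClosedInGL H'}
    {hinv : HasInverses H'}
    (horth : ∀ A ∈ H', A * Aᵀ = 1 → A = 1)
    (hV : V ≤ zeroLastRow d) (hsup : zeroLastRow d ≤ V ⊔ skewAffine d)
    (hlead : ∀ X ∈ V, ∀ c : ℝ, (∀ i j, X i j ≠ 0 → sidonWeight d i - sidonWeight d j ≤ c) →
      (Matrix.of fun i j => if sidonWeight d i - sidonWeight d j = c then X i j else 0)
        ∈ lieSubspace H' hcl hinv) :
    (∀ v : Fin (d + 1) → ℝ, v (Fin.last d) = 0 → diagonal v ∈ lieSubspace H' hcl hinv) ∧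
    (∀ i j, i ≠ j → ¬ (single i j (1 : ℝ) ∈ lieSubspace H' hcl hinv ∧
      single j i (1 : ℝ) ∈ lieSubspace H' hcl hinv)) ∧
    (∀ i j, i ≠ j → single i j (1 : ℝ) ∈ lieSubspace H' hcl hinv ∨
      single j i (1 : ℝ) ∈ lieSubspace H' hcl hinv) := by
  classical
  set V' := lieSubspace H' hcl hinv with hV'
  -- `E_ij - E_ji` is skew, so it cannot lie in the Lie algebra.
  have hnot : ∀ i j, i ≠ j → ¬ (single i j (1 : ℝ) ∈ V' ∧ single j i (1 : ℝ) ∈ V') := by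
    rintro i j hij ⟨h1, h2⟩
    have h3 := eq_zero_of_mem_lieSubspace_of_skew hcl hinv horth (V'.sub_mem h1 h2) (by
      rw [transpose_sub, transpose_single, transpose_single]; abel)
    have h4 := congrFun (congrFun h3 i) j
    rw [Matrix.sub_apply, single_apply_same, single_apply_of_row_ne hij.symm] at h4
    norm_num at h4
  -- `F` picks from each opposite pair a root whose vector is not in `V'`; any weight outside these
  -- can then be fed to `weight_vector_mem`.
  set F : UpperPos d → Fin (d + 1) × Fin (d + 1) := fun p =>
    if single p.1.1 p.1.2 (1 : ℝ) ∈ V' then p.1.swap else p.1 with hFdef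
  have hF : ∀ p, F p = p.1 ∨ F p = p.1.swap := fun p => by
    rw [hFdef]; dsimp only; split_ifs
    · exact Or.inr rfl
    · exact Or.inl rfl
  have hFV : ∀ p, single (F p).1 (F p).2 (1 : ℝ) ∉ V' := fun p => by
    rw [hFdef]; dsimp only; split_ifs with h
    · exact fun h' => hnot _ _ p.2.1.ne ⟨h, h'⟩
    · exact h
  have hFne : ∀ p, (F p).1 ≠ (F p).2 := fun p => by
    rcases hF p with h | h <;> rw [h]
    · exact p.2.1.ne
    · exact p.2.1.ne'
  have hFl : ∀ p, (F p).2 ≠ Fin.last d := fun p => by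
    rcases hF p with h | h <;> rw [h]
    · exact p.2.2
    · exact (p.2.1.trans_le (Fin.le_last _)).ne
  have hpos : ∀ i j : Fin (d + 1), i < j → single i j (1 : ℝ) ∈ V' ∨ single j i (1 : ℝ) ∈ V' := by
    intro i j hij
    -- Roots into the last column are translations, never values of `F`. For other pairs, if neither
    -- vector were in `V'`, then `F` would pick `(i, j)`, leaving the weight of `(j, i)` free and
    -- forcing `E_ji` into `V'`.
    by_cases hj : j = Fin.last d
    · subst hj
      refine Or.inl (weight_vector_mem hV hsup hlead hF hFV (single_mem_zeroLastRow _ hij.ne)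
        single_weight fun p h => ?_)
      exact hFl p (sidonWeight_sub_injective (hFne p) h).2
    · by_contra! hcon
      refine hcon.2 (weight_vector_mem hV hsup hlead hF hFV (single_mem_zeroLastRow _ hj)
        single_weight fun p h => ?_)
      obtain ⟨h1, h2⟩ := sidonWeight_sub_injective (hFne p) h
      have hFp : F p = p.1.swap := by
        refine (hF p).resolve_left fun h3 => ?_
        rw [h3] at h1 h2
        have := p.2.1
        rw [h1, h2] at this
        exact this.not_gt hij
      rw [hFp] at h1 h2
      simp only [Prod.fst_swap, Prod.snd_swap] at h1 h2
      have hmem : single p.1.1 p.1.2 (1 : ℝ) ∈ V' := by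
        by_contra hn
        have : F p = p.1 := if_neg hn
        rw [this] at hFp
        have h5 := congrArg Prod.fst hFp
        exact p.2.1.ne h5
      rw [h1, h2] at hmem
      exact hcon.1 hmem
  refine ⟨fun v hv => ?_, hnot, fun i j hij => ?_⟩
  · refine weight_vector_mem hV hsup hlead hF hFV (c := 0) ?_ (fun i j h => ?_) fun p h => ?_
    · change diagonal v (Fin.last d) = 0
      ext j
      rw [diagonal_apply]
      split_ifs
      · exact hv
      · rfl
    · have : i = j := by
        by_contra hne
        exact h (diagonal_apply_ne _ hne)
      rw [this, sub_self]
    · refine hFne p (sidonWeight_sub_injective (hFne p) (k := (F p).2) (l := (F p).2) ?_).1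
      rw [h, sub_self]
  · rcases lt_or_gt_of_ne hij with h | h
    · exact hpos i j h
    · exact (hpos j i h).symm

/-- A group whose Lie algebra contains all upper triangular matrices with vanishing last row
contains all upper triangular matrices with positive diagonal and last diagonal entry `1`. -/
theorem triangularAffine_subset {H : Submonoid (Matrix (Fin (d + 1)) (Fin (d + 1)) ℝ)}
    {hcl : ClosedInGL H} {hinv : HasInverses H}
    (hdiag : ∀ v : Fin (d + 1) → ℝ, v (Fin.last d) = 0 → diagonal v ∈ lieSubspace H hcl hinv)
    (hup : ∀ i j, i < j → single i j (1 : ℝ) ∈ lieSubspace H hcl hinv) :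
    triangularAffine d ⊆ H := by
  intro T hT
  -- `C m` is the identity with column `m` taken from `T`; multiplying these from the left in
  -- increasing order of `m` builds `T`.
  set C : Fin (d + 1) → Matrix (Fin (d + 1)) (Fin (d + 1)) ℝ := fun m =>
    Matrix.of fun i j => if j = m then T i j else (1 : Matrix (Fin (d + 1)) (Fin (d + 1)) ℝ) i j
    with hC
  have hCmem : ∀ m, C m ∈ H := by
    intro m
    set N : Matrix (Fin (d + 1)) (Fin (d + 1)) ℝ := ∑ i ∈ Finset.Iio m, T i m • single i m 1 with hN
    have hNapp : ∀ i j, N i j = if i < m ∧ j = m then T i m else 0 := by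
      intro i j
      rw [hN, Matrix.sum_apply]
      have : ∀ a ∈ Finset.Iio m, (T a m • single a m (1 : ℝ)) i j
          = if a = i then (if j = m then T i m else 0) else 0 := by
        intro a _
        rw [Matrix.smul_apply, single_apply, smul_eq_mul]
        by_cases h1 : a = i
        · subst h1
          by_cases h2 : j = m
          · simp [h2]
          · simp [h2, Ne.symm h2]
        · simp [h1]
      rw [Finset.sum_congr rfl this, Finset.sum_ite_eq']
      by_cases h1 : i < m <;> simp [h1]
    have hNN : N * N = 0 := by
      ext i j
      rw [Matrix.mul_apply]
      refine Finset.sum_eq_zero fun k _ => ?_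
      rw [hNapp, hNapp]
      by_cases hk : k = m
      · subst hk; simp
      · simp [hk]
    have hNmem : N ∈ lieSubspace H hcl hinv := Submodule.sum_mem _ fun i hi =>
      Submodule.smul_mem _ _ (hup _ _ (Finset.mem_Iio.1 hi))
    have h1 := hNmem 1
    rw [one_smul, Matrix.exp_eq_one_add_of_mul_self_eq_zero hNN] at h1
    set v : Fin (d + 1) → ℝ := fun i => if i = m then Real.log (T m m) else 0 with hv
    have h2 := hdiag v (by
      rw [hv]; dsimp only; split_ifs with h
      · rw [← h, hT.2.2, Real.log_one]
      · rfl) 1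
    rw [one_smul, Matrix.exp_diagonal] at h2
    have hexp : ∀ i, exp v i = if i = m then T m m else 1 := by
      intro i
      rw [Pi.coe_exp, ← Real.exp_eq_exp_ℝ, hv]
      dsimp only
      split_ifs
      · exact Real.exp_log (hT.2.1 m)
      · exact Real.exp_zero
    -- Row `m` is scaled by `T m m`, the exponential of its logarithm, and the part above the
    -- diagonal is `1 + N = exp N` because `N * N = 0`.
    have h3 : C m = diagonal (exp v) * (1 + N) := by
      ext i j
      rw [diagonal_mul, Matrix.add_apply, hNapp, hexp]
      change (if j = m then T i j else (1 : Matrix _ _ ℝ) i j) = _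
      by_cases hj : j = m
      · subst hj
        rcases lt_trichotomy i j with h | rfl | h
        · simp [h, h.ne, one_apply_ne h.ne]
        · simp
        · simp [h.not_gt, one_apply_ne h.ne', hT.1 _ _ h]
      · by_cases hi : i = m
        · subst hi; simp [hj, one_apply_ne (Ne.symm hj)]
        · simp [hj, hi]
    rw [h3]
    exact H.mul_mem h2 h1
  have hprod : ∀ m ≤ d + 1, (Matrix.of fun i j : Fin (d + 1) => if (j : ℕ) < m then T i j else
      (1 : Matrix (Fin (d + 1)) (Fin (d + 1)) ℝ) i j) ∈ H := by
    intro m hm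
    induction m with
    | zero => simp only [Nat.not_lt_zero, if_false]; exact H.one_mem
    | succ m ih =>
      -- Upper triangularity makes row `m` of the columns already filled zero, so left
      -- multiplication by `C m` leaves them unchanged.
      have h1 := H.mul_mem (hCmem ⟨m, hm⟩) (ih (by omega))
      convert! h1 using 1
      ext i j
      have hCk : ∀ k, C ⟨m, hm⟩ i k = (1 : Matrix (Fin (d + 1)) (Fin (d + 1)) ℝ) i k
          + if k = ⟨m, hm⟩ then T i k - (1 : Matrix (Fin (d + 1)) (Fin (d + 1)) ℝ) i k else 0 := by
        intro k
        change (if k = _ then T i k else (1 : Matrix _ _ ℝ) i k) = _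
        split_ifs <;> ring
      simp only [Matrix.mul_apply, hCk, add_mul, Finset.sum_add_distrib, ite_mul, zero_mul,
        Finset.sum_ite_eq', Finset.mem_univ, if_true, of_apply]
      simp only [one_apply, ite_mul, one_mul, zero_mul, Finset.sum_ite_eq, Finset.mem_univ, if_true]
      rcases lt_trichotomy (j : ℕ) m with h | h | h
      · simp [h, h.trans (Nat.lt_succ_self m), hT.1 ⟨m, hm⟩ j h]
      · have : j = ⟨m, hm⟩ := Fin.ext h
        subst this
        simp
      · have : (⟨m, hm⟩ : Fin (d + 1)) ≠ j := fun e => by rw [← e] at h; exact lt_irrefl _ h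
        simp [h.not_gt, show ¬ (j : ℕ) < m + 1 by omega, this]
  have h := hprod (d + 1) le_rfl
  have : (Matrix.of fun i j : Fin (d + 1) => if (j : ℕ) < d + 1 then T i j else
      (1 : Matrix (Fin (d + 1)) (Fin (d + 1)) ℝ) i j) = T := by
    ext i j
    rw [of_apply, if_pos j.2]
  rwa [this] at h

/-- A closed group of affine transformations that is a complement of the orthogonal group in the
sense that it meets it trivially, and that together with it covers the triangular group, contains an
orthogonal conjugate of the triangular group. -/
theorem exists_conj_triangularAffine_subset
    {H : Submonoid (Matrix (Fin (d + 1)) (Fin (d + 1)) ℝ)} (hcl : ClosedInGL H)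
    (hinv : HasInverses H)
    (haff : ∀ A ∈ H, A (Fin.last d) = (1 : Matrix (Fin (d + 1)) (Fin (d + 1)) ℝ) (Fin.last d))
    (horth : ∀ A ∈ H, A * Aᵀ = 1 → A = 1)
    (hfac : ∀ T ∈ triangularAffine d, ∃ h ∈ H, h * hᵀ = T * Tᵀ)
    (hfac1 : ∀ T : ℕ → Matrix (Fin (d + 1)) (Fin (d + 1)) ℝ, (∀ k, T k ∈ triangularAffine d) →
      Tendsto T atTop (𝓝 1) → ∃ h : ℕ → Matrix (Fin (d + 1)) (Fin (d + 1)) ℝ,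
        (∀ k, h k ∈ H ∧ h k * (h k)ᵀ = T k * (T k)ᵀ) ∧ Tendsto h atTop (𝓝 1)) :
    ∃ k : Matrix (Fin (d + 1)) (Fin (d + 1)) ℝ, k * kᵀ = 1 ∧
      k (Fin.last d) = (1 : Matrix (Fin (d + 1)) (Fin (d + 1)) ℝ) (Fin.last d) ∧
      ∀ T ∈ triangularAffine d, k * T * kᵀ ∈ H := by
  have hV : lieSubspace H hcl hinv ≤ zeroLastRow d := fun X hX =>
    row_eq_zero_of_mem_lieSubspace haff hX
  have hsup : zeroLastRow d ≤ lieSubspace H hcl hinv ⊔ skewAffine d := by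
    refine zeroLastRow_le_sup hV fun Z hZ hZl => ?_
    obtain ⟨t, ht0, ht, htm⟩ := exists_pos_one_add_smul_mem_triangularAffine hZ hZl
    have hT1 := (ht.smul_const Z).const_add (1 : Matrix (Fin (d + 1)) (Fin (d + 1)) ℝ)
    rw [zero_smul, add_zero] at hT1
    obtain ⟨h, hh, hlim⟩ := hfac1 _ htm hT1
    exact exists_mem_lieSubspace_add_skew hcl hinv horth ht0 ht (fun k => (hh k).1) hlim
      fun k => (hh k).2
  -- The shift by `2 ^ d` in the weights makes the last one zero: the diagonal one-parameter group
  -- then consists of affine matrices, and `q` inherits the last row of the identity.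
  have hw : sidonWeight d (Fin.last d) = 0 := by simp [sidonWeight]
  obtain ⟨q, hq, ⟨u, hu, hulim⟩, hlead⟩ := exists_orthogonal_leading_terms hcl hinv (sidonWeight d)
    fun m => hfac _ ⟨fun i j hij => diagonal_apply_ne _ hij.ne', fun i => by
      rw [diagonal_apply_eq]; exact Real.exp_pos _, by rw [diagonal_apply_eq, hw]; simp⟩
  have hql : q (Fin.last d) = (1 : Matrix (Fin (d + 1)) (Fin (d + 1)) ℝ) (Fin.last d) := by
    ext j
    refine tendsto_nhds_unique (tendsto_pi_nhds.1 (tendsto_pi_nhds.1 hulim (Fin.last d)) j)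
      (tendsto_const_nhds.congr fun k => ?_)
    obtain ⟨h, hh, v, huk, hv⟩ := hu k
    rw [huk, mul_diagonal, haff h hh]
    by_cases hj : j = Fin.last d
    · rw [hj, hv _ hw, mul_one]
    · rw [one_apply_ne (Ne.symm hj), zero_mul]
  have horth' := conjSubmonoid_orthogonal hq horth
  obtain ⟨hdiag, hnot, htot⟩ := root_structure (hcl := hcl.conj hq) (hinv := hinv.conj hq) horth' hV
    hsup fun X hX c hc => (mem_lieSubspace_conj hq).2 (hlead X hX c hc)
  have haff' : ∀ A ∈ conjSubmonoid H q hq,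
      A (Fin.last d) = (1 : Matrix (Fin (d + 1)) (Fin (d + 1)) ℝ) (Fin.last d) := fun A hA =>
    row_eq_one_of_conj_row_eq_one hq hql (haff _ hA)
  set V' := lieSubspace (conjSubmonoid H q hq) (hcl.conj hq) (hinv.conj hq) with hV'
  obtain ⟨σ, hσ⟩ := exists_perm_of_strictTotal
    (fun i j : Fin (d + 1) => i ≠ j ∧ single i j (1 : ℝ) ∈ V') (fun i h => h.1 rfl)
    (fun i j hij => (htot i j hij).imp (fun h => ⟨hij, h⟩) fun h => ⟨hij.symm, h⟩) (by
      rintro i j k ⟨hij, h1⟩ ⟨hjk, h2⟩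
      have hik : i ≠ k := by
        rintro rfl
        exact hnot _ _ hij ⟨h1, h2⟩
      exact ⟨hik, single_trans_mem_lieSubspace hij hik h1 h2⟩)
  -- The last coordinate is the largest in the order, since every matrix in `V'` has zero last row
  -- and so no `E_{last, j}` belongs to it.
  have hσl : σ (Fin.last d) = Fin.last d := by
    by_contra hne
    have h1 : σ.symm (Fin.last d) < Fin.last d := by
      refine lt_of_le_of_ne (Fin.le_last _) fun h => hne ?_
      rw [← h, Equiv.apply_symm_apply, h]
    obtain ⟨h2, h3⟩ := hσ _ _ h1
    rw [Equiv.apply_symm_apply] at h2 h3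
    have h4 := row_eq_zero_of_mem_lieSubspace haff' h3
    have h5 := congrFun h4 (σ (Fin.last d))
    rw [single_apply_same] at h5
    exact one_ne_zero h5
  set P : Matrix (Fin (d + 1)) (Fin (d + 1)) ℝ := (1 : Matrix _ _ ℝ).submatrix σ.symm id with hP
  have hPT : Pᵀ = (1 : Matrix (Fin (d + 1)) (Fin (d + 1)) ℝ).submatrix id σ.symm := by
    rw [hP, transpose_submatrix, transpose_one]
  have hPconj : ∀ A : Matrix (Fin (d + 1)) (Fin (d + 1)) ℝ,
      P * A * Pᵀ = A.submatrix σ.symm σ.symm := by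
    intro A
    ext i j
    rw [hPT, hP, Matrix.mul_apply]
    simp [Matrix.mul_apply, one_apply]
  have hPo : P * Pᵀ = 1 := by
    have := hPconj 1
    rwa [mul_one, submatrix_one_equiv] at this
  have hPl : P (Fin.last d) = (1 : Matrix (Fin (d + 1)) (Fin (d + 1)) ℝ) (Fin.last d) := by
    ext j
    rw [hP, submatrix_apply, show σ.symm (Fin.last d) = Fin.last d from by
      rw [Equiv.symm_apply_eq, hσl], id]
  have hsub := triangularAffine_subset (hcl := (hcl.conj hq).conj hPo)
    (hinv := (hinv.conj hq).conj hPo)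
    (fun v hv => by
      rw [mem_lieSubspace_conj, hPconj, submatrix_diagonal_equiv]
      refine hdiag _ ?_
      rw [Function.comp_apply, show σ.symm (Fin.last d) = Fin.last d from by
        rw [Equiv.symm_apply_eq, hσl], hv])
    (fun i j hij => by
      rw [mem_lieSubspace_conj, hPconj, submatrix_single_equiv]
      exact (hσ i j hij).2)
  refine ⟨q * P, ?_, ?_, fun T hT => ?_⟩
  · rw [transpose_mul, Matrix.mul_assoc, ← Matrix.mul_assoc P, hPo, one_mul, hq]
  · rw [mul_row_of_row_eq_one hql, hPl]
  · have h1 : q * (P * T * Pᵀ) * qᵀ ∈ H := hsub hT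
    rw [transpose_mul]
    simpa only [Matrix.mul_assoc] using h1

end

/-! ### The upper triangular Cholesky factor: uniqueness, existence, continuity. -/

noncomputable section

open Filter Topology

namespace PosUpper

variable {m : ℕ}

theorem isUnit_toMatrix (W : PosUpper m) : IsUnit W.toMatrix :=
  (Matrix.isUnit_iff_isUnit_det _).2 W.isUnit_det

/-- The inverse is upper triangular and, being the transpose, also lower triangular; what remains is
a positive diagonal with squares 1. -/
theorem eq_one_of_orthogonal {W : PosUpper m} (h : W.toMatrix * W.toMatrixᵀ = 1) : W = 1 := by
  have hinv : W.toMatrix⁻¹ = W.toMatrixᵀ := inv_eq_transpose_of_orthogonal h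
  have hoff : ∀ i j, i ≠ j → W.toMatrix i j = 0 := by
    intro i j hij
    rcases lt_or_gt_of_ne hij with h1 | h1
    · have := W.inv_blockTriangular (i := j) (j := i) h1
      rwa [hinv, transpose_apply] at this
    · exact W.upper i j h1
  ext i j
  rw [coe_one]
  by_cases hij : i = j
  · subst hij
    have h1 := congrFun (congrFun h i) i
    rw [Matrix.mul_apply, Finset.sum_eq_single i (fun j _ hj => by rw [hoff i j hj.symm, zero_mul])
      (by simp), transpose_apply, one_apply_eq] at h1
    rw [one_apply_eq]
    have := W.pos i
    nlinarith
  · rw [hoff i j hij, one_apply_ne hij]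

/-- Uniqueness of the Cholesky factor. -/
theorem eq_of_mul_transpose_eq {V W : PosUpper m}
    (h : V.toMatrix * V.toMatrixᵀ = W.toMatrix * W.toMatrixᵀ) : V = W := by
  have h1 : (V⁻¹ * W).toMatrix * (V⁻¹ * W).toMatrixᵀ = 1 := by
    rw [coe_mul, coe_inv]
    exact inv_mul_orthogonal V.isUnit_toMatrix h
  exact inv_mul_eq_one.1 (eq_one_of_orthogonal h1)

/-- Existence of the Cholesky factor. -/
theorem exists_mul_transpose_eq {B : Matrix (Fin m) (Fin m) ℝ} (hB : IsUnit B) :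
    ∃ W : PosUpper m, W.toMatrix * W.toMatrixᵀ = B * Bᵀ := by
  have hBd := (Matrix.isUnit_iff_isUnit_det _).1 hB
  -- The LDL decomposition uses a lower triangular `L`; applied to the inverse it gives `B * Bᵀ = Lᵀ
  -- * D⁻¹ * L`, whose left factor is upper triangular as required.
  have hS : (B * Bᵀ)⁻¹.PosDef := by
    refine PosDef.inv ?_
    have := Matrix.PosDef.mul_conjTranspose_self B
      (Matrix.vecMul_injective_of_isUnit hB)
    rwa [conjTranspose_eq_transpose_of_trivial] at this
  set L := LDL.lowerInv hS with hL
  have hLunit : IsUnit L.det := Matrix.isUnit_det_of_invertible L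
  have hDL : LDL.diag hS = L * (B * Bᵀ)⁻¹ * Lᵀ := by
    rw [LDL.diag_eq_lowerInv_conj, conjTranspose_eq_transpose_of_trivial]
  have hDpos : ∀ i, 0 < LDL.diagEntries hS i := by
    have h1 : (LDL.diag hS).PosDef := by
      rw [LDL.diag_eq_lowerInv_conj]
      exact hS.mul_mul_conjTranspose_same (Matrix.vecMul_injective_of_isUnit
        ((Matrix.isUnit_iff_isUnit_det _).2 hLunit))
    intro i
    have := h1.diag_pos (i := i)
    rwa [LDL.diag, diagonal_apply_eq] at this
  have hLtri : ∀ i j, i < j → L i j = 0 := fun i j h => LDL.lowerInv_triangular hS h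
  have hLdiag : ∀ i, L i i ≠ 0 := by
    have h1 : Lᵀ.det = ∏ i, L i i := by
      rw [Matrix.det_of_isUpperTriangular (M := Lᵀ) (fun i j h => hLtri j i h)]
      rfl
    rw [det_transpose] at h1
    intro i hi
    exact hLunit.ne_zero (by rw [h1]; exact Finset.prod_eq_zero (Finset.mem_univ i) hi)
  -- A square root of `D⁻¹`, with signs chosen so that `Lᵀ * diagonal s` has positive diagonal.
  set s : Fin m → ℝ := fun j => (L j j / |L j j|) / Real.sqrt (LDL.diagEntries hS j) with hs
  have hss : ∀ j, s j * s j = (LDL.diagEntries hS j)⁻¹ := fun j => by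
    have h1 := abs_pos.2 (hLdiag j)
    have h2 := Real.sqrt_pos.2 (hDpos j)
    rw [hs]
    dsimp only
    rw [div_mul_div_comm, div_mul_div_comm, abs_mul_abs_self,
        div_self (mul_self_ne_zero.2 (hLdiag j)),
      Real.mul_self_sqrt (hDpos j).le, one_div]
  refine ⟨⟨Lᵀ * diagonal s, fun i j h => ?_, fun i => ?_⟩, ?_⟩
  · rw [mul_diagonal, transpose_apply, hLtri j i h, zero_mul]
  · rw [mul_diagonal, transpose_apply, hs]
    dsimp only
    rw [← mul_div_assoc, ← mul_div_assoc]
    exact div_pos (div_pos (mul_self_pos.2 (hLdiag i)) (abs_pos.2 (hLdiag i)))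
      (Real.sqrt_pos.2 (hDpos i))
  · change Lᵀ * diagonal s * (Lᵀ * diagonal s)ᵀ = _
    have hD : diagonal s * diagonal s * LDL.diag hS = 1 := by
      rw [LDL.diag, diagonal_mul_diagonal, diagonal_mul_diagonal, ← diagonal_one]
      congr 1
      ext j
      rw [hss, inv_mul_cancel₀ (hDpos j).ne']
    have hLT : IsUnit Lᵀ.det := by rwa [det_transpose]
    have hBB : IsUnit (B * Bᵀ).det := by rw [det_mul, det_transpose]; exact hBd.mul hBd
    rw [hDL] at hD
    rw [transpose_mul, transpose_transpose, diagonal_transpose]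
    have h1 : (Lᵀ * diagonal s * (diagonal s * L)) * (B * Bᵀ)⁻¹ = 1 := by
      have h2 : Lᵀ * (diagonal s * diagonal s * (L * (B * Bᵀ)⁻¹ * Lᵀ)) = Lᵀ := by rw [hD, mul_one]
      have h3 : (Lᵀ * diagonal s * (diagonal s * L)) * (B * Bᵀ)⁻¹ * Lᵀ = 1 * Lᵀ := by
        rw [one_mul]; simpa only [Matrix.mul_assoc] using h2
      have := congrArg (fun X => X * (Lᵀ)⁻¹) h3
      simpa only [Matrix.mul_assoc, Matrix.mul_nonsing_inv _ hLT, mul_one] using this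
    have := congrArg (fun X => X * (B * Bᵀ)) h1
    simpa only [Matrix.mul_assoc _ (B * Bᵀ)⁻¹, Matrix.nonsing_inv_mul _ hBB, mul_one, one_mul]
      using this

/-- The Cholesky factor depends continuously on the matrix. -/
theorem tendsto_of_mul_transpose {ι : Type*} {l : Filter ι} {f : ι → PosUpper m} {W : PosUpper m}
    (h : Tendsto (fun k => (f k).toMatrix * (f k).toMatrixᵀ) l (𝓝 (W.toMatrix * W.toMatrixᵀ))) :
    Tendsto (fun k => (f k).toMatrix) l (𝓝 W.toMatrix) := by
  -- The diagonal of `f k * (f k)ᵀ` bounds all entries, so every ultrafilter has a limit. That limit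
  -- is upper triangular with nonnegative diagonal and nonzero determinant, and uniqueness
  -- identifies it with `W`.
  rw [tendsto_iff_ultrafilter]
  intro g hg
  have hgl := h.mono_left hg
  set c : ℝ := ∑ i, ((W.toMatrix * W.toMatrixᵀ) i i + 1) with hc
  set K : Set (Matrix (Fin m) (Fin m) ℝ) :=
    Set.univ.pi fun _ => Set.univ.pi fun _ => Set.Icc (-(c + 1)) (c + 1) with hKdef
  have hK : IsCompact K := isCompact_univ_pi fun _ => isCompact_univ_pi fun _ => isCompact_Icc
  have hself : ∀ (V : PosUpper m) i, (V.toMatrix * V.toMatrixᵀ) i i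
      = ∑ j, V.toMatrix i j * V.toMatrix i j := fun V i => by
    rw [Matrix.mul_apply]; rfl
  have hpos : ∀ (V : PosUpper m) i, 0 ≤ (V.toMatrix * V.toMatrixᵀ) i i := fun V i => by
    rw [hself]; exact Finset.sum_nonneg fun j _ => mul_self_nonneg _
  have hev : ∀ᶠ k in (g : Filter ι), (f k).toMatrix ∈ K := by
    have h1 : ∀ i, ∀ᶠ k in (g : Filter ι), ((f k).toMatrix * (f k).toMatrixᵀ) i i
        < (W.toMatrix * W.toMatrixᵀ) i i + 1 := fun i =>
      (tendsto_pi_nhds.1 (tendsto_pi_nhds.1 hgl i) i).eventually (gt_mem_nhds (lt_add_one _))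
    filter_upwards [eventually_all.2 h1] with k hk i _ j _
    have h2 : (f k).toMatrix i j * (f k).toMatrix i j ≤ c := by
      calc (f k).toMatrix i j * (f k).toMatrix i j
          ≤ ((f k).toMatrix * (f k).toMatrixᵀ) i i := by
            rw [hself]
            exact Finset.single_le_sum (f := fun j => (f k).toMatrix i j * (f k).toMatrix i j)
              (fun j _ => mul_self_nonneg _) (Finset.mem_univ j)
        _ ≤ (W.toMatrix * W.toMatrixᵀ) i i + 1 := (hk i).le
        _ ≤ c := Finset.single_le_sum (f := fun i => (W.toMatrix * W.toMatrixᵀ) i i + 1)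
            (fun i _ => by have := hpos W i; linarith) (Finset.mem_univ i)
    have hc0 : 0 ≤ c := (mul_self_nonneg _).trans h2
    exact ⟨by nlinarith, by nlinarith⟩
  obtain ⟨x, -, hx⟩ := hK.ultrafilter_le_nhds (g.map fun k => (f k).toMatrix)
    (le_principal_iff.2 hev)
  have hx' : Tendsto (fun k => (f k).toMatrix) g (𝓝 x) := hx
  have hxx : x * xᵀ = W.toMatrix * W.toMatrixᵀ :=
    tendsto_nhds_unique (hx'.mul ((continuous_id.matrix_transpose.tendsto x).comp hx')) hgl
  have hent : ∀ i j, Tendsto (fun k => (f k).toMatrix i j) g (𝓝 (x i j)) := fun i j =>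
    tendsto_pi_nhds.1 (tendsto_pi_nhds.1 hx' i) j
  have hup : ∀ i j, j < i → x i j = 0 := fun i j hij =>
    tendsto_nhds_unique (hent i j) (tendsto_const_nhds.congr fun k => ((f k).upper i j hij).symm)
  have hdiag : ∀ i, 0 ≤ x i i := fun i =>
    ge_of_tendsto' (hent i i) fun k => ((f k).pos i).le
  have hdet : x.det ≠ 0 := by
    intro h0
    have h1 := congrArg Matrix.det hxx
    rw [det_mul, det_mul, det_transpose, det_transpose, h0, zero_mul] at h1
    exact W.isUnit_det.ne_zero (mul_self_eq_zero.1 h1.symm)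
  have hdiag' : ∀ i, 0 < x i i := fun i => (hdiag i).lt_of_ne fun h0 => hdet (by
    rw [Matrix.det_of_isUpperTriangular (M := x) fun i j h => hup i j h]
    exact Finset.prod_eq_zero (Finset.mem_univ i) h0.symm)
  have : (⟨x, hup, hdiag'⟩ : PosUpper m) = W := eq_of_mul_transpose_eq hxx
  rw [← this]
  exact hx'

end PosUpper

variable {d : ℕ}

theorem last_last_eq_one_of_mul_transpose_eq {W : PosUpper (d + 1)}
    {B : Matrix (Fin (d + 1)) (Fin (d + 1)) ℝ}
    (hB : B (Fin.last d) = (1 : Matrix (Fin (d + 1)) (Fin (d + 1)) ℝ) (Fin.last d))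
    (h : W.toMatrix * W.toMatrixᵀ = B * Bᵀ) : W.toMatrix (Fin.last d) (Fin.last d) = 1 := by
  have h1 := congrFun (congrFun h (Fin.last d)) (Fin.last d)
  rw [mul_row_of_row_eq_one hB, transpose_apply, hB, one_apply_eq, Matrix.mul_apply,
    Finset.sum_eq_single (Fin.last d) (fun j _ hj => by
      rw [W.upper _ _ (lt_of_le_of_ne (Fin.le_last j) hj), zero_mul]) (by simp),
    transpose_apply] at h1
  have := W.pos (Fin.last d)
  nlinarith

theorem exists_mem_triangularAffine_mul_transpose_eq {B : Matrix (Fin (d + 1)) (Fin (d + 1)) ℝ}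
    (hB : B (Fin.last d) = (1 : Matrix (Fin (d + 1)) (Fin (d + 1)) ℝ) (Fin.last d))
    (hBu : IsUnit B) : ∃ W : PosUpper (d + 1), W.toMatrix ∈ triangularAffine d ∧
      W.toMatrix * W.toMatrixᵀ = B * Bᵀ := by
  obtain ⟨W, hW⟩ := PosUpper.exists_mul_transpose_eq hBu
  exact ⟨W, ⟨W.upper, W.pos, last_last_eq_one_of_mul_transpose_eq hB hW⟩, hW⟩

/-- A complement of the orthogonal group cannot properly contain another one: Cholesky writes `kᵀ *
A * k` as a triangular matrix, already in the conjugate of `H`, times an orthogonal one, which is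
then trivial. -/
theorem eq_conj_of_conj_triangularAffine_subset
    {H : Submonoid (Matrix (Fin (d + 1)) (Fin (d + 1)) ℝ)} (hinv : HasInverses H)
    (haff : ∀ A ∈ H, A (Fin.last d) = (1 : Matrix (Fin (d + 1)) (Fin (d + 1)) ℝ) (Fin.last d))
    (horth : ∀ A ∈ H, A * Aᵀ = 1 → A = 1) {k : Matrix (Fin (d + 1)) (Fin (d + 1)) ℝ}
    (hk : k * kᵀ = 1)
    (hkl : k (Fin.last d) = (1 : Matrix (Fin (d + 1)) (Fin (d + 1)) ℝ) (Fin.last d))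
    (hsub : ∀ T ∈ triangularAffine d, k * T * kᵀ ∈ H) {A : Matrix (Fin (d + 1)) (Fin (d + 1)) ℝ}
    (hA : A ∈ H) : ∃ T ∈ triangularAffine d, A = k * T * kᵀ := by
  have hk' : kᵀ * k = 1 := mul_eq_one_comm.1 hk
  set B := kᵀ * A * k with hB
  have hkB : k * B * kᵀ = A := by
    calc k * B * kᵀ = (k * kᵀ) * A * (k * kᵀ) := by rw [hB]; simp only [Matrix.mul_assoc]
      _ = A := by rw [hk, one_mul, mul_one]
  have hBH : B ∈ conjSubmonoid H k hk := by rw [mem_conjSubmonoid, hkB]; exact hA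
  have hBl := row_eq_one_of_conj_row_eq_one hk hkl (A := B) (by rw [hkB]; exact haff A hA)
  obtain ⟨W, hWt, hW⟩ := exists_mem_triangularAffine_mul_transpose_eq hBl (hinv.conj hk B hBH).1
  have hWH : W.toMatrix ∈ conjSubmonoid H k hk := hsub _ hWt
  have h1 := conjSubmonoid_orthogonal hk horth _ (Submonoid.mul_mem _ (hinv.conj hk _ hWH).2 hBH)
    (inv_mul_orthogonal W.isUnit_toMatrix hW)
  refine ⟨W.toMatrix, hWt, ?_⟩
  have h2 := Matrix.mul_nonsing_inv_cancel_left _ B W.isUnit_det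
  rw [h1, mul_one] at h2
  rw [h2, hkB]

end

/-! ### Affine maps, parameters and the Gaussian group as block matrices. -/

noncomputable section

open Filter Topology

variable {d : ℕ}

/-- The block matrix `[[A, b], [0, 1]]` of the affine map `y ↦ A y + b`. -/
def affineMatrix (A : Matrix (Fin d) (Fin d) ℝ) (b : EuclideanSpace ℝ (Fin d)) :
    Matrix (Fin (d + 1)) (Fin (d + 1)) ℝ :=
  Matrix.of fun i j => Fin.lastCases (motive := fun _ => ℝ)
    (Fin.lastCases (motive := fun _ => ℝ) 1 (fun _ => 0) j)
    (fun i' => Fin.lastCases (motive := fun _ => ℝ) (b i') (fun j' => A i' j') j) i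

section Entries

variable (A : Matrix (Fin d) (Fin d) ℝ) (b : EuclideanSpace ℝ (Fin d)) (i j : Fin d)

@[simp] theorem affineMatrix_castSucc_castSucc :
    affineMatrix A b i.castSucc j.castSucc = A i j := by simp [affineMatrix]

@[simp] theorem affineMatrix_castSucc_last :
    affineMatrix A b i.castSucc (Fin.last d) = b i := by simp [affineMatrix]

@[simp] theorem affineMatrix_last_castSucc :
    affineMatrix A b (Fin.last d) j.castSucc = 0 := by simp [affineMatrix]

@[simp] theorem affineMatrix_last_last :
    affineMatrix A b (Fin.last d) (Fin.last d) = 1 := by simp [affineMatrix]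

end Entries

theorem Matrix.ext_castSucc {M N : Matrix (Fin (d + 1)) (Fin (d + 1)) ℝ}
    (h1 : ∀ i j : Fin d, M i.castSucc j.castSucc = N i.castSucc j.castSucc)
    (h2 : ∀ i : Fin d, M i.castSucc (Fin.last d) = N i.castSucc (Fin.last d))
    (h3 : ∀ j : Fin d, M (Fin.last d) j.castSucc = N (Fin.last d) j.castSucc)
    (h4 : M (Fin.last d) (Fin.last d) = N (Fin.last d) (Fin.last d)) : M = N := by
  ext i j
  refine Fin.lastCases ?_ (fun i => ?_) i <;> refine Fin.lastCases ?_ (fun j => ?_) j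
  exacts [h4, h3 j, h2 i, h1 i j]

theorem toEuclideanCLM_apply_apply (A : Matrix (Fin d) (Fin d) ℝ) (b : EuclideanSpace ℝ (Fin d))
    (i : Fin d) : toEuclideanCLM (𝕜 := ℝ) A b i = ∑ j, A i j * b j := rfl

theorem affineMatrix_mul (A A' : Matrix (Fin d) (Fin d) ℝ) (b b' : EuclideanSpace ℝ (Fin d)) :
    affineMatrix A b * affineMatrix A' b'
      = affineMatrix (A * A') (toEuclideanCLM (𝕜 := ℝ) A b' + b) := by
  apply Matrix.ext_castSucc <;> intros <;>
    simp [Matrix.mul_apply, Fin.sum_univ_castSucc, toEuclideanCLM_apply_apply]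

theorem affineMatrix_one : affineMatrix (1 : Matrix (Fin d) (Fin d) ℝ) 0 = 1 := by
  apply Matrix.ext_castSucc
  · intro i j; simp [one_apply]
  · intro i; simp [one_apply_ne (Fin.castSucc_lt_last i).ne]
  · intro j; simp [one_apply_ne (Fin.castSucc_lt_last j).ne']
  · simp

theorem affineMatrix_row_last (A : Matrix (Fin d) (Fin d) ℝ) (b : EuclideanSpace ℝ (Fin d)) :
    affineMatrix A b (Fin.last d)
      = (1 : Matrix (Fin (d + 1)) (Fin (d + 1)) ℝ) (Fin.last d) := by
  rw [← affineMatrix_one]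
  ext j
  refine Fin.lastCases ?_ (fun j => ?_) j <;> simp

theorem affineMatrix_injective {A A' : Matrix (Fin d) (Fin d) ℝ} {b b' : EuclideanSpace ℝ (Fin d)}
    (h : affineMatrix A b = affineMatrix A' b') : A = A' ∧ b = b' := by
  constructor
  · ext i j
    simpa using congrFun (congrFun h i.castSucc) j.castSucc
  · ext i
    simpa using congrFun (congrFun h i.castSucc) (Fin.last d)

/-- The product is `[[A Aᵀ + b bᵀ, b], [bᵀ, 1]]`: it sees `A` only through `A * Aᵀ`, so it carries
exactly the mean and the covariance. -/
theorem affineMatrix_mul_transpose_congr {A A' : Matrix (Fin d) (Fin d) ℝ}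
    (h : A * Aᵀ = A' * A'ᵀ) (b : EuclideanSpace ℝ (Fin d)) :
    affineMatrix A b * (affineMatrix A b)ᵀ = affineMatrix A' b * (affineMatrix A' b)ᵀ := by
  apply Matrix.ext_castSucc
  · intro i j
    have := congrFun (congrFun h i) j
    simp only [Matrix.mul_apply, transpose_apply] at this
    simp [Matrix.mul_apply, Fin.sum_univ_castSucc, this]
  all_goals intros; simp [Matrix.mul_apply, Fin.sum_univ_castSucc]

theorem continuous_affineMatrix :
    Continuous fun p : Matrix (Fin d) (Fin d) ℝ × EuclideanSpace ℝ (Fin d) =>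
      affineMatrix p.1 p.2 := by
  refine continuous_pi fun i => continuous_pi fun j => ?_
  refine Fin.lastCases ?_ (fun i => ?_) i <;> refine Fin.lastCases ?_ (fun j => ?_) j <;>
    simp only [affineMatrix_castSucc_castSucc, affineMatrix_castSucc_last,
      affineMatrix_last_castSucc, affineMatrix_last_last]
  · exact continuous_const
  · exact continuous_const
  · fun_prop
  · fun_prop

/-- Recover the parameters of an affine map from its block matrix. -/
theorem isInducing_affineMatrix :
    IsInducing fun p : Matrix (Fin d) (Fin d) ℝ × EuclideanSpace ℝ (Fin d) =>
      affineMatrix p.1 p.2 := by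
  have hr : Continuous fun M : Matrix (Fin (d + 1)) (Fin (d + 1)) ℝ =>
      ((Matrix.of fun i j : Fin d => M i.castSucc j.castSucc,
        WithLp.toLp 2 fun i : Fin d => M i.castSucc (Fin.last d)) :
        Matrix (Fin d) (Fin d) ℝ × EuclideanSpace ℝ (Fin d)) := by
    refine Continuous.prodMk ?_ ?_
    · exact continuous_pi fun i => continuous_pi fun j => continuous_apply_apply _ _
    · exact (PiLp.continuous_toLp 2 _).comp (continuous_pi fun i => continuous_apply_apply _ _)
  refine IsInducing.of_comp continuous_affineMatrix hr ?_
  convert! IsInducing.id using 1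
  ext p : 1
  refine Prod.ext ?_ ?_
  · ext i j; simp
  · ext i; simp

theorem isInducing_affineMatrix_posUpper :
    IsInducing fun p : PosUpper d × EuclideanSpace ℝ (Fin d) => affineMatrix p.1.toMatrix p.2 :=
  isInducing_affineMatrix.comp ((⟨rfl⟩ : IsInducing (PosUpper.toMatrix (d := d))).prodMap
      IsInducing.id)

/-- The block matrix of an affine map with triangular linear part. -/
def PosUpper.affine (V : PosUpper d) (b : EuclideanSpace ℝ (Fin d)) : PosUpper (d + 1) where
  toMatrix := affineMatrix V.toMatrix b
  upper i j := by
    refine Fin.lastCases ?_ (fun i => ?_) i <;> refine Fin.lastCases ?_ (fun j => ?_) j <;> intro h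
    · exact absurd h (lt_irrefl _)
    · simp
    · exact absurd h (Fin.castSucc_lt_last _).not_gt
    · simpa using V.upper i j (Fin.castSucc_lt_castSucc_iff.1 h)
  pos i := by
    refine Fin.lastCases ?_ (fun i => ?_) i
    · simp
    · simpa using V.pos i

theorem PosUpper.affine_mem_triangularAffine (V : PosUpper d) (b : EuclideanSpace ℝ (Fin d)) :
    affineMatrix V.toMatrix b ∈ triangularAffine d :=
  ⟨(V.affine b).upper, (V.affine b).pos, affineMatrix_last_last _ _⟩

theorem range_affineMatrix_posUpper :
    Set.range (fun p : PosUpper d × EuclideanSpace ℝ (Fin d) => affineMatrix p.1.toMatrix p.2)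
      = triangularAffine d := by
  refine Set.Subset.antisymm ?_ fun T hT => ?_
  · rintro _ ⟨p, rfl⟩
    exact p.1.affine_mem_triangularAffine p.2
  · refine ⟨(⟨Matrix.of fun i j => T i.castSucc j.castSucc, fun i j h => hT.1 _ _
      (Fin.castSucc_lt_castSucc_iff.2 h), fun i => hT.2.1 _⟩,
      WithLp.toLp 2 fun i => T i.castSucc (Fin.last d)), ?_⟩
    apply Matrix.ext_castSucc
    · intro i j; simp
    · intro i; simp
    · intro j; simp [hT.1 _ _ (Fin.castSucc_lt_last j)]
    · simp [hT.2.2]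

/-- Yields local compactness of the parameter space and of `GaussianGroup d`, as the open mapping
theorems need. -/
theorem isLocallyClosed_triangularAffine : IsLocallyClosed (triangularAffine d) := by
  have h1 : IsClosed {T : Matrix (Fin (d + 1)) (Fin (d + 1)) ℝ |
      (∀ i j, j < i → T i j = 0) ∧ T (Fin.last d) (Fin.last d) = 1} := by
    simp only [Set.ofPred_and, Set.ofPred_forall]
    refine IsClosed.inter (isClosed_iInter fun i => isClosed_iInter fun j =>
      isClosed_iInter fun _ => isClosed_eq (continuous_id.matrix_elem i j) continuous_const) ?_
    exact isClosed_eq (continuous_id.matrix_elem _ _) continuous_const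
  have h2 : IsOpen {T : Matrix (Fin (d + 1)) (Fin (d + 1)) ℝ | ∀ i, 0 < T i i} := by
    simp only [Set.ofPred_forall]
    exact isOpen_iInter_of_finite fun i => isOpen_lt continuous_const
      (continuous_id.matrix_elem i i)
  have h3 : triangularAffine d = {T | (∀ i j, j < i → T i j = 0) ∧
      T (Fin.last d) (Fin.last d) = 1} ∩ {T | ∀ i, 0 < T i i} := by
    ext T
    simp only [triangularAffine, Set.mem_ofPred_eq, Set.mem_inter_iff]
    tauto
  rw [h3]
  exact h1.isLocallyClosed.inter h2.isLocallyClosed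

/-- The block matrix of the pair `(U, μ)`. -/
def NormalParam.toMatrix (θ : NormalParam d) : Matrix (Fin (d + 1)) (Fin (d + 1)) ℝ :=
  affineMatrix θ.chol.toMatrix θ.mean

/-- The block matrix of an element of `G_𝒩`. -/
def GaussianGroup.toMatrix (g : GaussianGroup d) : Matrix (Fin (d + 1)) (Fin (d + 1)) ℝ :=
  affineMatrix g.linear.toMatrix g.shift

namespace NormalParam

theorem toMatrix_injective : Function.Injective (toMatrix (d := d)) := fun θ θ' h => by
  obtain ⟨h1, h2⟩ := affineMatrix_injective h
  exact NormalParam.ext (PosUpper.ext h1) h2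

theorem toMatrix_mem (θ : NormalParam d) : θ.toMatrix ∈ triangularAffine d :=
  θ.chol.affine_mem_triangularAffine θ.mean

theorem exists_toMatrix_eq {T : Matrix (Fin (d + 1)) (Fin (d + 1)) ℝ}
    (hT : T ∈ triangularAffine d) :
    ∃ θ : NormalParam d, θ.toMatrix = T := by
  rw [← range_affineMatrix_posUpper] at hT
  obtain ⟨p, rfl⟩ := hT
  exact ⟨⟨p.1, p.2⟩, rfl⟩

theorem isInducing_toMatrix : IsInducing (toMatrix (d := d)) :=
  isInducing_affineMatrix_posUpper.comp (f := fun θ : NormalParam d => (θ.chol, θ.mean)) ⟨rfl⟩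

theorem isEmbedding_toMatrix : IsEmbedding (toMatrix (d := d)) :=
  ⟨isInducing_toMatrix, toMatrix_injective⟩

instance : T2Space (NormalParam d) := isEmbedding_toMatrix.t2Space

instance : LocallyCompactSpace (NormalParam d) := by
  have : LocallyCompactSpace (Matrix (Fin (d + 1)) (Fin (d + 1)) ℝ) :=
    inferInstanceAs (LocallyCompactSpace (Fin (d + 1) → Fin (d + 1) → ℝ))
  refine isInducing_toMatrix.locallyCompactSpace ?_
  have : Set.range (toMatrix (d := d)) = triangularAffine d :=
    Set.Subset.antisymm (by rintro _ ⟨θ, rfl⟩; exact θ.toMatrix_mem)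
      fun T hT => exists_toMatrix_eq hT
  rw [this]
  exact isLocallyClosed_triangularAffine

end NormalParam

namespace GaussianGroup

theorem toMatrix_injective : Function.Injective (toMatrix (d := d)) := fun θ θ' h => by
  obtain ⟨h1, h2⟩ := affineMatrix_injective h
  exact GaussianGroup.ext (PosUpper.ext h1) h2

theorem toMatrix_mem (g : GaussianGroup d) : g.toMatrix ∈ triangularAffine d :=
  g.linear.affine_mem_triangularAffine g.shift

theorem exists_toMatrix_eq {T : Matrix (Fin (d + 1)) (Fin (d + 1)) ℝ}
    (hT : T ∈ triangularAffine d) :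
    ∃ θ : GaussianGroup d, θ.toMatrix = T := by
  rw [← range_affineMatrix_posUpper] at hT
  obtain ⟨p, rfl⟩ := hT
  exact ⟨⟨p.1, p.2⟩, rfl⟩

theorem isInducing_toMatrix : IsInducing (toMatrix (d := d)) :=
  isInducing_affineMatrix_posUpper.comp (f := fun g : GaussianGroup d => (g.linear, g.shift)) ⟨rfl⟩

theorem isEmbedding_toMatrix : IsEmbedding (toMatrix (d := d)) :=
  ⟨isInducing_toMatrix, toMatrix_injective⟩

theorem toMatrix_mul (g h : GaussianGroup d) : (g * h).toMatrix = g.toMatrix * h.toMatrix :=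
  (affineMatrix_mul _ _ _ _).symm

instance : T2Space (GaussianGroup d) := isEmbedding_toMatrix.t2Space

instance : LocallyCompactSpace (GaussianGroup d) := by
  have : LocallyCompactSpace (Matrix (Fin (d + 1)) (Fin (d + 1)) ℝ) :=
    inferInstanceAs (LocallyCompactSpace (Fin (d + 1) → Fin (d + 1) → ℝ))
  refine isInducing_toMatrix.locallyCompactSpace ?_
  have : Set.range (toMatrix (d := d)) = triangularAffine d :=
    Set.Subset.antisymm (by rintro _ ⟨θ, rfl⟩; exact θ.toMatrix_mem)
      fun T hT => exists_toMatrix_eq hT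
  rw [this]
  exact isLocallyClosed_triangularAffine

instance : ContinuousMul (GaussianGroup d) :=
  IsInducing.continuousMul (⟨toMatrix, toMatrix_mul⟩ :
    GaussianGroup d →ₙ* Matrix (Fin (d + 1)) (Fin (d + 1)) ℝ) isInducing_toMatrix

instance : SecondCountableTopology (GaussianGroup d) := by
  have : SecondCountableTopology (Matrix (Fin (d + 1)) (Fin (d + 1)) ℝ) :=
    inferInstanceAs (SecondCountableTopology (Fin (d + 1) → Fin (d + 1) → ℝ))
  exact isInducing_toMatrix.secondCountableTopology

end GaussianGroup

end

/-! ### From an affine representation to the isomorphism with the Gaussian group. -/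

noncomputable section

open Filter Topology

variable {d : ℕ}

namespace NormalParam

theorem eq_of_toMatrix_mul_transpose_eq {θ θ' : NormalParam d}
    (h : θ.toMatrix * θ.toMatrixᵀ = θ'.toMatrix * θ'.toMatrixᵀ) : θ = θ' :=
  toMatrix_injective (congrArg PosUpper.toMatrix (PosUpper.eq_of_mul_transpose_eq
    (V := θ.chol.affine θ.mean) (W := θ'.chol.affine θ'.mean) h))

theorem tendsto_of_toMatrix_mul_transpose {ι : Type*} {l : Filter ι} {f : ι → NormalParam d}
    {θ : NormalParam d}
    (h : Tendsto (fun k => (f k).toMatrix * (f k).toMatrixᵀ) l (𝓝 (θ.toMatrix * θ.toMatrixᵀ))) :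
    Tendsto f l (𝓝 θ) :=
  isInducing_toMatrix.tendsto_nhds_iff.2 (PosUpper.tendsto_of_mul_transpose
    (f := fun k => (f k).chol.affine (f k).mean) (W := θ.chol.affine θ.mean) h)

/-- The parameter of the standard normal distribution. -/
def std (d : ℕ) : NormalParam d := ⟨1, 0⟩

theorem toMatrix_std : (std d).toMatrix = 1 := affineMatrix_one

end NormalParam

/-- A group of affine transformations that acts simply transitively on the normal distributions is
an orthogonal conjugate of the triangular group. -/
theorem exists_continuousMulEquiv_gaussianGroup {G : Type*} [Group G] [TopologicalSpace G]
    [IsTopologicalGroup G] [SigmaCompactSpace G] [MulAction G (NormalParam d)]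
    (hst : IsSimplyTransitive G (NormalParam d))
    (φ : G →* Matrix (Fin (d + 1)) (Fin (d + 1)) ℝ) (hφ : Continuous φ)
    (haff : ∀ g, φ g (Fin.last d) = (1 : Matrix (Fin (d + 1)) (Fin (d + 1)) ℝ) (Fin.last d))
    (hR : ∀ (g : G) (θ : NormalParam d), (g • θ).toMatrix * (g • θ).toMatrixᵀ
      = (φ g * θ.toMatrix) * (φ g * θ.toMatrix)ᵀ) :
    ∃ k : Matrix (Fin (d + 1)) (Fin (d + 1)) ℝ, k * kᵀ = 1 ∧
      ∃ e : G ≃ₜ* GaussianGroup d, ∀ g, φ g = k * (e g).toMatrix * kᵀ := by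
  -- Continuity of the action on parameters comes for free: the new parameter is a Cholesky factor
  -- of an expression continuous in `φ g` and `θ`.
  have hsmul : ContinuousSMul G (NormalParam d) := by
    refine ⟨continuous_iff_continuousAt.2 fun p => ?_⟩
    refine NormalParam.tendsto_of_toMatrix_mul_transpose ?_
    simp only [hR]
    have h1 : Continuous fun p : G × NormalParam d => φ p.1 * p.2.toMatrix :=
      (hφ.comp continuous_fst).mul (NormalParam.isInducing_toMatrix.continuous.comp continuous_snd)
    exact (h1.mul h1.matrix_transpose).continuousAt
  have htrans : MulAction.IsPretransitive G (NormalParam d) := ⟨fun x y => (hst x y).exists⟩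
  set θ₀ := NormalParam.std d with hθ₀
  have hfree : ∀ g h : G, g • θ₀ = h • θ₀ → g = h := fun g h hgh =>
    (hst θ₀ (h • θ₀)).unique hgh rfl
  -- The open mapping theorem for σ-compact groups makes the orbit map a homeomorphism onto its
  -- image, so convergence in `G` can be tested on parameters.
  have horbit : IsOpenEmbedding fun g : G => g • θ₀ :=
    IsOpenEmbedding.of_continuous_injective_isOpenMap (by fun_prop) (fun g h => hfree g h)
      (isOpenMap_smul_of_sigmaCompact θ₀)
  have hR0 : ∀ g, (g • θ₀).toMatrix * (g • θ₀).toMatrixᵀ = φ g * (φ g)ᵀ := fun g => by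
    rw [hR, hθ₀, NormalParam.toMatrix_std, mul_one]
  have hunit : ∀ g, φ g * φ g⁻¹ = 1 := fun g => by rw [← map_mul, mul_inv_cancel, map_one]
  set H := MonoidHom.mrange φ with hH
  have hinv : HasInverses H := by
    rintro _ ⟨g, rfl⟩
    refine ⟨IsUnit.of_mul_eq_one _ (hunit g), ⟨g⁻¹, ?_⟩⟩
    exact (Matrix.inv_eq_right_inv (hunit g)).symm
  have haffH : ∀ A ∈ H, A (Fin.last d)
      = (1 : Matrix (Fin (d + 1)) (Fin (d + 1)) ℝ) (Fin.last d) := by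
    rintro _ ⟨g, rfl⟩
    exact haff g
  have horth : ∀ A ∈ H, A * Aᵀ = 1 → A = 1 := by
    rintro _ ⟨g, rfl⟩ h
    have h1 : g • θ₀ = (1 : G) • θ₀ := by
      refine NormalParam.eq_of_toMatrix_mul_transpose_eq ?_
      rw [hR0, h, hR0, map_one, transpose_one, mul_one]
    rw [hfree g 1 h1, map_one]
  have hfac : ∀ T ∈ triangularAffine d, ∃ h ∈ H, h * hᵀ = T * Tᵀ := by
    intro T hT
    obtain ⟨θ, rfl⟩ := NormalParam.exists_toMatrix_eq hT
    obtain ⟨g, rfl⟩ := (hst θ₀ θ).exists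
    exact ⟨φ g, ⟨g, rfl⟩, (hR0 g).symm⟩
  have hfac1 : ∀ T : ℕ → Matrix (Fin (d + 1)) (Fin (d + 1)) ℝ, (∀ k, T k ∈ triangularAffine d) →
      Tendsto T atTop (𝓝 1) → ∃ h : ℕ → Matrix (Fin (d + 1)) (Fin (d + 1)) ℝ,
        (∀ k, h k ∈ H ∧ h k * (h k)ᵀ = T k * (T k)ᵀ) ∧ Tendsto h atTop (𝓝 1) := by
    intro T hT hlim
    choose θ hθ using fun k => NormalParam.exists_toMatrix_eq (hT k)
    choose g hg using fun k => (hst θ₀ (θ k)).exists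
    refine ⟨fun k => φ (g k), fun k => ⟨⟨g k, rfl⟩, by rw [← hR0, hg, hθ]⟩, ?_⟩
    have h1 : Tendsto θ atTop (𝓝 θ₀) := by
      rw [NormalParam.isInducing_toMatrix.tendsto_nhds_iff, hθ₀, NormalParam.toMatrix_std]
      exact hlim.congr fun k => (hθ k).symm
    have h2 : Tendsto g atTop (𝓝 1) := by
      rw [horbit.isInducing.tendsto_nhds_iff, one_smul]
      exact h1.congr fun k => (hg k).symm
    have h3 := (hφ.tendsto 1).comp h2
    rwa [map_one] at h3
  -- The Cholesky factor of the limit `B` is the parameter of some `g' • θ₀`. The orbit points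
  -- converge to it, so `g k` tends to `g'` and `B = φ g'`.
  have hcl : ClosedInGL H := by
    intro u B hu hlim hB
    choose g hg using hu
    have hBl : B (Fin.last d) = (1 : Matrix (Fin (d + 1)) (Fin (d + 1)) ℝ) (Fin.last d) := by
      ext j
      refine tendsto_nhds_unique (tendsto_pi_nhds.1 (tendsto_pi_nhds.1 hlim (Fin.last d)) j)
        (tendsto_const_nhds.congr fun k => ?_)
      rw [← hg, haff]
    obtain ⟨W, hWt, hW⟩ := exists_mem_triangularAffine_mul_transpose_eq hBl hB
    obtain ⟨θ, hθ⟩ := NormalParam.exists_toMatrix_eq hWt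
    obtain ⟨g', hg'⟩ := (hst θ₀ θ).exists
    have h1 : Tendsto (fun k => g k • θ₀) atTop (𝓝 (g' • θ₀)) := by
      refine NormalParam.tendsto_of_toMatrix_mul_transpose ?_
      rw [hg', hθ, hW]
      simp only [hR0, hg]
      exact hlim.mul ((continuous_id.matrix_transpose.tendsto B).comp hlim)
    have h2 : Tendsto g atTop (𝓝 g') := horbit.isInducing.tendsto_nhds_iff.2 h1
    have h3 : Tendsto (fun k => φ (g k)) atTop (𝓝 (φ g')) := (hφ.tendsto g').comp h2
    simp only [hg] at h3
    exact ⟨g', tendsto_nhds_unique h3 hlim⟩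
  obtain ⟨k, hk, hkl, hsub⟩ := exists_conj_triangularAffine_subset hcl hinv haffH horth hfac hfac1
  refine ⟨k, hk, ?_⟩
  have hex : ∀ g, ∃ x : GaussianGroup d, φ g = k * x.toMatrix * kᵀ := fun g => by
    obtain ⟨T, hT, h⟩ := eq_conj_of_conj_triangularAffine_subset hinv haffH horth hk hkl hsub
      (A := φ g) ⟨g, rfl⟩
    obtain ⟨x, rfl⟩ := GaussianGroup.exists_toMatrix_eq hT
    exact ⟨x, h⟩
  choose f hf using hex
  have hfeq : ∀ {g x}, φ g = k * GaussianGroup.toMatrix x * kᵀ → f g = x := fun {g x} h =>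
    GaussianGroup.toMatrix_injective (orthogonal_conj_injective hk ((hf g).symm.trans h))
  have hk' : kᵀ * k = 1 := mul_eq_one_comm.1 hk
  have hfm : ∀ g, (f g).toMatrix = kᵀ * φ g * k := fun g => by
    calc (f g).toMatrix = (kᵀ * k) * (f g).toMatrix * (kᵀ * k) := by rw [hk', one_mul, mul_one]
      _ = _ := by rw [hf]; simp only [Matrix.mul_assoc]
  let F : G →* GaussianGroup d := MonoidHom.mk' f fun a b => hfeq (by
    rw [map_mul, hf, hf, conj_mul_conj hk, GaussianGroup.toMatrix_mul])
  have hF : Continuous F := by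
    rw [GaussianGroup.isInducing_toMatrix.continuous_iff]
    have : GaussianGroup.toMatrix ∘ F = fun g => kᵀ * φ g * k := funext hfm
    rw [this]
    fun_prop
  have hinj : Function.Injective F := by
    intro a b hab
    have h1 : φ a = φ b := by
      rw [hf, hf]
      exact congrArg (fun x => k * GaussianGroup.toMatrix x * kᵀ) hab
    refine hfree a b (NormalParam.eq_of_toMatrix_mul_transpose_eq ?_)
    rw [hR0, hR0, h1]
  have hsurj : Function.Surjective F := by
    intro x
    obtain ⟨g, hg⟩ := hsub _ x.toMatrix_mem
    exact ⟨g, hfeq hg⟩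
  have hopen := F.isOpenMap_of_sigmaCompact hsurj hF
  let e := MulEquiv.ofBijective F ⟨hinj, hsurj⟩
  exact ⟨{ e with
    continuous_toFun := hF
    continuous_invFun := (e.toEquiv.toHomeomorphOfContinuousOpen hF hopen).symm.continuous }, hf⟩

end

/-! ### Gaussian measures: densities, affine images, identifiability. -/

noncomputable section

open Filter Topology
open scoped RealInnerProductSpace

theorem MeasurableEquiv.map_withDensity {α β : Type*} [MeasurableSpace α] [MeasurableSpace β]
    (e : α ≃ᵐ β) (μ : Measure α) (f : α → ENNReal) :
    (μ.withDensity f).map e = (μ.map e).withDensity (f ∘ e.symm) := by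
  ext s hs
  rw [e.map_apply, withDensity_apply _ (e.measurable hs), withDensity_apply _ hs, e.restrict_map,
    lintegral_map_equiv]
  simp

section StdGaussian

variable {E : Type*} [NormedAddCommGroup E] [InnerProductSpace ℝ E] [FiniteDimensional ℝ E]
  [MeasurableSpace E] [BorelSpace E]

theorem integrable_rexp_neg_half_norm_sq : Integrable fun y : E => Real.exp (-(‖y‖ ^ 2 / 2)) := by
  have h := (GaussianFourier.integrable_cexp_neg_mul_sq_norm_add (V := E) (b := 1 / 2)
    (by norm_num) 0 0).norm
  refine h.congr (Eventually.of_forall fun y => ?_)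
  simp only [Complex.norm_exp]
  congr 1
  simp [← Complex.ofReal_pow]
  ring

/-- The density of the standard Gaussian measure. -/
theorem exists_stdGaussian_eq_withDensity : ∃ c : ℝ, stdGaussian E
    = (volume : Measure E).withDensity fun y => ENNReal.ofReal (Real.exp (c - ‖y‖ ^ 2 / 2)) := by
  set Z : ℝ := ∫ y : E, Real.exp (-(‖y‖ ^ 2 / 2)) with hZ
  have hint := integrable_rexp_neg_half_norm_sq (E := E)
  have hZ0 : 0 < Z := by
    rw [hZ, integral_pos_iff_support_of_nonneg (fun y => (Real.exp_pos _).le) hint]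
    have : Function.support (fun y : E => Real.exp (-(‖y‖ ^ 2 / 2))) = Set.univ := by
      ext y; simp [(Real.exp_pos _).ne']
    rw [this]
    exact Measure.measure_univ_pos.2 (NeZero.ne _)
  have hfe : ∀ y : E, Real.exp (-Real.log Z - ‖y‖ ^ 2 / 2) = Z⁻¹ * Real.exp (-(‖y‖ ^ 2 / 2)) := by
    intro y
    rw [sub_eq_add_neg, Real.exp_add, Real.exp_neg, Real.exp_log hZ0]
  refine ⟨-Real.log Z, ?_⟩
  simp only [hfe]
  have hfin : IsFiniteMeasure ((volume : Measure E).withDensity fun y =>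
      ENNReal.ofReal (Z⁻¹ * Real.exp (-(‖y‖ ^ 2 / 2)))) :=
    isFiniteMeasure_withDensity_ofReal (hint.const_mul _).2
  -- The constant is fixed by normalisation; equality of the measures is then the Fourier transform
  -- of a Gaussian.
  refine Measure.ext_of_charFun (funext fun t => ?_)
  rw [charFun_stdGaussian, charFun_apply, integral_withDensity_eq_integral_toReal_smul
    (by fun_prop) (Eventually.of_forall fun _ => ENNReal.ofReal_lt_top)]
  have h1 := GaussianFourier.integral_cexp_neg_mul_sq_norm_add (V := E) (b := 1 / 2)
    (by norm_num) Complex.I t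
  have h2 := GaussianFourier.integral_cexp_neg_mul_sq_norm (V := E) (b := 1 / 2) (by norm_num)
  have h3 : (Z : ℂ) = ∫ v : E, Complex.exp (-(1 / 2) * ‖v‖ ^ 2) := by
    rw [hZ, ← integral_complex_ofReal]
    refine integral_congr_ae (Eventually.of_forall fun y => ?_)
    simp only [Complex.ofReal_exp]
    congr 1
    push_cast
    ring
  have h4 : ∀ x : E, (ENNReal.ofReal (Z⁻¹ * Real.exp (-(‖x‖ ^ 2 / 2)))).toReal •
      Complex.exp (⟪x, t⟫ * Complex.I)
        = (Z : ℂ)⁻¹ * Complex.exp (-(1 / 2) * ‖x‖ ^ 2 + Complex.I * ⟪t, x⟫) := by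
    intro x
    rw [ENNReal.toReal_ofReal (by positivity), Complex.real_smul, Complex.exp_add,
      real_inner_comm t x]
    push_cast
    rw [mul_assoc, mul_comm Complex.I, show -((‖x‖ : ℂ) ^ 2 / 2) = -(1 / 2) * ‖x‖ ^ 2 by ring]
  simp only [h4]
  rw [integral_const_mul, h1, ← h2, ← h3, inv_mul_cancel_left₀ (by exact_mod_cast hZ0.ne'),
    Complex.I_sq]
  congr 1
  ring

end StdGaussian

variable {d : ℕ}

theorem inner_toEuclideanCLM_left (A : Matrix (Fin d) (Fin d) ℝ) (x y : EuclideanSpace ℝ (Fin d)) :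
    ⟪toEuclideanCLM (𝕜 := ℝ) A x, y⟫ = ⟪x, toEuclideanCLM (𝕜 := ℝ) Aᵀ y⟫ := by
  simp only [PiLp.inner_apply, toEuclideanCLM_apply_apply, RCLike.inner_apply, conj_trivial,
    Finset.mul_sum, Finset.sum_mul]
  rw [Finset.sum_comm]
  refine Finset.sum_congr rfl fun i _ => Finset.sum_congr rfl fun j _ => ?_
  rw [transpose_apply]
  ring

/-- Characteristic functions reduce this to moving `A` to the other side of the inner product, and
also cover singular `A` and `S`, for which there is no density. -/
theorem map_affine_multivariateGaussian {S : Matrix (Fin d) (Fin d) ℝ} (hS : S.PosSemidef)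
    (A : Matrix (Fin d) (Fin d) ℝ) (μ b : EuclideanSpace ℝ (Fin d)) :
    (multivariateGaussian μ S).map (fun y => toEuclideanCLM (𝕜 := ℝ) A y + b)
      = multivariateGaussian (toEuclideanCLM (𝕜 := ℝ) A μ + b) (A * S * Aᵀ) := by
  have hS' : (A * S * Aᵀ).PosSemidef := by
    have := hS.mul_mul_conjTranspose_same A
    rwa [conjTranspose_eq_transpose_of_trivial] at this
  have hm : Measurable fun y : EuclideanSpace ℝ (Fin d) => toEuclideanCLM (𝕜 := ℝ) A y + b := by
      fun_prop
  have : IsProbabilityMeasure ((multivariateGaussian μ S).map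
      fun y => toEuclideanCLM (𝕜 := ℝ) A y + b) := Measure.isProbabilityMeasure_map hm.aemeasurable
  refine Measure.ext_of_charFun (funext fun t => ?_)
  rw [charFun_multivariateGaussian hS', charFun_apply, integral_map hm.aemeasurable
    (Measurable.aestronglyMeasurable (by fun_prop))]
  have h1 : ∀ y : EuclideanSpace ℝ (Fin d), Complex.exp (⟪toEuclideanCLM (𝕜 := ℝ) A y + b,
      t⟫ * Complex.I)
      = Complex.exp (⟪y, toEuclideanCLM (𝕜 := ℝ) Aᵀ t⟫ * Complex.I) *
        Complex.exp (⟪b, t⟫ * Complex.I) := fun y => by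
    rw [inner_add_left, inner_toEuclideanCLM_left, Complex.ofReal_add, add_mul, Complex.exp_add]
  simp only [h1]
  rw [integral_mul_const, ← charFun_apply, charFun_multivariateGaussian hS, ← Complex.exp_add]
  have h2 : ⟪t, toEuclideanCLM (𝕜 := ℝ) A μ + b⟫
      = ⟪toEuclideanCLM (𝕜 := ℝ) Aᵀ t, μ⟫ + ⟪b, t⟫ := by
    rw [inner_add_right, inner_toEuclideanCLM_left, transpose_transpose, real_inner_comm b t]
  have h3 : (t : Fin d → ℝ) ⬝ᵥ (A * S * Aᵀ) *ᵥ t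
      = (toEuclideanCLM (𝕜 := ℝ) Aᵀ t : Fin d → ℝ) ⬝ᵥ
        S *ᵥ (toEuclideanCLM (𝕜 := ℝ) Aᵀ t : Fin d → ℝ) := by
    have h4 : (toEuclideanCLM (𝕜 := ℝ) Aᵀ t : Fin d → ℝ) = Aᵀ *ᵥ t := rfl
    rw [h4, ← Matrix.mulVec_mulVec, ← Matrix.mulVec_mulVec, Matrix.dotProduct_mulVec,
      ← Matrix.mulVec_transpose]
  rw [h2, h3]
  congr 1
  push_cast
  ring

theorem multivariateGaussian_injective {S S' : Matrix (Fin d) (Fin d) ℝ} (hS : S.PosSemidef)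
    (hS' : S'.PosSemidef) {μ μ' : EuclideanSpace ℝ (Fin d)} (h : multivariateGaussian μ S
        = multivariateGaussian μ' S') :
    μ = μ' ∧ S = S' := by
  constructor
  · rw [← integral_id_multivariateGaussian (μ := μ) (S := S), h, integral_id_multivariateGaussian]
  · ext i j
    rw [← covariance_eval_multivariateGaussian (μ := μ) hS i j, h,
      covariance_eval_multivariateGaussian hS']

theorem posSemidef_mul_transpose (U : Matrix (Fin d) (Fin d) ℝ) : (U * Uᵀ).PosSemidef := by
  have := Matrix.posSemidef_self_mul_conjTranspose U
  rwa [conjTranspose_eq_transpose_of_trivial] at this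

namespace NormalParam

instance (θ : NormalParam d) : IsProbabilityMeasure θ.likelihood := by
  rw [likelihood]; infer_instance

theorem likelihood_eq_map (θ : NormalParam d) : θ.likelihood
    = (stdGaussian (EuclideanSpace ℝ (Fin d))).map fun y => toEuclideanCLM (𝕜 := ℝ) θ.chol.toMatrix
        y + θ.mean := by
  rw [← multivariateGaussian_zero_one, map_affine_multivariateGaussian PosSemidef.one, map_zero,
    zero_add, mul_one]
  rfl

/-- The affine equivalence `y ↦ U y + μ`. -/
def measurableEquiv (θ : NormalParam d) : EuclideanSpace ℝ (Fin d) ≃ᵐ EuclideanSpace ℝ (Fin d) where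
  toFun y := toEuclideanCLM (𝕜 := ℝ) θ.chol.toMatrix y + θ.mean
  invFun y := toEuclideanCLM (𝕜 := ℝ) θ.chol.toMatrix⁻¹ (y - θ.mean)
  left_inv y := by
    dsimp only
    rw [add_sub_cancel_right, ← mul_apply_eq_comp, ← map_mul,
      Matrix.nonsing_inv_mul _ θ.chol.isUnit_det, map_one, one_apply_eq_self]
  right_inv y := by
    dsimp only
    rw [← mul_apply_eq_comp, ← map_mul,
      Matrix.mul_nonsing_inv _ θ.chol.isUnit_det, map_one, one_apply_eq_self,
      sub_add_cancel]
  measurable_toFun := by dsimp only [Equiv.coe_fn_mk]; fun_prop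
  measurable_invFun := by dsimp only [Equiv.coe_fn_symm_mk]; fun_prop

/-- The constant is the inverse absolute determinant; as `exp c` it merges with the additive
constant of the log-density. -/
theorem exists_map_volume (θ : NormalParam d) :
    ∃ c : ℝ, (volume : Measure (EuclideanSpace ℝ (Fin d))).map θ.measurableEquiv
        = ENNReal.ofReal (Real.exp c) • volume := by
  set L : EuclideanSpace ℝ (Fin d) →ₗ[ℝ] EuclideanSpace ℝ (Fin d) := (toEuclideanCLM (𝕜 := ℝ)
      θ.chol.toMatrix).toLinearMap with hL
  have hdet : LinearMap.det L ≠ 0 := by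
    have h1 : L * (toEuclideanCLM (𝕜 := ℝ) θ.chol.toMatrix⁻¹).toLinearMap = 1 := by
      ext1 y
      have h := θ.measurableEquiv.right_inv (y + θ.mean)
      have h' : toEuclideanCLM (𝕜 := ℝ) θ.chol.toMatrix
          (toEuclideanCLM (𝕜 := ℝ) θ.chol.toMatrix⁻¹ y) = y := by
        simpa [measurableEquiv] using h
      exact h'
    have h2 := congrArg LinearMap.det h1
    rw [map_mul, map_one] at h2
    exact left_ne_zero_of_mul_eq_one h2
  refine ⟨Real.log |(LinearMap.det L)⁻¹|, ?_⟩
  rw [Real.exp_log (abs_pos.2 (inv_ne_zero hdet)),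
    ← Measure.map_linearMap_addHaar_eq_smul_addHaar (volume : Measure (EuclideanSpace ℝ (Fin d)))
        hdet]
  have h1 : (θ.measurableEquiv : EuclideanSpace ℝ (Fin d) → EuclideanSpace ℝ (Fin d))
      = (fun y => y + θ.mean) ∘ L := rfl
  have hLm : Measurable L := (toEuclideanCLM (𝕜 := ℝ) θ.chol.toMatrix).measurable
  rw [h1, ← Measure.map_map (measurable_add_const _) hLm,
    Measure.map_linearMap_addHaar_eq_smul_addHaar (volume : Measure (EuclideanSpace ℝ (Fin d)))
        hdet, Measure.map_smul,
    map_add_right_eq_self]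

theorem exists_likelihood_eq_withDensity (θ : NormalParam d) : ∃ c : ℝ, θ.likelihood
    = (volume : Measure (EuclideanSpace ℝ (Fin d))).withDensity fun y => ENNReal.ofReal (Real.exp
      (c - ‖toEuclideanCLM (𝕜 := ℝ) θ.chol.toMatrix⁻¹ (y - θ.mean)‖ ^ 2 / 2)) := by
  obtain ⟨c, hc⟩ := exists_stdGaussian_eq_withDensity (E := EuclideanSpace ℝ (Fin d))
  obtain ⟨c', hc'⟩ := θ.exists_map_volume
  refine ⟨c' + c, ?_⟩
  have h1 : θ.likelihood = (stdGaussian (EuclideanSpace ℝ (Fin d))).map θ.measurableEquiv :=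
      θ.likelihood_eq_map
  rw [h1, hc, θ.measurableEquiv.map_withDensity, hc', withDensity_smul_measure,
    ← withDensity_smul _ (Measurable.comp (by fun_prop) θ.measurableEquiv.symm.measurable)]
  congr 1
  ext y
  rw [Pi.smul_apply, smul_eq_mul, Function.comp_apply, ← ENNReal.ofReal_mul (Real.exp_pos _).le,
    ← Real.exp_add, add_sub_assoc]
  rfl

end NormalParam

end

/-! ### Quadratic log-densities and almost everywhere affine action. -/

noncomputable section

open Filter Topology
open scoped RealInnerProductSpace

variable {d : ℕ}


/-- Polynomial functions of degree at most two. -/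
def IsQuadraticFun {E : Type*} [NormedAddCommGroup E] [InnerProductSpace ℝ E] (q : E → ℝ) : Prop :=
  ∃ (A : E →L[ℝ] E) (w : E) (c : ℝ), ∀ y, q y = ⟪A y, y⟫ + ⟪w, y⟫ + c

section Quadratic

variable {E : Type*} [NormedAddCommGroup E] [InnerProductSpace ℝ E]

theorem IsQuadraticFun.continuous {q : E → ℝ} (hq : IsQuadraticFun q) : Continuous q := by
  obtain ⟨A, w, c, h⟩ := hq
  rw [funext h]
  fun_prop

theorem IsQuadraticFun.sub {q r : E → ℝ} (hq : IsQuadraticFun q) (hr : IsQuadraticFun r) :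
    IsQuadraticFun fun y => q y - r y := by
  obtain ⟨A, w, c, h⟩ := hq
  obtain ⟨A', w', c', h'⟩ := hr
  refine ⟨A - A', w - w', c - c', fun y => ?_⟩
  change q y - r y = _
  rw [h, h', _root_.sub_apply, inner_sub_left, inner_sub_left]
  ring

theorem IsQuadraticFun.const_mul_add_const {q : E → ℝ} (hq : IsQuadraticFun q) (a b : ℝ) :
    IsQuadraticFun fun y => a * q y + b := by
  obtain ⟨A, w, c, h⟩ := hq
  refine ⟨a • A, a • w, a * c + b, fun y => ?_⟩
  change a * q y + b = _
  rw [h, _root_.smul_apply, inner_smul_left, inner_smul_left]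
  simp only [conj_trivial]
  ring

theorem isQuadraticFun_norm_sq [CompleteSpace E] (L : E →L[ℝ] E) (b : E) :
    IsQuadraticFun fun y => ‖L (y - b)‖ ^ 2 := by
  refine ⟨L.adjoint * L, -(2 : ℝ) • L.adjoint (L b), ‖L b‖ ^ 2, fun y => ?_⟩
  change ‖L (y - b)‖ ^ 2 = _
  rw [map_sub, norm_sub_sq_real, mul_apply_eq_comp, ContinuousLinearMap.adjoint_inner_left,
    real_inner_self_eq_norm_sq, inner_smul_left, ContinuousLinearMap.adjoint_inner_left,
    real_inner_comm (L y) (L b)]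
  simp only [conj_trivial]
  ring

/-- A quadratic function whose square is quadratic is affine. -/
theorem IsQuadraticFun.affine_of_sq {q r : E → ℝ} (hq : IsQuadraticFun q) (hr : IsQuadraticFun r)
    (h : ∀ y, q y ^ 2 = r y) : ∃ (w : E) (c : ℝ), ∀ y, q y = ⟪w, y⟫ + c := by
  obtain ⟨A, w, c, hq⟩ := hq
  obtain ⟨A', w', c', hr⟩ := hr
  refine ⟨w, c, fun y => ?_⟩
  have key : ∀ t : ℝ, (t ^ 2 * ⟪A y, y⟫ + t * ⟪w, y⟫ + c) ^ 2
      = t ^ 2 * ⟪A' y, y⟫ + t * ⟪w', y⟫ + c' := by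
    intro t
    have h1 := h (t • y)
    rw [hq, hr] at h1
    simp only [map_smul, inner_smul_left, inner_smul_right, conj_trivial] at h1
    linear_combination h1
  -- The fourth central difference at `0, ±1, ±2` annihilates the quadratic side and leaves 24 times
  -- the leading coefficient of the quartic side.
  have hz : ⟪A y, y⟫ ^ 2 = 0 := by
    linear_combination (1 / 24) * (key 2 - 4 * key 1 + 6 * key 0 - 4 * key (-1) + key (-2))
  rw [hq, pow_eq_zero_iff two_ne_zero |>.1 hz, zero_add]

end Quadratic

namespace NormalParam

/-- The logarithm of the density of the normal distribution. -/
def logDensity (θ : NormalParam d) (y : EuclideanSpace ℝ (Fin d)) : ℝ :=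
  θ.exists_likelihood_eq_withDensity.choose -
    ‖toEuclideanCLM (𝕜 := ℝ) θ.chol.toMatrix⁻¹ (y - θ.mean)‖ ^ 2 / 2

theorem likelihood_eq_withDensity (θ : NormalParam d) : θ.likelihood
    = (volume : Measure (EuclideanSpace ℝ (Fin d))).withDensity fun y => ENNReal.ofReal (Real.exp
        (θ.logDensity y)) :=
  θ.exists_likelihood_eq_withDensity.choose_spec

theorem isQuadraticFun_logDensity (θ : NormalParam d) : IsQuadraticFun θ.logDensity := by
  have h := (isQuadraticFun_norm_sq (toEuclideanCLM (𝕜 := ℝ) θ.chol.toMatrix⁻¹)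
    θ.mean).const_mul_add_const (-(1 / 2)) θ.exists_likelihood_eq_withDensity.choose
  convert! h using 1
  ext y
  rw [logDensity]
  ring

theorem measurable_logDensity (θ : NormalParam d) : Measurable θ.logDensity :=
  θ.isQuadraticFun_logDensity.continuous.measurable

theorem volume_absolutelyContinuous (θ : NormalParam d) :
    (volume : Measure (EuclideanSpace ℝ (Fin d))) ≪ θ.likelihood := by
  rw [likelihood_eq_withDensity]
  refine withDensity_absolutelyContinuous' ?_ (Eventually.of_forall fun y => ?_)
  · exact θ.measurable_logDensity.exp.ennreal_ofReal.aemeasurable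
  · exact (ENNReal.ofReal_pos.2 (Real.exp_pos _)).ne'

theorem likelihood_absolutelyContinuous (θ : NormalParam d) : θ.likelihood ≪ volume := by
  rw [likelihood_eq_withDensity]
  exact withDensity_absolutelyContinuous _ _

theorem likelihood_eq_withDensity_likelihood (η η' : NormalParam d) : η.likelihood
    = η'.likelihood.withDensity fun y =>
      ENNReal.ofReal (Real.exp (η.logDensity y - η'.logDensity y)) := by
  have hm : Measurable fun y => ENNReal.ofReal (Real.exp (η.logDensity y - η'.logDensity y)) :=
    (η.measurable_logDensity.sub η'.measurable_logDensity).exp.ennreal_ofReal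
  rw [likelihood_eq_withDensity η', ← withDensity_mul _ η'.measurable_logDensity.exp.ennreal_ofReal
    hm, likelihood_eq_withDensity η]
  congr 1
  ext y
  rw [Pi.mul_apply, ← ENNReal.ofReal_mul (Real.exp_pos _).le, ← Real.exp_add, add_sub_cancel]

/-- Shifting the mean of the standard normal by a unit vector changes the log-density by the
coordinate and a constant. -/
theorem exists_logDensity_sub_eq_coord (i : Fin d) : ∃ (η η' : NormalParam d) (a c : ℝ),
    ∀ y : EuclideanSpace ℝ (Fin d),
    y i = a * (η.logDensity y - η'.logDensity y) + c := by
  set η : NormalParam d := ⟨1, EuclideanSpace.single i 1⟩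
  set η' : NormalParam d := ⟨1, 0⟩
  refine ⟨η, η', 1, η'.exists_likelihood_eq_withDensity.choose
    - η.exists_likelihood_eq_withDensity.choose + 1 / 2, fun y => ?_⟩
  have h1 : ‖toEuclideanCLM (𝕜 := ℝ) η.chol.toMatrix⁻¹ (y - η.mean)‖ ^ 2
      = ‖y‖ ^ 2 - 2 * y i + 1 := by
    change ‖toEuclideanCLM (𝕜 := ℝ) (1 : Matrix (Fin d) (Fin d) ℝ)⁻¹
      (y - EuclideanSpace.single i 1)‖ ^ 2 = _
    rw [inv_one, map_one, one_apply_eq_self, norm_sub_sq_real, EuclideanSpace.inner_single_right]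
    simp
  have h2 : ‖toEuclideanCLM (𝕜 := ℝ) η'.chol.toMatrix⁻¹ (y - η'.mean)‖ ^ 2 = ‖y‖ ^ 2 := by
    change ‖toEuclideanCLM (𝕜 := ℝ) (1 : Matrix (Fin d) (Fin d) ℝ)⁻¹ (y - 0)‖ ^ 2 = _
    rw [inv_one, map_one, one_apply_eq_self, sub_zero]
  rw [logDensity, logDensity, h1, h2]
  ring

/-- Halving the standard deviation in direction `i` adds `3 * y i ^ 2` to the squared norm, so the
log-density changes by `-(3/2) * y i ^ 2` and a constant; hence the factor `-(2/3)`. -/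
theorem exists_logDensity_sub_eq_coord_sq (i : Fin d) : ∃ (η η' : NormalParam d) (a c : ℝ),
    ∀ y : EuclideanSpace ℝ (Fin d), y i ^ 2 = a * (η.logDensity y - η'.logDensity y) + c := by
  set w : Fin d → ℝ := fun j => if j = i then 2 else 1 with hw
  set W : PosUpper d := ⟨diagonal w, fun _ _ h => diagonal_apply_ne _ h.ne', fun j => by
    rw [diagonal_apply_eq, hw]; dsimp only; split_ifs <;> norm_num⟩ with hW
  set η : NormalParam d := ⟨W⁻¹, 0⟩
  set η' : NormalParam d := ⟨1, 0⟩
  refine ⟨η, η', -(2 / 3), 2 / 3 * (η.exists_likelihood_eq_withDensity.choose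
    - η'.exists_likelihood_eq_withDensity.choose), fun y => ?_⟩
  have h1 : ‖toEuclideanCLM (𝕜 := ℝ) η.chol.toMatrix⁻¹ (y - η.mean)‖ ^ 2
      = ‖y‖ ^ 2 + 3 * y i ^ 2 := by
    change ‖toEuclideanCLM (𝕜 := ℝ) (W.toMatrix⁻¹)⁻¹ (y - 0)‖ ^ 2 = _
    rw [Matrix.nonsing_inv_nonsing_inv _ W.isUnit_det, sub_zero, EuclideanSpace.real_norm_sq_eq,
      EuclideanSpace.real_norm_sq_eq]
    have h3 : ∀ j, toEuclideanCLM (𝕜 := ℝ) W.toMatrix y j ^ 2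
        = y j ^ 2 + if j = i then 3 * y i ^ 2 else 0 := by
      intro j
      have h4 : toEuclideanCLM (𝕜 := ℝ) W.toMatrix y j = w j * y j := by
        rw [toEuclideanCLM_apply_apply]
        simp [hW, diagonal_apply]
      rw [h4, hw]
      dsimp only
      split_ifs with hj
      · rw [hj]; ring
      · ring
    simp only [h3, Finset.sum_add_distrib, Finset.sum_ite_eq', Finset.mem_univ, if_true]
  have h2 : ‖toEuclideanCLM (𝕜 := ℝ) η'.chol.toMatrix⁻¹ (y - η'.mean)‖ ^ 2 = ‖y‖ ^ 2 := by
    change ‖toEuclideanCLM (𝕜 := ℝ) (1 : Matrix (Fin d) (Fin d) ℝ)⁻¹ (y - 0)‖ ^ 2 = _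
    rw [inv_one, map_one, one_apply_eq_self, sub_zero]
  rw [logDensity, logDensity, h1, h2]
  ring

end NormalParam

section Action

variable {G : Type*} [Group G] [MulAction G (EuclideanSpace ℝ (Fin d))]
  [MulAction G (NormalParam d)]

/-- The likelihood family is equivariant under the two actions. -/
def IsEquivariant (G : Type*) [Group G] (d : ℕ) [MulAction G (EuclideanSpace ℝ (Fin d))]
    [MulAction G (NormalParam d)] : Prop :=
  ∀ (g : G) (θ : NormalParam d), θ.likelihood.map (fun y => g • y) = (g • θ).likelihood

theorem isEquivariant_of_image (hm : ∀ g : G, Measurable fun y : EuclideanSpace ℝ (Fin d) => g • y)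
    (hinv : ∀ (g : G) (θ : NormalParam d) (A : Set (EuclideanSpace ℝ (Fin d))),
      MeasurableSet A → θ.likelihood A = (g • θ).likelihood ((fun y => g • y) '' A)) :
    IsEquivariant G d := by
  intro g θ
  ext A hA
  rw [Measure.map_apply (hm g) hA, hinv g θ _ (hm g hA),
    Set.image_preimage_eq _ (MulAction.surjective g)]

theorem quasiMeasurePreserving_smul_of_isEquivariant (hm : ∀ g : G,
    Measurable fun y : EuclideanSpace ℝ (Fin d) => g • y)
    (heq : IsEquivariant G d) (g : G) :
    Measure.QuasiMeasurePreserving (fun y : EuclideanSpace ℝ (Fin d) => g • y) volume volume := by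
  refine ⟨hm g, ?_⟩
  have h1 : (volume : Measure (EuclideanSpace ℝ (Fin d))) ≪ (NormalParam.std d).likelihood :=
    NormalParam.volume_absolutelyContinuous _
  refine (h1.map (hm g)).trans ?_
  rw [heq]
  exact NormalParam.likelihood_absolutelyContinuous _

/-- Uniqueness of the Radon–Nikodym derivative of one likelihood against another. Differences are
used because a single Lebesgue density would bring in an unknown Jacobian, whereas the ratio is
intrinsic. -/
theorem ae_logDensity_sub_smul (hm : ∀ g : G, Measurable fun y : EuclideanSpace ℝ (Fin d) => g • y)
    (heq : IsEquivariant G d) (g : G) (η η' : NormalParam d) :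
    ∀ᵐ y ∂(volume : Measure (EuclideanSpace ℝ (Fin d))),
        η.logDensity (g • y) - η'.logDensity (g • y)
      = (g⁻¹ • η).logDensity y - (g⁻¹ • η').logDensity y := by
  let e : EuclideanSpace ℝ (Fin d) ≃ᵐ EuclideanSpace ℝ (Fin d) := ⟨MulAction.toPerm g⁻¹, hm g⁻¹, by
    have : ((MulAction.toPerm g⁻¹ : Equiv.Perm (EuclideanSpace ℝ (Fin d))).symm :
        EuclideanSpace ℝ (Fin d) → EuclideanSpace ℝ (Fin d)) = fun y => g • y := by
      ext1 y
      rw [Equiv.symm_apply_eq, MulAction.toPerm_apply, inv_smul_smul]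
    rw [this]
    exact hm g⟩
  have he : ∀ y, e.symm y = g • y := fun y => by
    rw [MeasurableEquiv.symm_apply_eq]
    exact (inv_smul_smul g y).symm
  have hmap : ∀ θ : NormalParam d, θ.likelihood.map e = (g⁻¹ • θ).likelihood := fun θ => heq g⁻¹ θ
  have h1 := η.likelihood_eq_withDensity_likelihood η'
  have h2 := congrArg (Measure.map e) h1
  rw [e.map_withDensity, hmap, hmap,
    (g⁻¹ • η).likelihood_eq_withDensity_likelihood (g⁻¹ • η')] at h2
  have hmeas : ∀ θ θ' : NormalParam d, Measurable fun y : EuclideanSpace ℝ (Fin d) =>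
      ENNReal.ofReal (Real.exp (θ.logDensity y - θ'.logDensity y)) := fun θ θ' =>
    (θ.measurable_logDensity.sub θ'.measurable_logDensity).exp.ennreal_ofReal
  have h3 := (withDensity_eq_iff_of_sigmaFinite (hmeas _ _).aemeasurable
    ((hmeas _ _).comp e.symm.measurable).aemeasurable).1 h2
  filter_upwards [(g⁻¹ • η').volume_absolutelyContinuous.ae_le h3] with y hy
  rw [Function.comp_apply, he] at hy
  exact Real.exp_injective ((ENNReal.ofReal_eq_ofReal_iff (Real.exp_pos _).le
    (Real.exp_pos _).le).1 hy).symm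

/-- Every group element acts by an affine map, up to a null set. -/
theorem exists_ae_smul_eq_affine (hm : ∀ g : G,
    Measurable fun y : EuclideanSpace ℝ (Fin d) => g • y)
    (heq : IsEquivariant G d) (g : G) : ∃ (A : Matrix (Fin d) (Fin d) ℝ)
        (b : EuclideanSpace ℝ (Fin d)),
    ∀ᵐ y ∂(volume : Measure (EuclideanSpace ℝ (Fin d))), g • y
        = toEuclideanCLM (𝕜 := ℝ) A y + b := by
  have hquad : ∀ f : EuclideanSpace ℝ (Fin d) → ℝ, (∃ (η η' : NormalParam d) (a c : ℝ),
      ∀ y : EuclideanSpace ℝ (Fin d), f y = a * (η.logDensity y - η'.logDensity y) + c) →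
      ∃ q : EuclideanSpace ℝ (Fin d) → ℝ, IsQuadraticFun q ∧
        ∀ᵐ y ∂(volume : Measure (EuclideanSpace ℝ (Fin d))), f (g • y) = q y := by
    rintro f ⟨η, η', a, c, h⟩
    refine ⟨_, ((g⁻¹ • η).isQuadraticFun_logDensity.sub
      (g⁻¹ • η').isQuadraticFun_logDensity).const_mul_add_const a c, ?_⟩
    filter_upwards [ae_logDensity_sub_smul hm heq g η η'] with y hy
    rw [h, hy]
  have hcoord : ∀ i, ∃ (w : EuclideanSpace ℝ (Fin d)) (c : ℝ),
      ∀ᵐ y ∂(volume : Measure (EuclideanSpace ℝ (Fin d))), (g • y) i = ⟪w, y⟫ + c := by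
    intro i
    obtain ⟨q, hq, hqy⟩ := hquad (fun y => y i) (NormalParam.exists_logDensity_sub_eq_coord i)
    obtain ⟨r, hr, hry⟩ := hquad (fun y => y i ^ 2)
        (NormalParam.exists_logDensity_sub_eq_coord_sq i)
    have h1 : (fun y => q y ^ 2) =ᵐ[(volume : Measure (EuclideanSpace ℝ (Fin d)))] r := by
      filter_upwards [hqy, hry] with y h1 h2
      rw [← h1, ← h2]
    -- Continuous functions equal almost everywhere are equal, so the square of `q` is quadratic at
    -- every point.
    have h2 := (Continuous.ae_eq_iff_eq _ (hq.continuous.pow 2) hr.continuous).1 h1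
    obtain ⟨w, c, hwc⟩ := hq.affine_of_sq hr (congrFun h2)
    refine ⟨w, c, ?_⟩
    filter_upwards [hqy] with y hy
    rw [hy, hwc]
  choose w c hwc using hcoord
  refine ⟨Matrix.of fun i j => w i j, WithLp.toLp 2 c, ?_⟩
  filter_upwards [ae_all_iff.2 hwc] with y hy
  ext i
  rw [hy, PiLp.add_apply, toEuclideanCLM_apply_apply, PiLp.inner_apply]
  simp [mul_comm]

end Action

end

/-! ### The affine representation and its effect on parameters. -/

noncomputable section

open Filter Topology

variable {d : ℕ}

theorem toEuclideanCLM_add_injective {A A' : Matrix (Fin d) (Fin d) ℝ}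
    {b b' : EuclideanSpace ℝ (Fin d)}
    (h : ∀ y, toEuclideanCLM (𝕜 := ℝ) A y + b = toEuclideanCLM (𝕜 := ℝ) A' y + b') :
    A = A' ∧ b = b' := by
  have hb : b = b' := by simpa using h 0
  refine ⟨(toEuclideanCLM (𝕜 := ℝ) (n := Fin d)).injective ?_, hb⟩
  ext1 y
  have := h y
  rwa [hb, add_left_inj] at this

theorem ae_toEuclideanCLM_add_injective {A A' : Matrix (Fin d) (Fin d) ℝ}
    {b b' : EuclideanSpace ℝ (Fin d)}
    (h : ∀ᵐ y ∂(volume : Measure (EuclideanSpace ℝ (Fin d))),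
      toEuclideanCLM (𝕜 := ℝ) A y + b = toEuclideanCLM (𝕜 := ℝ) A' y + b') :
    A = A' ∧ b = b' :=
  toEuclideanCLM_add_injective <| congrFun <|
    (Continuous.ae_eq_iff_eq (volume : Measure (EuclideanSpace ℝ (Fin d)))
      (by fun_prop) (by fun_prop)).1 h

variable {G : Type*} [Group G] [MulAction G (EuclideanSpace ℝ (Fin d))]

/-- The homomorphism `φ` into affine matrices describes the action up to null sets. -/
def IsAffineRepresentation (φ : G →* Matrix (Fin (d + 1)) (Fin (d + 1)) ℝ)
    (A : G → Matrix (Fin d) (Fin d) ℝ) (b : G → EuclideanSpace ℝ (Fin d)) : Prop :=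
  (∀ g, φ g = affineMatrix (A g) (b g)) ∧ ∀ g, ∀ᵐ y ∂(volume : Measure (EuclideanSpace ℝ (Fin d))),
    g • y = toEuclideanCLM (𝕜 := ℝ) (A g) y + b g

theorem exists_isAffineRepresentation [MulAction G (NormalParam d)]
    (hm : ∀ g : G, Measurable fun y : EuclideanSpace ℝ (Fin d) => g • y)
    (heq : IsEquivariant G d) :
    ∃ (φ : G →* Matrix (Fin (d + 1)) (Fin (d + 1)) ℝ) (A : G → Matrix (Fin d) (Fin d) ℝ)
      (b : G → EuclideanSpace ℝ (Fin d)), IsAffineRepresentation φ A b := by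
  choose A b hAb using exists_ae_smul_eq_affine (G := G) hm heq
  have hone : A 1 = 1 ∧ b 1 = 0 := by
    refine ae_toEuclideanCLM_add_injective ?_
    filter_upwards [hAb 1] with y hy
    rw [← hy, one_smul, map_one, one_apply_eq_self, add_zero]
  -- Affine maps agreeing almost everywhere coincide, so the cocycle identities hold exactly.
  -- Composing the exceptional sets uses that `h` pulls null sets back to null sets.
  have hmul : ∀ g h, A (g * h) = A g * A h ∧
      b (g * h) = toEuclideanCLM (𝕜 := ℝ) (A g) (b h) + b g := by
    intro g h
    refine ae_toEuclideanCLM_add_injective ?_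
    filter_upwards [hAb (g * h), hAb h,
      (quasiMeasurePreserving_smul_of_isEquivariant hm heq h).ae (hAb g)] with y h1 h2 h3
    rw [← h1, mul_smul, h3, h2, map_add, map_mul, mul_apply_eq_comp, add_assoc]
  refine ⟨⟨⟨fun g => affineMatrix (A g) (b g), ?_⟩, fun g h => ?_⟩, A, b, fun g => rfl, hAb⟩
  · rw [hone.1, hone.2, affineMatrix_one]
  · dsimp only
    rw [affineMatrix_mul, (hmul g h).1, (hmul g h).2]

namespace IsAffineRepresentation

variable {φ : G →* Matrix (Fin (d + 1)) (Fin (d + 1)) ℝ} {A : G → Matrix (Fin d) (Fin d) ℝ}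
  {b : G → EuclideanSpace ℝ (Fin d)}

theorem map_one (h : IsAffineRepresentation φ A b) : A 1 = 1 ∧ b 1 = 0 := by
  have h1 := h.1 1
  rw [_root_.map_one, ← affineMatrix_one] at h1
  exact ⟨(affineMatrix_injective h1).1.symm, (affineMatrix_injective h1).2.symm⟩

theorem map_mul (h : IsAffineRepresentation φ A b) (g g' : G) : A (g * g') = A g * A g' ∧
    b (g * g') = toEuclideanCLM (𝕜 := ℝ) (A g) (b g') + b g := by
  have h1 := h.1 (g * g')
  rw [_root_.map_mul, h.1, h.1, affineMatrix_mul] at h1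
  exact ⟨(affineMatrix_injective h1).1.symm, (affineMatrix_injective h1).2.symm⟩

theorem mul_apply (h : IsAffineRepresentation φ A b) (g g' : G) (y : EuclideanSpace ℝ (Fin d)) :
    toEuclideanCLM (𝕜 := ℝ) (A (g * g')) y + b (g * g')
      = toEuclideanCLM (𝕜 := ℝ) (A g) (toEuclideanCLM (𝕜 := ℝ) (A g') y + b g') + b g := by
  rw [(h.map_mul g g').1, (h.map_mul g g').2, map_add, _root_.map_mul, mul_apply_eq_comp,
    add_assoc]

theorem exists_affineEquiv (h : IsAffineRepresentation φ A b) :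
    ∃ ρ : G →* (EuclideanSpace ℝ (Fin d) ≃ᵃ[ℝ] EuclideanSpace ℝ (Fin d)),
      ∀ g y, ρ g y = toEuclideanCLM (𝕜 := ℝ) (A g) y + b g := by
  let f : G →* (EuclideanSpace ℝ (Fin d) →ᵃ[ℝ] EuclideanSpace ℝ (Fin d)) :=
    { toFun := fun g => ⟨fun y => toEuclideanCLM (𝕜 := ℝ) (A g) y + b g,
        (toEuclideanCLM (𝕜 := ℝ) (A g)).toLinearMap, fun y v => by
          simp only [vadd_eq_add, map_add, ContinuousLinearMap.coe_coe, add_assoc]⟩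
      map_one' := by
        ext1 y
        change toEuclideanCLM (𝕜 := ℝ) (A 1) y + b 1 = y
        rw [h.map_one.1, h.map_one.2, _root_.map_one, one_apply_eq_self, add_zero]
      map_mul' := fun g g' => by
        ext1 y
        exact h.mul_apply g g' y }
  exact ⟨AffineEquiv.equivUnitsAffineMap.symm.toMonoidHom.comp f.toHomUnits, fun g y => rfl⟩

/-- The image of a normal law is computed twice, by equivariance and as an affine image; mean and
covariance determine the law's parameters. -/
theorem mean_smul_and_cov_smul [MulAction G (NormalParam d)] (heq : IsEquivariant G d)
    (h : IsAffineRepresentation φ A b) (g : G) (θ : NormalParam d) :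
    (g • θ).mean = toEuclideanCLM (𝕜 := ℝ) (A g) θ.mean + b g ∧
      (g • θ).chol.toMatrix * (g • θ).chol.toMatrixᵀ
        = A g * (θ.chol.toMatrix * θ.chol.toMatrixᵀ) * (A g)ᵀ := by
  have h1 : θ.likelihood.map (fun y => g • y)
      = θ.likelihood.map fun y => toEuclideanCLM (𝕜 := ℝ) (A g) y + b g :=
    Measure.map_congr (θ.likelihood_absolutelyContinuous.ae_le (h.2 g))
  rw [heq, NormalParam.likelihood, NormalParam.likelihood,
    map_affine_multivariateGaussian (posSemidef_mul_transpose _)] at h1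
  refine multivariateGaussian_injective (posSemidef_mul_transpose _) ?_ h1
  have := posSemidef_mul_transpose (A g * θ.chol.toMatrix)
  rwa [transpose_mul, Matrix.mul_assoc, ← Matrix.mul_assoc _ _ (A g)ᵀ,
    ← Matrix.mul_assoc] at this

theorem toMatrix_smul_mul_transpose [MulAction G (NormalParam d)] (heq : IsEquivariant G d)
    (h : IsAffineRepresentation φ A b) (g : G) (θ : NormalParam d) :
    (g • θ).toMatrix * (g • θ).toMatrixᵀ = (φ g * θ.toMatrix) * (φ g * θ.toMatrix)ᵀ := by
  obtain ⟨h1, h2⟩ := h.mean_smul_and_cov_smul heq g θ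
  have h3 : (g • θ).toMatrix = affineMatrix (g • θ).chol.toMatrix (g • θ).mean := rfl
  have h4 : θ.toMatrix = affineMatrix θ.chol.toMatrix θ.mean := rfl
  rw [h3, h4, h.1, affineMatrix_mul, h1]
  refine affineMatrix_mul_transpose_congr ?_ _
  rw [h2, transpose_mul]
  simp only [Matrix.mul_assoc]

/-- Every point is fixed by some nontrivial group element, in the affine representation. -/
theorem exists_ne_one_apply_eq [MulAction G (NormalParam d)] (heq : IsEquivariant G d)
    (hst : IsSimplyTransitive G (NormalParam d)) (hd : 0 < d)
    (h : IsAffineRepresentation φ A b) (y : EuclideanSpace ℝ (Fin d)) :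
    ∃ s : G, s ≠ 1 ∧ toEuclideanCLM (𝕜 := ℝ) (A s) y + b s = y := by
  let W : PosUpper d := ⟨diagonal fun _ => 2, fun _ _ h => diagonal_apply_ne _ h.ne', fun j => by
    rw [diagonal_apply_eq]; norm_num⟩
  -- This `s` doubles the Cholesky factor and keeps the mean `y`, so its affine map fixes `y`
  -- although `s` is not the identity.
  obtain ⟨s, hs, -⟩ := hst ⟨1, y⟩ ⟨W, y⟩
  refine ⟨s, ?_, ?_⟩
  · rintro rfl
    rw [one_smul] at hs
    have h1 := congrArg (fun θ => θ.chol.toMatrix ⟨0, hd⟩ ⟨0, hd⟩) hs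
    simp [W] at h1
  · have h1 := (h.mean_smul_and_cov_smul heq s ⟨1, y⟩).1
    rw [hs] at h1
    exact h1.symm

theorem apply_eq_of_continuous (h : IsAffineRepresentation φ A b) {g : G}
    (hg : Continuous fun y : EuclideanSpace ℝ (Fin d) => g • y) (y : EuclideanSpace ℝ (Fin d)) :
    g • y = toEuclideanCLM (𝕜 := ℝ) (A g) y + b g :=
  congrFun ((Continuous.ae_eq_iff_eq (volume : Measure (EuclideanSpace ℝ (Fin d))) hg
    (by fun_prop)).1 (h.2 g)) y

end IsAffineRepresentation


end

/-! ### Automatic continuity of the affine representation. -/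

noncomputable section

open Filter Topology
open scoped Pointwise

section Steinhaus

variable {G : Type*} [Group G] [TopologicalSpace G] [IsTopologicalGroup G]
  [LocallyCompactSpace G] [MeasurableSpace G] [BorelSpace G] {m : ℕ}

theorem MonoidHom.map_div_matrix {H : Type*} [Group H] (φ : H →* Matrix (Fin m) (Fin m) ℝ)
    (x y : H) : φ (x / y) = φ x * (φ y)⁻¹ := by
  rw [div_eq_mul_inv, map_mul]
  congr 1
  refine (Matrix.inv_eq_right_inv ?_).symm
  rw [← map_mul, mul_inv_cancel, map_one]

/-- A measurable finite-dimensional real representation of a locally compact group is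
continuous. -/
theorem MonoidHom.continuous_of_measurable_matrix (φ : G →* Matrix (Fin m) (Fin m) ℝ)
    (hφ : ∀ i j, Measurable fun g => φ g i j) : Continuous φ := by
  have hm : @Measurable G (Fin m → Fin m → ℝ) _ MeasurableSpace.pi φ :=
    measurable_pi_iff.2 fun i => measurable_pi_iff.2 fun j => hφ i j
  refine continuous_of_continuousAt_one φ fun V hV => ?_
  rw [map_one] at hV
  have hU : ∀ g : G, ∃ U : Set (Matrix (Fin m) (Fin m) ℝ), IsOpen U ∧ φ g ∈ U ∧
      ∀ B ∈ U, ∀ C ∈ U, B * C⁻¹ ∈ V := by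
    intro g
    have hunit : IsUnit (φ g) := (Group.isUnit g).map φ
    have h1 : Tendsto (fun p : Matrix (Fin m) (Fin m) ℝ × Matrix (Fin m) (Fin m) ℝ =>
        p.1 * p.2⁻¹) (𝓝 (φ g) ×ˢ 𝓝 (φ g)) (𝓝 (φ g * (φ g)⁻¹)) :=
      tendsto_fst.mul (tendsto_snd.matrix_inv hunit)
    rw [Matrix.mul_nonsing_inv _ ((Matrix.isUnit_iff_isUnit_det _).1 hunit)] at h1
    obtain ⟨s, hs, hsV⟩ := mem_prod_same_iff.1 (h1 hV)
    obtain ⟨U, hUs, hUo, hgU⟩ := mem_nhds_iff.1 hs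
    exact ⟨U, hUo, hgU, fun B hB C hC => hsV (Set.mk_mem_prod (hUs hB) (hUs hC))⟩
  choose U hUo hgU hUV using hU
  have : SecondCountableTopology (Matrix (Fin m) (Fin m) ℝ) :=
    inferInstanceAs (SecondCountableTopology (Fin m → Fin m → ℝ))
  -- By second countability, countably many of the `U g` cover the image of `φ`, so one preimage has
  -- positive Haar measure within a compact set. By Steinhaus its quotients contain a neighbourhood
  -- of 1, and `φ` maps them into `V`.
  obtain ⟨T, hT, hTU⟩ := TopologicalSpace.isOpen_iUnion_countable U hUo
  let K : TopologicalSpace.PositiveCompacts G := Classical.arbitrary _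
  have hmeas : ∀ g, MeasurableSet (φ ⁻¹' U g) := fun g =>
    hm (t := U g) (IsOpen.measurableSet (α := Fin m → Fin m → ℝ) (hUo g))
  obtain ⟨g, -, hg⟩ : ∃ g ∈ T, 0 < Measure.haar (interior K ∩ φ ⁻¹' U g) := by
    by_contra! hcon
    have h0 : Measure.haar (⋃ g ∈ T, interior (K : Set G) ∩ φ ⁻¹' U g) = 0 :=
      (measure_biUnion_null_iff hT).2 fun g hg => nonpos_iff_eq_zero.1 (hcon g hg)
    refine (isOpen_interior.measure_pos Measure.haar K.interior_nonempty).ne' ?_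
    refine measure_mono_null (fun x hx => ?_) h0
    have hxU : φ x ∈ ⋃ g ∈ T, U g := by
      rw [hTU]
      exact Set.mem_iUnion.2 ⟨x, hgU x⟩
    simp only [Set.mem_iUnion] at hxU ⊢
    obtain ⟨g, hg, hxg⟩ := hxU
    exact ⟨g, hg, hx, hxg⟩
  refine mem_map.2 <| mem_of_superset (Measure.div_mem_nhds_one_of_haar_pos_ne_top Measure.haar _
    (isOpen_interior.measurableSet.inter (hmeas g)) hg
    (mt (measure_mono_top (Set.inter_subset_left.trans interior_subset))
      K.isCompact.measure_ne_top)) ?_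
  rintro _ ⟨x, hx, y, hy, rfl⟩
  rw [Set.mem_preimage]
  change φ (x / y) ∈ V
  rw [φ.map_div_matrix]
  exact hUV g _ hx.2 _ hy.2

end Steinhaus

namespace IsAffineRepresentation

variable {d : ℕ} {G : Type*} [Group G] [MulAction G (EuclideanSpace ℝ (Fin d))]
  [MeasurableSpace G] {φ : G →* Matrix (Fin (d + 1)) (Fin (d + 1)) ℝ}
  {A : G → Matrix (Fin d) (Fin d) ℝ} {b : G → EuclideanSpace ℝ (Fin d)}

/-- The affine image of `v` is the mean of the transported law `N(v, 1)`, an integral of the jointly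
measurable action, so Fubini applies although each pointwise identity holds only almost everywhere.
-/
theorem measurable_apply
    (hY : Measurable fun p : G × EuclideanSpace ℝ (Fin d) => p.1 • p.2)
    (h : IsAffineRepresentation φ A b) (v : EuclideanSpace ℝ (Fin d)) :
    Measurable fun g => toEuclideanCLM (𝕜 := ℝ) (A g) v + b g := by
  set θ : NormalParam d := ⟨1, v⟩ with hθ
  have h1 : ∀ g, ∫ y, g • y ∂θ.likelihood = toEuclideanCLM (𝕜 := ℝ) (A g) v + b g := by
    intro g
    rw [integral_congr_ae (θ.likelihood_absolutelyContinuous.ae_le (h.2 g)),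
      ← integral_map (φ := fun y => toEuclideanCLM (𝕜 := ℝ) (A g) y + b g) (f := fun y => y)
        (by fun_prop) (by fun_prop), NormalParam.likelihood,
      map_affine_multivariateGaussian (posSemidef_mul_transpose _),
      integral_id_multivariateGaussian]
  simp only [← h1]
  exact hY.stronglyMeasurable.integral_prod_right'.measurable

theorem measurable_linear
    (hY : Measurable fun p : G × EuclideanSpace ℝ (Fin d) => p.1 • p.2)
    (h : IsAffineRepresentation φ A b) (i j : Fin d) : Measurable fun g => A g i j := by
  have h1 : ∀ g, A g i j = (toEuclideanCLM (𝕜 := ℝ) (A g) (EuclideanSpace.single j 1) + b g) i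
      - (toEuclideanCLM (𝕜 := ℝ) (A g) 0 + b g) i := by
    intro g
    rw [PiLp.add_apply, PiLp.add_apply, toEuclideanCLM_apply_apply, toEuclideanCLM_apply_apply]
    simp
  have hi : Measurable fun y : EuclideanSpace ℝ (Fin d) => y i := by fun_prop
  simp only [h1]
  exact (hi.comp (h.measurable_apply hY _)).sub (hi.comp (h.measurable_apply hY 0))

theorem measurable_shift
    (hY : Measurable fun p : G × EuclideanSpace ℝ (Fin d) => p.1 • p.2)
    (h : IsAffineRepresentation φ A b) : Measurable b := by
  simpa using h.measurable_apply hY 0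

theorem measurable_uncurry
    (hY : Measurable fun p : G × EuclideanSpace ℝ (Fin d) => p.1 • p.2)
    (h : IsAffineRepresentation φ A b) :
    Measurable fun p : G × EuclideanSpace ℝ (Fin d) =>
      toEuclideanCLM (𝕜 := ℝ) (A p.1) p.2 + b p.1 := by
  refine Measurable.add ?_ ((h.measurable_shift hY).comp measurable_fst)
  refine (WithLp.measurable_toLp 2 (Fin d → ℝ)).comp
    (f := fun p : G × EuclideanSpace ℝ (Fin d) => (A p.1) *ᵥ p.2) (measurable_pi_iff.2 fun i => ?_)
  simp only [Matrix.mulVec, dotProduct]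
  refine Finset.measurable_fun_sum _ fun j _ => ?_
  refine ((h.measurable_linear hY i j).comp measurable_fst).mul ?_
  fun_prop

theorem continuous [TopologicalSpace G] [IsTopologicalGroup G] [LocallyCompactSpace G]
    [BorelSpace G] (hY : Measurable fun p : G × EuclideanSpace ℝ (Fin d) => p.1 • p.2)
    (h : IsAffineRepresentation φ A b) : Continuous φ := by
  refine φ.continuous_of_measurable_matrix fun i j => ?_
  simp only [h.1]
  have hb : ∀ i, Measurable fun g => b g i := fun i =>
    (show Measurable fun y : EuclideanSpace ℝ (Fin d) => y i by fun_prop).comp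
      (h.measurable_shift hY)
  induction i using Fin.lastCases with
  | last => simp only [affineMatrix_row_last]; exact measurable_const
  | cast i =>
    induction j using Fin.lastCases with
    | last => simpa using hb i
    | cast j => simpa using h.measurable_linear hY i j

end IsAffineRepresentation

end

/-! ### Failure of freeness. -/

noncomputable section

open Filter Topology

namespace IsAffineRepresentation

variable {d : ℕ} {G : Type*} [Group G] [MulAction G (EuclideanSpace ℝ (Fin d))]
  [MeasurableSpace G] {φ : G →* Matrix (Fin (d + 1)) (Fin (d + 1)) ℝ}
  {A : G → Matrix (Fin d) (Fin d) ℝ} {b : G → EuclideanSpace ℝ (Fin d)}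

theorem ae_ae_apply_eq
    (hY : Measurable fun p : G × EuclideanSpace ℝ (Fin d) => p.1 • p.2)
    (h : IsAffineRepresentation φ A b) (μ : Measure G) [SFinite μ] :
    ∀ᵐ y ∂(volume : Measure (EuclideanSpace ℝ (Fin d))), ∀ᵐ g ∂μ,
      g • y = toEuclideanCLM (𝕜 := ℝ) (A g) y + b g :=
  (Measure.ae_ae_comm (p := fun g y => g • y = toEuclideanCLM (𝕜 := ℝ) (A g) y + b g)
    (measurableSet_eq_fun hY (h.measurable_uncurry hY))).1
    (Eventually.of_forall h.2)

theorem not_isFreeAction [TopologicalSpace G] [IsTopologicalGroup G] [LocallyCompactSpace G]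
    [SigmaCompactSpace G] [SecondCountableTopology G] [BorelSpace G] [MulAction G (NormalParam d)]
    (hY : Measurable fun p : G × EuclideanSpace ℝ (Fin d) => p.1 • p.2)
    (heq : IsEquivariant G d) (hst : IsSimplyTransitive G (NormalParam d)) (hd : 0 < d)
    (h : IsAffineRepresentation φ A b) : ¬ IsFreeAction G (EuclideanSpace ℝ (Fin d)) := by
  intro hfree
  obtain ⟨y, hy⟩ := (h.ae_ae_apply_eq hY (Measure.haar (G := G))).exists
  obtain ⟨s, hs, hsy⟩ := h.exists_ne_one_apply_eq heq hst hd y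
  -- Right translation preserves Haar null sets, so some `g` is good at `y` together with `g * s`;
  -- both send `y` to the same point, and cancelling `g` gives `s • y = y`.
  obtain ⟨g, hg, hgs⟩ := (hy.and ((quasiMeasurePreserving_mul_right Measure.haar s).ae hy)).exists
  refine hs (hfree s y ?_)
  rw [h.mul_apply, hsy, ← hg, mul_smul] at hgs
  exact MulAction.injective g hgs

end IsAffineRepresentation

end

theorem mainTheorem6 (d : ℕ) (hd : 1 < d)
    (G : Type*) [Group G] [TopologicalSpace G] [IsTopologicalGroup G]
    [LocallyCompactSpace G] [SigmaCompactSpace G] [MeasurableSpace G] [BorelSpace G]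
    [MulAction G (EuclideanSpace ℝ (Fin d))] [MulAction G (NormalParam d)]
    (hY : Measurable fun p : G × EuclideanSpace ℝ (Fin d) => p.1 • p.2)
    (hΘ : Measurable fun p : G × NormalParam d => p.1 • p.2)
    (hst : IsSimplyTransitive G (NormalParam d))
    (hinv : ∀ (g : G) (θ : NormalParam d) (A : Set (EuclideanSpace ℝ (Fin d))),
      MeasurableSet A → θ.likelihood A = (g • θ).likelihood ((fun y => g • y) '' A)) :
    Nonempty (G ≃ₜ* GaussianGroup d) ∧
    (∃ ρ : G →* (EuclideanSpace ℝ (Fin d) ≃ᵃ[ℝ] EuclideanSpace ℝ (Fin d)), ∀ g : G,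
      (∀ᵐ y ∂(volume : Measure (EuclideanSpace ℝ (Fin d))), g • y = ρ g y) ∧
      (Continuous (fun y : EuclideanSpace ℝ (Fin d) => g • y) → ∀ y, g • y = ρ g y)) ∧
    ¬ IsFreeAction G (EuclideanSpace ℝ (Fin d)) := by
  have hm : ∀ g : G, Measurable fun y : EuclideanSpace ℝ (Fin d) => g • y :=
    fun g => hY.comp measurable_prodMk_left
  have heq : IsEquivariant G d := isEquivariant_of_image hm hinv
  obtain ⟨φ, A, b, h⟩ := exists_isAffineRepresentation hm heq
  obtain ⟨ρ, hρ⟩ := h.exists_affineEquiv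
  obtain ⟨-, -, e, -⟩ := exists_continuousMulEquiv_gaussianGroup hst φ (h.continuous hY)
    (fun g => by rw [h.1, affineMatrix_row_last]) (h.toMatrix_smul_mul_transpose heq)
  -- Second countability is inherited through `e` from the matrix group, and is available for the
  -- measure theory of `G` only from here on.
  have : SecondCountableTopology G := e.toHomeomorph.secondCountableTopology
  refine ⟨⟨e⟩, ⟨ρ, fun g => ⟨?_, fun hg y => ?_⟩⟩,
    h.not_isFreeAction hY heq hst (zero_lt_one.trans hd)⟩
  · filter_upwards [h.2 g] with y hy
    rw [hρ, hy]
  · rw [hρ, h.apply_eq_of_continuous hg]
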